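/- A Hopf Galois structure on a finite field extension $L/K$ is a pair $(H,\mu)$, where $H$ is a finite cocommutative $K$-Hopf algebra and $\mu\colon H\to \mathrm{End}_K(L)$ is a $K$-linear map making $L$ a left $H$-module algebra and inducing a bijection $L\otimes_K H\to \mathrm{End}_K(L)$. Let $L/K$ be separable and let $\widetilde L$ be its Galois closure. The type of $(H,\mu)$ is the isomorphism class of the group $N$ for which $\widetilde L\otimes_K H\cong \widetilde L[N]$ as $\widetilde L$-Hopf algebras. Write $C_n$ for the cyclic group of order $n$, $D_{2n}$ for the dihedral group of order $2n$, $(C_p\times C_p)\rtimes C_2$ for the semidirect product in which the generator of $C_2$ acts by inversion, and $\mathrm{Hol}(N)=N\rtimes\mathrm{Aut}(N)$. Let $p$ be an odd prime, and let $L/K$ be a separable field extension of degree $2p^2$. Then either $L/K$ has no Hopf Galois structures, or the set of types of Hopf Galois structures on $L/K$ is one of the following six sets: $$\{D_{2p^2}\},\quad \{(C_p\times C_p)\rtimes C_2\},\quad \{D_{2p^2},\,C_{2p^2}\},\quad \{(C_p\times C_p)\rtimes C_2,\ C_p\times C_{2p}\},$$ $$\{(C_p\times C_p)\rtimes C_2,\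 C_p\times D_{2p}\},\quad \{(C_p\times C_p)\rtimes C_2,\ C_p\times C_{2p},\ C_p\times D_{2p}\}.$$ Moreover, for every odd prime $p$ each of these seven cases occurs. There is a separable extension $L/K$ of degree $2p^2$ with $\mathrm{Gal}(\widetilde L/K)\cong S_{2p^2}$ that has no Hopf Galois structures. The six sets, in the order listed, are the sets of types of suitable separable extensions $L/K$ of degree $2p^2$ with $\mathrm{Gal}(\widetilde L/K)$ isomorphic, respectively, to $\mathrm{Hol}(D_{2p^2})$, $\mathrm{Hol}((C_p\times C_p)\rtimes C_2)$, $C_{2p^2}$, $\mathrm{Hol}(C_p\times C_{2p})$, $\mathrm{Hol}(C_p\times D_{2p})$, $C_p\times C_{2p}$. -/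

import Mathlib

open scoped TensorProduct

universe u v

/-- A Hopf Galois structure on a finite field extension `L / K`: a finite cocommutative `K`-Hopf
algebra `H` together with a Hopf action `μ : H → End_K(L)`, i.e. `L` is a left `H`-module algebra
via `μ`, and the induced `K`-linear map `L ⊗ H → End_K(L)` is bijective. Such an `H` embeds into
`End_K(L)`, so it is no restriction to let it live in the universe of `L`. -/
structure HopfGaloisStructure (K : Type u) (L : Type v) [Field K] [Field L] [Algebra K L] where
  /-- The underlying type of the Hopf algebra. -/
  H : Type v
  [ring : Ring H]
  [hopfAlgebra : HopfAlgebra K H]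
  [finite : Module.Finite K H]
  [cocomm : Coalgebra.IsCocomm K H]
  /-- The action; a `K`-algebra homomorphism, so that `L` is a left `H`-module. -/
  μ : H →ₐ[K] Module.End K L
  /-- `h · 1 = ε(h) 1`. -/
  act_one : ∀ h : H, μ h 1 = algebraMap K L (Coalgebra.counit h)
  /-- `h · (x y) = ∑ (h₁ · x) (h₂ · y)`, where `Δ(h) = ∑ h₁ ⊗ h₂`. -/
  act_mul : ∀ (h : H) (x y : L), μ h (x * y) =
    TensorProduct.lift
      ((LinearMap.mul K L).compl₁₂ (μ.toLinearMap.flip x) (μ.toLinearMap.flip y))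
      (Coalgebra.comul (R := K) h)
  /-- The map `L ⊗ H → End_K(L)`, `x ⊗ h ↦ (y ↦ x (h · y))`, is bijective. -/
  bijective : Function.Bijective
    (TensorProduct.lift
      ((LinearMap.mul K (Module.End K L)).compl₁₂ (Algebra.lmul K L).toLinearMap μ.toLinearMap) :
        L ⊗[K] H →ₗ[K] Module.End K L)

attribute [instance] HopfGaloisStructure.ring HopfGaloisStructure.hopfAlgebra
  HopfGaloisStructure.finite HopfGaloisStructure.cocomm

/-- The normal closure of `L / K` (the Galois closure, if `L / K` is separable). -/
noncomputable abbrev GaloisClosure (K : Type u) (L : Type v) [Field K] [Field L] [Algebra K L] :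
    IntermediateField K (AlgebraicClosure L) :=
  IntermediateField.normalClosure K L (AlgebraicClosure L)

/-- Being isomorphic, as an equivalence relation on (small) groups. -/
def groupIsoSetoid : Setoid GrpCat.{0} where
  r G G' := Nonempty (G ≃* G')
  iseqv := ⟨fun G => ⟨MulEquiv.refl G⟩, fun ⟨e⟩ => ⟨e.symm⟩, fun ⟨e⟩ ⟨f⟩ => ⟨e.trans f⟩⟩

/-- Isomorphism classes of groups. -/
def GroupIsoClass : Type 1 := Quotient groupIsoSetoid

/-- The isomorphism class of a group. -/
def groupIsoClass (G : Type) [Group G] : GroupIsoClass :=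
  Quotient.mk groupIsoSetoid (GrpCat.of G)

/-- The Hopf Galois structure `(H, μ)` on `L / K` has type `T` if `T` is the isomorphism class of a
group `N` such that, with `E` the Galois closure of `L / K`, the `E`-Hopf algebra `E ⊗_K H` is
isomorphic to the group algebra `E[N]`. (A bialgebra isomorphism of Hopf algebras respects the
antipodes. The group `N` is determined by `H` up to isomorphism, as the group of group-like
elements of `E ⊗_K H`.) -/
def HopfGaloisStructure.HasType {K : Type u} {L : Type v} [Field K] [Field L] [Algebra K L]
    (S : HopfGaloisStructure K L) (T : GroupIsoClass) : Prop :=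
  ∃ (N : Type) (_ : Group N), T = groupIsoClass N ∧
    Nonempty ((GaloisClosure K L ⊗[K] S.H) ≃ₐc[GaloisClosure K L]
      MonoidAlgebra (GaloisClosure K L) N)

/-- The set of types of Hopf Galois structures on `L / K`. -/
def hopfGaloisTypes (K : Type u) (L : Type v) [Field K] [Field L] [Algebra K L] :
    Set GroupIsoClass :=
  {T | ∃ S : HopfGaloisStructure K L, S.HasType T}

/-- The cyclic group `C_n` of order `n` (for `n ≠ 0`). -/
abbrev CyclicGrp (n : ℕ) : Type := Multiplicative (ZMod n)

/-- The action of `C_2` on a commutative group in which the generator acts by inversion. -/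
def inversionAction (A : Type) [CommGroup A] : CyclicGrp 2 →* MulAut A where
  toFun z := if z = 1 then 1 else MulEquiv.inv A
  map_one' := if_pos rfl
  map_mul' := by
    have key : ∀ x y : CyclicGrp 2, x ≠ 1 → y ≠ 1 → x * y = 1 := by decide
    intro x y
    by_cases hx : x = 1
    · simp [hx]
    by_cases hy : y = 1
    · simp [hy]
    rw [if_pos (key x y hx hy), if_neg hx, if_neg hy]
    ext a
    simp

/-- `(C_p × C_p) ⋊ C_2`, where the generator of `C_2` acts by inversion. -/
abbrev GenDihedralGrp (p : ℕ) : Type :=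
  (CyclicGrp p × CyclicGrp p) ⋊[inversionAction (CyclicGrp p × CyclicGrp p)] CyclicGrp 2

/-- The holomorph `N ⋊ Aut(N)` of a group `N`. -/
abbrev Holomorph (N : Type) [Group N] : Type :=
  N ⋊[MonoidHom.id (MulAut N)] MulAut N

/-- There is a separable extension `L / K` of degree `n` whose Galois closure has Galois group
isomorphic to `G` over `K`, such that `S` is the set of types of Hopf Galois structures on
`L / K`. -/
def TypesOccur (n : ℕ) (G : Type) [Group G] (S : Set GroupIsoClass) : Prop :=
  ∃ (K L : Type) (_ : Field K) (_ : Field L) (_ : Algebra K L),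
    Algebra.IsSeparable K L ∧ Module.finrank K L = n ∧
    Nonempty ((GaloisClosure K L ≃ₐ[K] GaloisClosure K L) ≃* G) ∧
    hopfGaloisTypes K L = S

-- The first half is the theorem of Greither and Pareigis. Let `E` be the Galois closure, `G =
-- Gal(E/K)` and `X` the set of `K`-embeddings `L → E`. Then `N` is a type of `L/K` exactly when `N`
-- acts regularly on `X` and `G` normalizes this action (`NormalizedRegular`,
-- `mem_hopfGaloisTypes_iff`). Given such an action, `G` acts on `E[N]` through both coefficients
-- and `N`. Galois descent makes `E[N]^G` a `K`-Hopf algebra, acting on `L`, which is the space of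
-- equivariant functions `X → E`. Conversely, the group-like elements of `E ⊗ H` permute `X`
-- regularly. Conversely again, every finite transitive permutation group arises from a separable
-- extension, by permuting the variables of a rational function field
-- (`exists_field_extension_of_action`). Everything is thereby a question about transitive groups of
-- degree `2p²`.
--
-- There are five groups of order `2p²`. In coordinates given by a normalized regular `N`, each
-- element of `G` acts as an automorphism of `N` followed by a right translation. If `N = Z × D` and
-- these automorphisms respect the factors and are compatible with an action of `D` on `Z`, then the
-- same set also carries a normalized regular `Z ⋊ D`. So `C_{2p²}` forces `D_{2p²}`, and both `C_p
-- × C_{2p}` and `C_p × D_{2p}` force `(C_p × C_p) ⋊ C_2`.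
--
-- Cyclic and elementary abelian Sylow `p`-subgroups cannot coexist
-- (`not_normalizedRegular_cyclic_and_elementary`). Some `σ ∈ G` of `p`-power order moves a point
-- `x₀` by a generator `w` of `C_{p²}`, and then `σ^p` moves it by `(1 + A + ⋯ + A^{p-1}) w`, with
-- `A` the action of `σ` by conjugation. For odd `p` this sum is `p` modulo `p²` in the cyclic case,
-- but zero on `C_p × C_p`, where `(A - 1)² = 0`. The six sets are what these constraints leave.
--
-- For the examples, an element of `G` with a fixed point acts as an automorphism of every
-- normalized regular group, so its fixed points form a subgroup of each of them. Conjugations,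
-- transvections and transpositions have numbers of fixed points that rule out the unwanted types.

universe w

/-! ### Tensor products under extension of scalars -/

section Form

variable {K E A : Type*} [Field K] [Field E] [Algebra K E] [Ring A] [Algebra E A] [Algebra K A]
  [IsScalarTower K E A]

/-- The canonical `K`-algebra map `H ⊗_K H → A ⊗_E A` induced by a `K`-algebra map `H → A`. -/
noncomputable def AlgHom.tensorSquareMap {H : Type*} [Ring H] [Algebra K H] (f : H →ₐ[K] A) :
    H ⊗[K] H →ₐ[K] A ⊗[E] A :=
  Algebra.TensorProduct.lift
    ((Algebra.TensorProduct.includeLeft (R := E) (S := K) (A := A) (B := A)).comp f)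
    (((Algebra.TensorProduct.includeRight (R := E) (A := A) (B := A)).restrictScalars K).comp f)
    (fun x y => by
      change _ * _ = _ * _
      simp)

@[simp] lemma AlgHom.tensorSquareMap_tmul {H : Type*} [Ring H] [Algebra K H] (f : H →ₐ[K] A)
    (x y : H) : f.tensorSquareMap (E := E) (x ⊗ₜ y) = f x ⊗ₜ[E] f y := by
  exact (Algebra.TensorProduct.lift_tmul _ _ _ x y).trans (by simp)

/-- The canonical map `W₁ ⊗_K W₂ → V₁ ⊗_E V₂` induced by `K`-linear maps `Wᵢ → Vᵢ`. -/
noncomputable def TensorProduct.mapScalars {W₁ W₂ V₁ V₂ : Type*} [AddCommGroup W₁] [AddCommGroup W₂]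
    [AddCommGroup V₁] [AddCommGroup V₂] [Module K W₁] [Module K W₂] [Module E V₁] [Module E V₂]
    [Module K V₁] [Module K V₂] [IsScalarTower K E V₁] [IsScalarTower K E V₂]
    (f : W₁ →ₗ[K] V₁) (g : W₂ →ₗ[K] V₂) : W₁ ⊗[K] W₂ →ₗ[K] V₁ ⊗[E] V₂ :=
  TensorProduct.lift (((TensorProduct.mk E V₁ V₂).restrictScalars₁₂ K K).compl₁₂ f g)

@[simp] lemma TensorProduct.mapScalars_tmul {W₁ W₂ V₁ V₂ : Type*} [AddCommGroup W₁] [AddCommGroup W₂]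
    [AddCommGroup V₁] [AddCommGroup V₂] [Module K W₁] [Module K W₂] [Module E V₁] [Module E V₂]
    [Module K V₁] [Module K V₂] [IsScalarTower K E V₁] [IsScalarTower K E V₂]
    (f : W₁ →ₗ[K] V₁) (g : W₂ →ₗ[K] V₂) (x : W₁) (y : W₂) :
    TensorProduct.mapScalars (E := E) f g (x ⊗ₜ y) = f x ⊗ₜ g y := rfl

/-- Independence over `E` is essential: an injective `K`-linear `H → A` need not induce an injective
`H ⊗_K H → A ⊗_E A`, but tensor products of `E`-independent families stay `E`-independent. -/
lemma linearIndependent_mapScalars {W₁ W₂ V₁ V₂ : Type*} [AddCommGroup W₁] [AddCommGroup W₂]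
    [AddCommGroup V₁] [AddCommGroup V₂] [Module K W₁] [Module K W₂] [Module E V₁] [Module E V₂]
    [Module K V₁] [Module K V₂] [IsScalarTower K E V₁] [IsScalarTower K E V₂]
    {f : W₁ →ₗ[K] V₁} {g : W₂ →ₗ[K] V₂} {ι κ : Type*} (b : Module.Basis ι K W₁)
    (c : Module.Basis κ K W₂) (hf : LinearIndependent E (f ∘ b)) (hg : LinearIndependent E (g ∘ c)) :
    LinearIndependent E (TensorProduct.mapScalars (E := E) f g ∘ b.tensorProduct c) := by
  have := hf.tmul_of_flat_left hg
  have h : (TensorProduct.mapScalars (E := E) f g ∘ b.tensorProduct c) =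
      fun i : ι × κ => (f ∘ b) i.1 ⊗ₜ[E] (g ∘ c) i.2 := by
    ext ⟨i, j⟩
    simp [Module.Basis.tensorProduct_apply]
  rw [h]
  exact this

lemma Module.Basis.injective_of_linearIndependent {R M M' : Type*} [Ring R] [AddCommGroup M]
    [AddCommGroup M'] [Module R M] [Module R M'] {ι : Type*} (b : Module.Basis ι R M)
    (f : M →ₗ[R] M') (h : LinearIndependent R (f ∘ b)) : Function.Injective f := by
  rw [injective_iff_map_eq_zero]
  intro x hx
  rw [← b.linearCombination_repr x, Finsupp.apply_linearCombination] at hx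
  have := (linearIndependent_iff.1 h) _ hx
  simpa using this

lemma injective_of_linearIndependent_basis {W V : Type*} [AddCommGroup W] [AddCommGroup V]
    [Module K W] [Module E V] [Module K V] [IsScalarTower K E V] (f : W →ₗ[K] V) {ι : Type*}
    (b : Module.Basis ι K W) (hf : LinearIndependent E (f ∘ b)) : Function.Injective f := by
  have h : LinearIndependent K (f ∘ b) := hf.restrict_scalars' K
  exact b.injective_of_linearIndependent f h

end Form

/-! ### Forms of Hopf algebras -/

/-- A `K`-form, inside an `E`-Hopf algebra `A`, of this Hopf algebra. -/
structure HopfForm (K : Type u) (E : Type v) (A : Type w) [Field K] [Field E] [Algebra K E]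
    [Ring A] [HopfAlgebra E A] [Algebra K A] [IsScalarTower K E A] where
  /-- The underlying ring. -/
  carrier : Type w
  [ring : Ring carrier]
  [algebra : Algebra K carrier]
  /-- The inclusion. -/
  val : carrier →ₐ[K] A
  linearIndependent : LinearIndependent E (val ∘ Module.Basis.ofVectorSpace K carrier)
  span_eq_top : Submodule.span E (Set.range val) = ⊤
  counit_mem : ∀ h : carrier, Coalgebra.counit (R := E) (val h) ∈ (Algebra.linearMap K E).range
  comul_mem : ∀ h : carrier, Coalgebra.comul (R := E) (val h) ∈
    (val.tensorSquareMap (E := E)).toLinearMap.range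
  antipode_mem : ∀ h : carrier, HopfAlgebra.antipode E (val h) ∈ val.toLinearMap.range

attribute [instance] HopfForm.ring HopfForm.algebra

namespace HopfForm

variable {K : Type u} {E : Type v} {A : Type w} [Field K] [Field E] [Algebra K E] [Ring A]
  [HopfAlgebra E A]
  [Algebra K A] [IsScalarTower K E A] (F : HopfForm K E A)

lemma tensorSquareMap_toLinearMap : (F.val.tensorSquareMap (E := E)).toLinearMap =
    TensorProduct.mapScalars (E := E) F.val.toLinearMap F.val.toLinearMap := by
  ext; simp

lemma tensorSquareMap_injective : Function.Injective (F.val.tensorSquareMap (E := E)) := by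
  have h := linearIndependent_mapScalars (f := F.val.toLinearMap) (g := F.val.toLinearMap)
    _ _ F.linearIndependent F.linearIndependent
  rw [← tensorSquareMap_toLinearMap] at h
  exact injective_of_linearIndependent_basis (F.val.tensorSquareMap (E := E)).toLinearMap _ h

/-- The canonical map `H ⊗ (H ⊗ H) → A ⊗ (A ⊗ A)`. -/
noncomputable def tensorCubeMap :
    F.carrier ⊗[K] (F.carrier ⊗[K] F.carrier) →ₗ[K] A ⊗[E] (A ⊗[E] A) :=
  TensorProduct.mapScalars F.val.toLinearMap (F.val.tensorSquareMap (E := E)).toLinearMap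

@[simp] lemma tensorCubeMap_tmul (x : F.carrier) (y : F.carrier ⊗[K] F.carrier) :
    F.tensorCubeMap (x ⊗ₜ y) = (F.val x) ⊗ₜ[E] F.val.tensorSquareMap (E := E) y := rfl

lemma tensorCubeMap_injective : Function.Injective F.tensorCubeMap := by
  have h := linearIndependent_mapScalars (f := F.val.toLinearMap) (g := F.val.toLinearMap)
    _ _ F.linearIndependent F.linearIndependent
  rw [← tensorSquareMap_toLinearMap] at h
  exact injective_of_linearIndependent_basis F.tensorCubeMap _
    (linearIndependent_mapScalars (f := F.val.toLinearMap)
      (g := (F.val.tensorSquareMap (E := E)).toLinearMap) _ _ F.linearIndependent h)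

/-- The comultiplication of a form. -/
noncomputable def comul : F.carrier →ₗ[K] F.carrier ⊗[K] F.carrier :=
  (LinearEquiv.ofInjective (F.val.tensorSquareMap (E := E)).toLinearMap
    F.tensorSquareMap_injective).symm.toLinearMap ∘ₗ
  LinearMap.codRestrict _
    (((Coalgebra.comul (R := E) (A := A)).restrictScalars K) ∘ₗ F.val.toLinearMap) F.comul_mem

@[simp] lemma tensorSquareMap_comul (h : F.carrier) :
    F.val.tensorSquareMap (E := E) (F.comul h) = Coalgebra.comul (R := E) (F.val h) := by
  have := LinearEquiv.ofInjective_symm_apply (f := (F.val.tensorSquareMap (E := E)).toLinearMap)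
    (h := F.tensorSquareMap_injective) ⟨_, F.comul_mem h⟩
  exact this

/-- The counit of a form. -/
noncomputable def counit : F.carrier →ₗ[K] K :=
  (LinearEquiv.ofInjective (Algebra.linearMap K E)
    (algebraMap K E).injective).symm.toLinearMap ∘ₗ
  LinearMap.codRestrict _
    (((Coalgebra.counit (R := E) (A := A)).restrictScalars K) ∘ₗ F.val.toLinearMap) F.counit_mem

@[simp] lemma algebraMap_counit (h : F.carrier) :
    algebraMap K E (F.counit h) = Coalgebra.counit (R := E) (F.val h) := by
  have := LinearEquiv.ofInjective_symm_apply (f := Algebra.linearMap K E)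
    (h := (algebraMap K E).injective) ⟨_, F.counit_mem h⟩
  exact this

lemma val_injective : Function.Injective F.val :=
  injective_of_linearIndependent_basis F.val.toLinearMap _ F.linearIndependent

/-- The antipode of a form. -/
noncomputable def antipode : F.carrier →ₗ[K] F.carrier :=
  (LinearEquiv.ofInjective F.val.toLinearMap F.val_injective).symm.toLinearMap ∘ₗ
  LinearMap.codRestrict _
    (((HopfAlgebra.antipode E (A := A)).restrictScalars K) ∘ₗ F.val.toLinearMap) F.antipode_mem

@[simp] lemma val_antipode (h : F.carrier) :
    F.val (F.antipode h) = HopfAlgebra.antipode E (F.val h) := by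
  have := LinearEquiv.ofInjective_symm_apply (f := F.val.toLinearMap)
    (h := F.val_injective) ⟨_, F.antipode_mem h⟩
  exact this

/-- The structure maps are those of `A`, pulled back along injections of the tensor powers of the
form into those of `A`; each axiom is therefore inherited from `A`. -/
noncomputable instance : Coalgebra K F.carrier where
  comul := F.comul
  counit := F.counit
  coassoc := by
    have h1 : ∀ (s : F.carrier ⊗[K] F.carrier) (b : F.carrier),
        F.tensorCubeMap (TensorProduct.assoc K _ _ _ (s ⊗ₜ b)) =
        TensorProduct.assoc E A A A (F.val.tensorSquareMap s ⊗ₜ (F.val b)) := by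
      intro s b
      induction s with
      | zero => simp
      | add x y hx hy => simp [TensorProduct.add_tmul, hx, hy]
      | tmul x y => simp
    have h2 : ∀ t : F.carrier ⊗[K] F.carrier,
        F.tensorCubeMap (TensorProduct.assoc K _ _ _ (F.comul.rTensor _ t)) =
        TensorProduct.assoc E A A A ((Coalgebra.comul (R := E) (A := A)).rTensor A
          (F.val.tensorSquareMap t)) := by
      intro t
      induction t with
      | zero => simp
      | add x y hx hy => simp [hx, hy]
      | tmul x y => simp [h1]
    have h3 : ∀ t : F.carrier ⊗[K] F.carrier,
        F.tensorCubeMap (F.comul.lTensor _ t) =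
        (Coalgebra.comul (R := E) (A := A)).lTensor A (F.val.tensorSquareMap t) := by
      intro t
      induction t with
      | zero => simp
      | add x y hx hy => simp [hx, hy]
      | tmul x y => simp
    ext h
    apply F.tensorCubeMap_injective
    simp [h2, h3]
  rTensor_counit_comp_comul := by
    have h1 : ∀ t : F.carrier ⊗[K] F.carrier,
        F.val ((TensorProduct.lid K _ (F.counit.rTensor _ t) : F.carrier)) =
        TensorProduct.lid E A ((Coalgebra.counit (R := E) (A := A)).rTensor A
          (F.val.tensorSquareMap t)) := by
      intro t
      induction t with
      | zero => simp
      | add x y hx hy => simp [hx, hy]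
      | tmul x y =>
        simp only [LinearMap.rTensor_tmul, TensorProduct.lid_tmul, AlgHom.tensorSquareMap_tmul,
          map_smul, ← F.algebraMap_counit,
          algebraMap_smul]
    ext h
    apply (TensorProduct.lid K _).injective
    apply F.val_injective
    simp [h1]
  lTensor_counit_comp_comul := by
    have h1 : ∀ t : F.carrier ⊗[K] F.carrier,
        F.val ((TensorProduct.rid K _ (F.counit.lTensor _ t) : F.carrier)) =
        TensorProduct.rid E A ((Coalgebra.counit (R := E) (A := A)).lTensor A
          (F.val.tensorSquareMap t)) := by
      intro t
      induction t with
      | zero => simp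
      | add x y hx hy => simp [hx, hy]
      | tmul x y =>
        simp only [LinearMap.lTensor_tmul, TensorProduct.rid_tmul, AlgHom.tensorSquareMap_tmul,
          map_smul, ← F.algebraMap_counit,
          algebraMap_smul]
    ext h
    apply (TensorProduct.rid K _).injective
    apply F.val_injective
    simp [h1]

noncomputable instance : Bialgebra K F.carrier :=
  Bialgebra.mk' K F.carrier
    (by
      apply (algebraMap K E).injective
      exact (F.algebraMap_counit 1).trans (by simp))
    (by
      intro a b
      apply (algebraMap K E).injective
      refine Eq.trans ?_ (map_mul _ _ _).symm
      change algebraMap K E (F.counit (a * b)) =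
        algebraMap K E (F.counit a) * algebraMap K E (F.counit b)
      simp)
    (by
      apply F.tensorSquareMap_injective
      exact (F.tensorSquareMap_comul 1).trans (by simp))
    (by
      intro a b
      apply F.tensorSquareMap_injective
      refine Eq.trans ?_ (map_mul _ _ _).symm
      change F.val.tensorSquareMap (E := E) (F.comul (a * b)) =
        F.val.tensorSquareMap (F.comul a) * F.val.tensorSquareMap (F.comul b)
      simp)

lemma comul_eq (h : F.carrier) : Coalgebra.comul (R := K) h = F.comul h := rfl

lemma counit_eq (h : F.carrier) : Coalgebra.counit (R := K) h = F.counit h := rfl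

noncomputable instance : HopfAlgebra K F.carrier where
  antipode := F.antipode
  mul_antipode_rTensor_comul := by
    have h1 : ∀ t : F.carrier ⊗[K] F.carrier,
        F.val ((LinearMap.mul' K F.carrier (F.antipode.rTensor _ t) : F.carrier)) =
        LinearMap.mul' E A ((HopfAlgebra.antipode E (A := A)).rTensor A
          (F.val.tensorSquareMap t)) := by
      intro t
      induction t with
      | zero => simp
      | add x y hx hy => simp [hx, hy]
      | tmul x y => simp
    ext h
    apply F.val_injective
    simp only [LinearMap.comp_apply, h1, comul_eq, tensorSquareMap_comul, counit_eq]
    rw [HopfAlgebra.mul_antipode_rTensor_comul_apply, ← F.algebraMap_counit,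
      ← IsScalarTower.algebraMap_apply]
    exact (F.val.commutes _).symm
  mul_antipode_lTensor_comul := by
    have h1 : ∀ t : F.carrier ⊗[K] F.carrier,
        F.val ((LinearMap.mul' K F.carrier (F.antipode.lTensor _ t) : F.carrier)) =
        LinearMap.mul' E A ((HopfAlgebra.antipode E (A := A)).lTensor A
          (F.val.tensorSquareMap t)) := by
      intro t
      induction t with
      | zero => simp
      | add x y hx hy => simp [hx, hy]
      | tmul x y => simp
    ext h
    apply F.val_injective
    simp only [LinearMap.comp_apply, h1, comul_eq, tensorSquareMap_comul, counit_eq]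
    rw [HopfAlgebra.mul_antipode_lTensor_comul_apply, ← F.algebraMap_counit,
      ← IsScalarTower.algebraMap_apply]
    exact (F.val.commutes _).symm

instance [Coalgebra.IsCocomm E A] : Coalgebra.IsCocomm K F.carrier where
  comm_comp_comul := by
    have h1 : ∀ t : F.carrier ⊗[K] F.carrier,
        F.val.tensorSquareMap (E := E) (TensorProduct.comm K _ _ t) =
        TensorProduct.comm E A A (F.val.tensorSquareMap t) := by
      intro t
      induction t with
      | zero => simp
      | add x y hx hy => simp [hx, hy]
      | tmul x y => simp
    ext h
    apply F.tensorSquareMap_injective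
    simp only [LinearMap.comp_apply, LinearEquiv.coe_coe, h1, comul_eq, tensorSquareMap_comul,
      Coalgebra.comm_comul]

/-- The canonical map `E ⊗_K H → A`. -/
noncomputable def baseChangeAlgHom : E ⊗[K] F.carrier →ₐ[E] A :=
  Algebra.TensorProduct.lift (Algebra.ofId E A) F.val
    (fun _ _ => Algebra.commutes _ _)

@[simp] lemma baseChangeAlgHom_tmul (e : E) (h : F.carrier) :
    F.baseChangeAlgHom (e ⊗ₜ h) = e • (F.val h) := by
  exact (Algebra.TensorProduct.lift_tmul _ _ _ e h).trans (Algebra.smul_def _ _).symm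

/-- A `K`-basis of the form is `E`-independent in `A`, which gives injectivity; the form spans `A`
over `E`, which gives surjectivity. -/
lemma baseChangeAlgHom_bijective : Function.Bijective F.baseChangeAlgHom := by
  constructor
  · have h : LinearIndependent E (F.baseChangeAlgHom.toLinearMap ∘
        (Module.Basis.ofVectorSpace K F.carrier).baseChange E) := by
      convert F.linearIndependent using 1
      ext i
      simp
    exact Module.Basis.injective_of_linearIndependent _ _ h
  · have h : F.baseChangeAlgHom.toLinearMap.range = ⊤ := by
      rw [eq_top_iff, ← F.span_eq_top, Submodule.span_le]
      rintro _ ⟨a, rfl⟩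
      exact ⟨1 ⊗ₜ a, by simp⟩
    exact LinearMap.range_eq_top.1 h

lemma comul_one_tmul (h : F.carrier) :
    TensorProduct.map F.baseChangeAlgHom.toLinearMap F.baseChangeAlgHom.toLinearMap
      (Coalgebra.comul (R := E) ((1 : E) ⊗ₜ[K] h)) = Coalgebra.comul (R := E) (F.val h) := by
  rw [TensorProduct.comul_tmul, ← F.tensorSquareMap_comul, comul_eq]
  generalize F.comul h = t
  induction t with
  | zero => simp
  | add x y hx hy => simp only [TensorProduct.tmul_add, map_add, hx, hy]
  | tmul x y => simp

/-- The base change of a form is the original Hopf algebra. -/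
noncomputable def baseChangeEquiv : (E ⊗[K] F.carrier) ≃ₐc[E] A :=
  BialgEquiv.ofBijective
    (BialgHom.ofAlgHom F.baseChangeAlgHom
      (by
        ext h
        simp [counit_eq, Algebra.smul_def])
      (by
        ext h
        have := F.comul_one_tmul h
        simp at this ⊢
        exact this))
    F.baseChangeAlgHom_bijective

end HopfForm

/-! ### Galois descent for vector spaces -/

section Descent

variable {K E V : Type*} [Field K] [Field E] [Algebra K E] [FiniteDimensional K E] [IsGalois K E]
  [AddCommGroup V] [Module K V] [Module E V] [IsScalarTower K E V]

/-- Multiply a relation `∑ cᵢ wᵢ = 0` by `e` and sum over the Galois group: `∑ Tr(e cᵢ) wᵢ = 0` has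
coefficients in `K`, so all `Tr(e cᵢ)` vanish, and the trace form is nondegenerate. -/
lemma linearIndependent_of_semilinear_fixed (ρ : Representation K Gal(E/K) V)
    (hρ : ∀ g (e : E) v, ρ g (e • v) = g e • ρ g v) {ι : Type*} {w : ι → V}
    (hw : ∀ g i, ρ g (w i) = w i) (hli : LinearIndependent K w) : LinearIndependent E w := by
  rw [linearIndependent_iff'] at hli ⊢
  intro s c hc
  have key : ∀ e : E, ∀ i ∈ s, Algebra.trace K E (e * c i) = 0 := by
    intro e
    apply hli s
    have h1 : ∑ g : Gal(E/K), ρ g (e • ∑ i ∈ s, c i • w i) = 0 := by simp [hc]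
    rw [← h1]
    have h2 : ∀ i, Algebra.trace K E (e * c i) • w i = ∑ g : Gal(E/K), g (e * c i) • w i := by
      intro i
      rw [← Finset.sum_smul, ← trace_eq_sum_automorphisms, algebraMap_smul]
    simp only [h2, Finset.smul_sum, map_sum, smul_smul, hρ, hw]
    exact Finset.sum_comm
  intro i hi
  refine (traceForm_nondegenerate K E).1 (c i) fun e => ?_
  rw [Algebra.traceForm_apply, mul_comm]
  exact key e i hi

-- A functional `f` killing all fixed vectors kills each `∑ g (e v)`, so `∑ f(g v) g(e) = 0` for all
-- `e`. By Dedekind's independence of automorphisms the coefficient `f(v)` at `g = 1` vanishes.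
omit [IsGalois K E] [IsScalarTower K E V] in
lemma span_semilinear_fixed_eq_top (ρ : Representation K Gal(E/K) V)
    (hρ : ∀ g (e : E) v, ρ g (e • v) = g e • ρ g v) :
    Submodule.span E {v : V | ∀ g, ρ g v = v} = ⊤ := by
  by_contra hne
  obtain ⟨f, hf0, hf⟩ := Submodule.exists_le_ker_of_lt_top _ (lt_top_iff_ne_top.2 hne)
  apply hf0
  ext v
  have hli : LinearIndependent E fun g : Gal(E/K) => (g : E → E) := by
    have := (linearIndependent_monoidHom E E).comp (fun g : Gal(E/K) => ((g : E →ₐ[K] E) : E →* E))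
      (fun g h hgh => AlgEquiv.ext fun x => DFunLike.congr_fun hgh x)
    exact this
  have h0 : ∀ e : E, ∑ g : Gal(E/K), f (ρ g v) * g e = 0 := by
    intro e
    have hmem : ∑ g : Gal(E/K), ρ g (e • v) ∈ {v : V | ∀ g, ρ g v = v} := by
      intro g
      rw [map_sum]
      refine Fintype.sum_equiv (Equiv.mulLeft g) _ _ fun h => ?_
      rw [Equiv.coe_mulLeft, map_mul]
      rfl
    have := hf (Submodule.subset_span hmem)
    rw [LinearMap.mem_ker, map_sum] at this
    simpa [hρ, mul_comm] using this
  have h1 := Fintype.linearIndependent_iff.1 hli (fun g => f (ρ g v)) (by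
    ext e
    simpa using h0 e) 1
  simpa using h1

omit [FiniteDimensional K E] [IsGalois K E] in
lemma linearIndependent_of_injective_semilinear_fixed [FiniteDimensional K E] [IsGalois K E]
    {W : Type*} [AddCommGroup W] [Module K W]
    (ρ : Representation K Gal(E/K) V) (hρ : ∀ g (e : E) v, ρ g (e • v) = g e • ρ g v)
    (f : W →ₗ[K] V) (hf : Function.Injective f) (hfix : ∀ g w, ρ g (f w) = f w)
    {ι : Type*} (b : Module.Basis ι K W) : LinearIndependent E (f ∘ b) :=
  linearIndependent_of_semilinear_fixed ρ hρ (fun g i => hfix g (b i))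
    (b.linearIndependent.map' f (LinearMap.ker_eq_bot.2 hf))

/-- A `K`-basis of a `K`-form of an `E`-vector space is an `E`-basis. -/
noncomputable def Module.Basis.ofForm {K E V W : Type*} [Field K] [Field E] [Algebra K E]
    [AddCommGroup V] [Module K V] [Module E V] [IsScalarTower K E V] [AddCommGroup W] [Module K W]
    (f : W →ₗ[K] V) {ι : Type*}
    (b : Module.Basis ι K W) (hli : LinearIndependent E (f ∘ b))
    (hspan : Submodule.span E (Set.range f) = ⊤) : Module.Basis ι E V :=
  Module.Basis.mk hli (by
    rw [← hspan, Submodule.span_le]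
    rintro _ ⟨a, rfl⟩
    rw [← b.linearCombination_repr a, Finsupp.apply_linearCombination,
      Finsupp.linearCombination_apply]
    refine Submodule.sum_mem _ fun i _ => ?_
    change b.repr a i • _ ∈ _
    rw [← algebraMap_smul E]
    exact Submodule.smul_mem _ _ (Submodule.subset_span ⟨i, rfl⟩))

lemma Module.Basis.ofForm_apply {K E V W : Type*} [Field K] [Field E] [Algebra K E]
    [AddCommGroup V] [Module K V] [Module E V] [IsScalarTower K E V] [AddCommGroup W] [Module K W]
    (f : W →ₗ[K] V) {ι : Type*}
    (b : Module.Basis ι K W) (hli : LinearIndependent E (f ∘ b))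
    (hspan : Submodule.span E (Set.range f) = ⊤) (i : ι) :
    Module.Basis.ofForm f b hli hspan i = f (b i) :=
  Module.Basis.mk_apply _ _ i

end Descent

/-! ### The descended group algebra `E[N]^G` -/

section GroupAlgebra

variable {K : Type u} {E : Type v} {N : Type w} [Field K] [Field E] [Algebra K E] [Group N]
  [MulDistribMulAction Gal(E/K) N]

/-- The semilinear action of `Gal(E/K)` on `E[N]`, acting on both the coefficients and `N`. -/
noncomputable def galGroupAlgebraMap (g : Gal(E/K)) :
    MonoidAlgebra E N →ₐ[K] MonoidAlgebra E N :=
  MonoidAlgebra.liftNCAlgHom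
    ((MonoidAlgebra.singleOneAlgHom (R := K) (A := E) (M := N)).comp (g : E →ₐ[K] E))
    ((MonoidAlgebra.of E N).comp (MulDistribMulAction.toMonoidHom N g))
    (fun x y => by
      change _ * _ = _ * _
      simp)

@[simp] lemma galGroupAlgebraMap_single (g : Gal(E/K)) (n : N) (e : E) :
    galGroupAlgebraMap (K := K) g (MonoidAlgebra.single n e) =
      MonoidAlgebra.single (g • n) (g e) := by
  simp [galGroupAlgebraMap, MonoidAlgebra.liftNCAlgHom, MonoidAlgebra.liftNCRingHom]

lemma coeff_galGroupAlgebraMap (g : Gal(E/K)) (a : MonoidAlgebra E N) (n : N) :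
    (galGroupAlgebraMap (K := K) g a).coeff (g • n) = g (a.coeff n) := by
  induction a using MonoidAlgebra.induction_linear with
  | zero => simp
  | add x y hx hy => simp [hx, hy]
  | single m e =>
    classical
    simp only [galGroupAlgebraMap_single, MonoidAlgebra.coeff_single, Finsupp.single_apply,
      smul_left_cancel_iff]
    split_ifs <;> simp

/-- `galGroupAlgebraMap` as a representation. -/
noncomputable def galGroupAlgebraRep : Representation K Gal(E/K) (MonoidAlgebra E N) where
  toFun g := (galGroupAlgebraMap g).toLinearMap
  map_one' := by
    refine LinearMap.ext fun a => ?_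
    induction a using MonoidAlgebra.induction_linear with
    | zero => simp
    | add x y hx hy => simp_all
    | single m e => simp
  map_mul' g h := by
    refine LinearMap.ext fun a => ?_
    induction a using MonoidAlgebra.induction_linear with
    | zero => simp
    | add x y hx hy => simp_all
    | single m e => simp [mul_smul]

lemma galGroupAlgebraMap_smul (g : Gal(E/K)) (e : E) (a : MonoidAlgebra E N) :
    galGroupAlgebraMap (K := K) g (e • a) = g e • galGroupAlgebraMap (K := K) g a := by
  induction a using MonoidAlgebra.induction_linear with
  | zero => simp
  | add x y hx hy => simp_all
  | single m e => simp

lemma galGroupAlgebraRep_smul (g : Gal(E/K)) (e : E) (a : MonoidAlgebra E N) :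
    galGroupAlgebraRep (K := K) g (e • a) = g e • galGroupAlgebraRep (K := K) g a :=
  galGroupAlgebraMap_smul g e a

variable (K E N) in
/-- The subalgebra of fixed points `E[N]^G`. -/
noncomputable def fixedSubalgebra : Subalgebra K (MonoidAlgebra E N) where
  carrier := {a | ∀ g : Gal(E/K), galGroupAlgebraMap g a = a}
  mul_mem' ha hb g := by rw [map_mul, ha g, hb g]
  add_mem' ha hb g := by rw [map_add, ha g, hb g]
  algebraMap_mem' k g := by rw [AlgHom.commutes]

lemma mem_fixedSubalgebra {a : MonoidAlgebra E N} :
    a ∈ fixedSubalgebra K E N ↔ ∀ g : Gal(E/K), galGroupAlgebraMap g a = a := Iff.rfl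

lemma mem_fixedSubalgebra_iff_coeff {a : MonoidAlgebra E N} :
    a ∈ fixedSubalgebra K E N ↔ ∀ (g : Gal(E/K)) (n : N), a.coeff (g • n) = g (a.coeff n) := by
  rw [mem_fixedSubalgebra]
  constructor
  · intro h g n
    conv_lhs => rw [← h g]
    exact coeff_galGroupAlgebraMap g a n
  · intro h g
    ext n
    obtain ⟨m, rfl⟩ := MulAction.surjective g n
    rw [coeff_galGroupAlgebraMap, h]

variable [FiniteDimensional K E] [IsGalois K E]

lemma linearIndependent_fixedSubalgebra :
    LinearIndependent E ((fixedSubalgebra K E N).val ∘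
      Module.Basis.ofVectorSpace K (fixedSubalgebra K E N)) :=
  linearIndependent_of_injective_semilinear_fixed (galGroupAlgebraRep (K := K) (E := E) (N := N))
    galGroupAlgebraRep_smul (fixedSubalgebra K E N).val.toLinearMap Subtype.val_injective (fun g w => w.2 g) _

omit [IsGalois K E] in
lemma span_fixedSubalgebra :
    Submodule.span E (Set.range (fixedSubalgebra K E N).val) = ⊤ := by
  rw [← span_semilinear_fixed_eq_top (galGroupAlgebraRep (K := K) (E := E) (N := N))
    galGroupAlgebraRep_smul]
  congr 1
  exact Subtype.range_coe

variable (K E N) in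
/-- A `K`-basis of `E[N]^G`, viewed as an `E`-basis of `E[N]`. -/
noncomputable def fixedBasis :
    Module.Basis (Module.Basis.ofVectorSpaceIndex K (fixedSubalgebra K E N)) E
      (MonoidAlgebra E N) :=
  Module.Basis.ofForm (fixedSubalgebra K E N).val.toLinearMap _ linearIndependent_fixedSubalgebra
    span_fixedSubalgebra

lemma fixedBasis_apply (i) : fixedBasis K E N i =
    (fixedSubalgebra K E N).val (Module.Basis.ofVectorSpace K (fixedSubalgebra K E N) i) := by
  exact Module.Basis.ofForm_apply _ _ _ _ i

/-- The basis vectors are fixed, so a semilinear map only moves the coordinates. -/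
lemma fixedBasis_repr_galGroupAlgebraMap (g : Gal(E/K)) (a : MonoidAlgebra E N) (i) :
    (fixedBasis K E N).repr (galGroupAlgebraMap g a) i = g ((fixedBasis K E N).repr a i) := by
  have h : galGroupAlgebraMap (K := K) g a = Finsupp.linearCombination E (fixedBasis K E N)
      (((fixedBasis K E N).repr a).mapRange g (map_zero g)) := by
    conv_lhs => rw [← (fixedBasis K E N).linearCombination_repr a]
    rw [Finsupp.linearCombination_apply, Finsupp.linearCombination_apply,
      Finsupp.sum_mapRange_index (by simp), Finsupp.sum, Finsupp.sum, map_sum]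
    refine Finset.sum_congr rfl fun j _ => ?_
    rw [galGroupAlgebraMap_smul, fixedBasis_apply]
    congr 1
    exact (Module.Basis.ofVectorSpace K (fixedSubalgebra K E N) j).2 g
  rw [h, (fixedBasis K E N).repr_linearCombination, Finsupp.mapRange_apply]

lemma comul_eq_sum [Fintype N] (a : MonoidAlgebra E N) : Coalgebra.comul (R := E) a =
    ∑ n : N, a.coeff n • (MonoidAlgebra.single n (1 : E) ⊗ₜ[E] MonoidAlgebra.single n (1 : E)) := by
  induction a using MonoidAlgebra.induction_linear with
  | zero => simp
  | add x y hx hy => simp [hx, hy, add_smul, Finset.sum_add_distrib]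
  | single m e =>
    classical
    have h : MonoidAlgebra.single m e = e • MonoidAlgebra.single m (1 : E) := by simp
    rw [MonoidAlgebra.comul_single, CommSemiring.comul_apply, TensorProduct.map_tmul,
      MonoidAlgebra.lsingle_apply, MonoidAlgebra.lsingle_apply, h, TensorProduct.tmul_smul]
    simp [Finsupp.single_apply]

omit [Group N] in
lemma counit_eq_sum [Fintype N] (a : MonoidAlgebra E N) : Coalgebra.counit (R := E) a =
    ∑ n : N, a.coeff n := by
  induction a using MonoidAlgebra.induction_linear with
  | zero => simp
  | add x y hx hy => simp [hx, hy, Finset.sum_add_distrib]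
  | single m e =>
    classical
    simp [Finsupp.single_apply]

omit [FiniteDimensional K E] [IsGalois K E] in
lemma antipode_galGroupAlgebraMap (g : Gal(E/K)) (a : MonoidAlgebra E N) :
    galGroupAlgebraMap (K := K) g (HopfAlgebra.antipode E a) =
      HopfAlgebra.antipode E (galGroupAlgebraMap (K := K) g a) := by
  induction a using MonoidAlgebra.induction_linear with
  | zero => simp
  | add x y hx hy => simp [hx, hy]
  | single m e => simp

/-- With `rₙᵢ` the coordinates of `n` in a basis of fixed elements, the coefficient of `bᵢ ⊗ bⱼ` in
`Δ(a)` is `∑ₙ aₙ rₙᵢ rₙⱼ`. As `a` and `r` are equivariant in `n`, the Galois group only permutes the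
summands, so this lies in `K`. -/
lemma comul_mem_range_of_fixed [Finite N] (a : fixedSubalgebra K E N) :
    Coalgebra.comul (R := E) ((fixedSubalgebra K E N).val a) ∈
      ((fixedSubalgebra K E N).val.tensorSquareMap (E := E)).toLinearMap.range := by
  have := Fintype.ofFinite N
  have : Module.Finite E (MonoidAlgebra E N) :=
    Module.Finite.equiv (MonoidAlgebra.coeffLinearEquiv (R := E) (S := E) (M := N)).symm
  have := FiniteDimensional.fintypeBasisIndex (fixedBasis K E N)
  let b := fixedBasis K E N
  let r : N → Module.Basis.ofVectorSpaceIndex K (fixedSubalgebra K E N) → E := fun n i =>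
    b.repr (MonoidAlgebra.single n 1) i
  have hr : ∀ (g : Gal(E/K)) n i, r (g • n) i = g (r n i) := by
    intro g n i
    simp only [r, b]
    rw [← fixedBasis_repr_galGroupAlgebraMap, galGroupAlgebraMap_single, map_one]
  have hk : ∀ i j, ∃ k : K, algebraMap K E k = ∑ n, a.1.coeff n * (r n i * r n j) := by
    intro i j
    apply (IsGalois.mem_range_algebraMap_iff_fixed _).2
    intro g
    rw [map_sum]
    refine Fintype.sum_equiv (MulAction.toPerm g) _ _ fun n => ?_
    rw [MulAction.toPerm_apply, mem_fixedSubalgebra_iff_coeff.1 a.2, hr, hr, map_mul, map_mul]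
  choose k hk using hk
  refine ⟨∑ i, ∑ j, k i j • (Module.Basis.ofVectorSpace K (fixedSubalgebra K E N) i ⊗ₜ
    Module.Basis.ofVectorSpace K (fixedSubalgebra K E N) j), ?_⟩
  rw [comul_eq_sum]
  have hs : ∀ n, MonoidAlgebra.single n (1 : E) ⊗ₜ[E] MonoidAlgebra.single n (1 : E) =
      ∑ i, ∑ j, (r n i * r n j) • (b i ⊗ₜ[E] b j) := by
    intro n
    have h : MonoidAlgebra.single n (1 : E) = ∑ i, r n i • b i := (b.sum_repr _).symm
    rw [h, TensorProduct.sum_tmul]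
    simp only [TensorProduct.tmul_sum, TensorProduct.smul_tmul_smul]
  simp only [AlgHom.toLinearMap_apply, map_sum, map_smul, AlgHom.tensorSquareMap_tmul,
    ← fixedBasis_apply]
  simp only [← algebraMap_smul E (k _ _), hk, hs, Finset.smul_sum, Finset.sum_smul, smul_smul]
  symm
  rw [Finset.sum_comm]
  refine Finset.sum_congr rfl fun i _ => ?_
  exact Finset.sum_comm

variable (K E N) in
/-- The `K`-form `E[N]^G` of the Hopf algebra `E[N]`. -/
noncomputable def fixedForm [Finite N] : HopfForm K E (MonoidAlgebra E N) where
  carrier := fixedSubalgebra K E N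
  val := (fixedSubalgebra K E N).val
  linearIndependent := linearIndependent_fixedSubalgebra
  span_eq_top := span_fixedSubalgebra
  counit_mem a := by
    have := Fintype.ofFinite N
    apply (IsGalois.mem_range_algebraMap_iff_fixed _).2
    intro g
    rw [counit_eq_sum, map_sum]
    exact Fintype.sum_equiv (MulAction.toPerm g) _ _ fun n =>
      (mem_fixedSubalgebra_iff_coeff.1 a.2 g n).symm
  comul_mem := comul_mem_range_of_fixed
  antipode_mem a := ⟨⟨HopfAlgebra.antipode E a.1, fun g => by
    rw [antipode_galGroupAlgebraMap, a.2 g]⟩, rfl⟩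

end GroupAlgebra

/-! ### Embeddings of `L` and the evaluation of `E[N]` -/

/-- A group `N` acts regularly on the `G`-set `X`, and this action is normalized by `G`. -/
def NormalizedRegular (G X N : Type*) [Group G] [MulAction G X] [Group N] : Prop :=
  ∃ φ : N →* Equiv.Perm X, (∀ x y, ∃! n, φ n x = y) ∧
    ∀ (g : G) (n : N), ∃ n', ∀ x, g • φ n x = φ n' (g • x)

section

variable {K L E : Type*} [Field K] [Field L] [Field E] [Algebra K L] [Algebra K E]

/-- The Galois group of `E / K` acts on the embeddings `L → E` by composition. -/
instance AlgHom.instMulActionGal : MulAction Gal(E/K) (L →ₐ[K] E) where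
  smul g x := (g : E →ₐ[K] E).comp x
  one_smul x := by ext; rfl
  mul_smul g h x := by ext; rfl

@[simp] lemma AlgHom.gal_smul_apply (g : Gal(E/K)) (x : L →ₐ[K] E) (l : L) :
    (g • x) l = g (x l) := rfl

lemma AlgHom.injective_of_field (x : L →ₐ[K] E) : Function.Injective x := x.toRingHom.injective

lemma AlgHom.exists_gal_smul_eq [Normal K E] (x y : L →ₐ[K] E) : ∃ g : Gal(E/K), g • x = y := by
  let := x.toRingHom.toAlgebra
  have : IsScalarTower K L E := IsScalarTower.of_algebraMap_eq fun k => (x.commutes k).symm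
  have hb := Algebra.IsAlgebraic.algHom_bijective (y.liftNormal E)
  refine ⟨AlgEquiv.ofBijective (y.liftNormal E) hb, ?_⟩
  ext l
  exact y.liftNormal_commutes E l

instance AlgHom.isPretransitive_gal [Normal K E] : MulAction.IsPretransitive Gal(E/K) (L →ₐ[K] E) :=
  ⟨AlgHom.exists_gal_smul_eq⟩

/-- This recovers `L` as the equivariant functions on the embeddings: `f x₀` is fixed by every
automorphism fixing `x₀(L)`, hence lies in `x₀(L)`, and transitivity does the rest. -/
lemma AlgHom.exists_eq_apply_of_equivariant [FiniteDimensional K E] [IsGalois K E]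
    (x₀ : L →ₐ[K] E) (f : (L →ₐ[K] E) → E)
    (hf : ∀ (g : Gal(E/K)) x, f (g • x) = g (f x)) : ∃ l : L, ∀ x : L →ₐ[K] E, x l = f x := by
  have h : f x₀ ∈ IntermediateField.fixedField (IntermediateField.fixingSubgroup x₀.fieldRange) := by
    rintro ⟨g, hg⟩
    change g (f x₀) = f x₀
    rw [← hf]
    congr 1
    ext l
    exact hg ⟨x₀ l, l, rfl⟩
  rw [IsGalois.fixedField_fixingSubgroup] at h
  obtain ⟨l, hl⟩ := h
  refine ⟨l, fun x => ?_⟩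
  obtain ⟨g, rfl⟩ := AlgHom.exists_gal_smul_eq x₀ x
  rw [hf, ← hl]
  rfl

variable {N : Type*} [Group N] (φ : N →* Equiv.Perm (L →ₐ[K] E))

/-- The `E`-linear map `E[N] → Hom_K(L, E)`, `n ↦ n⁻¹ • x`. -/
noncomputable def groupAlgebraEval (x : L →ₐ[K] E) : MonoidAlgebra E N →ₗ[E] L →ₗ[K] E :=
  (Finsupp.linearCombination E (fun n => (φ n⁻¹ x).toLinearMap)) ∘ₗ
    (MonoidAlgebra.coeffLinearEquiv E).toLinearMap

@[simp] lemma groupAlgebraEval_single (x : L →ₐ[K] E) (n : N) (e : E) (l : L) :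
    groupAlgebraEval φ x (MonoidAlgebra.single n e) l = e * φ n⁻¹ x l := by
  simp [groupAlgebraEval]

/-- Here `m` stands for `b · l`. The inverse in `groupAlgebraEval` makes `E[N]` act on the left on
functions of embeddings, `(n f)(x) = f(n⁻¹ x)`. -/
lemma groupAlgebraEval_mul (x : L →ₐ[K] E) (a b : MonoidAlgebra E N) (l m : L)
    (h : ∀ n : N, φ n⁻¹ x m = groupAlgebraEval φ (φ n⁻¹ x) b l) :
    groupAlgebraEval φ x a m = groupAlgebraEval φ x (a * b) l := by
  induction a using MonoidAlgebra.induction_linear with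
  | zero => simp
  | add p q hp hq => simp [add_mul, hp, hq]
  | single n e =>
    rw [groupAlgebraEval_single, h]
    clear h
    induction b using MonoidAlgebra.induction_linear with
    | zero => simp
    | add p q hp hq => rw [mul_add, map_add, map_add, LinearMap.add_apply, LinearMap.add_apply,
        mul_add, hp, hq]
    | single n' e' =>
      simp [MonoidAlgebra.single_mul_single, mul_assoc]

/-- Regularity makes the embeddings `n⁻¹ x` distinct, and distinct embeddings are linearly
independent over `E` (Dedekind). -/
lemma groupAlgebraEval_injective (hφ : ∀ x y, ∃! n, φ n x = y) (x : L →ₐ[K] E) :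
    Function.Injective (groupAlgebraEval φ x) := by
  have hinj : Function.Injective fun n => φ n⁻¹ x := by
    intro n m h
    exact inv_injective ((hφ x (φ m⁻¹ x)).unique h rfl)
  have hli := (linearIndependent_toLinearMap K L E).comp _ hinj
  intro a b hab
  exact (MonoidAlgebra.coeffLinearEquiv E).injective (hli hab)

lemma groupAlgebraEval_one (x : L →ₐ[K] E) (a : MonoidAlgebra E N) :
    groupAlgebraEval φ x a 1 = Coalgebra.counit (R := E) a := by
  induction a using MonoidAlgebra.induction_linear with
  | zero => simp
  | add p q hp hq => simp [hp, hq]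
  | single n e => simp

/-- The bilinear form `(a, b) ↦ (a · l) (b · m)`, evaluated at an embedding. -/
noncomputable def groupAlgebraEval₂ (x : L →ₐ[K] E) (l m : L) :
    MonoidAlgebra E N ⊗[E] MonoidAlgebra E N →ₗ[E] E :=
  TensorProduct.lift ((LinearMap.mul E E).compl₁₂
    ((LinearMap.applyₗ' E l) ∘ₗ groupAlgebraEval φ x)
    ((LinearMap.applyₗ' E m) ∘ₗ groupAlgebraEval φ x))

@[simp] lemma groupAlgebraEval₂_tmul (x : L →ₐ[K] E) (l m : L) (a b : MonoidAlgebra E N) :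
    groupAlgebraEval₂ φ x l m (a ⊗ₜ b) = groupAlgebraEval φ x a l * groupAlgebraEval φ x b m := by
  simp [groupAlgebraEval₂]

/-- Group elements act through ring homomorphisms; this becomes the module algebra axiom of the
form. -/
lemma groupAlgebraEval₂_comul (x : L →ₐ[K] E) (l m : L) (a : MonoidAlgebra E N) :
    groupAlgebraEval₂ φ x l m (Coalgebra.comul (R := E) a) = groupAlgebraEval φ x a (l * m) := by
  induction a using MonoidAlgebra.induction_linear with
  | zero => simp
  | add p q hp hq => simp [hp, hq]
  | single n e =>
    have h : MonoidAlgebra.single n e = e • MonoidAlgebra.single n (1 : E) := by simp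
    rw [h, map_smul, map_smul, map_smul, MonoidAlgebra.comul_single]
    simp

lemma groupAlgebraEval_gal [MulDistribMulAction Gal(E/K) N]
    (hφ : ∀ (g : Gal(E/K)) (n : N) x, g • φ n x = φ (g • n) (g • x))
    (g : Gal(E/K)) (x : L →ₐ[K] E) (a : MonoidAlgebra E N) (l : L) :
    groupAlgebraEval φ (g • x) (galGroupAlgebraMap g a) l = g (groupAlgebraEval φ x a l) := by
  induction a using MonoidAlgebra.induction_linear with
  | zero => simp
  | add p q hp hq => simp [hp, hq]
  | single n e => simp [← smul_inv', ← hφ]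

end

/-! ### From normalized regular groups to Hopf Galois structures -/

section

variable {K : Type u} {L : Type v} {E : Type v} [Field K] [Field L] [Field E] [Algebra K L]
  [Algebra K E]

lemma exists_fixed_act [FiniteDimensional K E] [IsGalois K E] {N : Type*} [Group N]
    [MulDistribMulAction Gal(E/K) N]
    (φ : N →* Equiv.Perm (L →ₐ[K] E))
    (hφ : ∀ (g : Gal(E/K)) (n : N) x, g • φ n x = φ (g • n) (g • x)) (x₀ : L →ₐ[K] E)
    (a : MonoidAlgebra E N) (ha : ∀ g : Gal(E/K), galGroupAlgebraMap g a = a) (l : L) :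
    ∃ m : L, ∀ x : L →ₐ[K] E, x m = groupAlgebraEval φ x a l := by
  refine AlgHom.exists_eq_apply_of_equivariant x₀ _ fun g x => ?_
  rw [← groupAlgebraEval_gal φ hφ, ha g]

section

variable {N : Type} [Group N] (F : HopfForm K E (MonoidAlgebra E N))
  (φ : N →* Equiv.Perm (L →ₐ[K] E)) (x₀ : L →ₐ[K] E)
  (act : F.carrier → L → L)
  (hact : ∀ a l (x : L →ₐ[K] E), x (act a l) = groupAlgebraEval φ x (F.val a) l)

/-- The action on `L` of a form of `E[N]`, from its values. -/
noncomputable def formAction : F.carrier →ₐ[K] Module.End K L :=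
  AlgHom.ofLinearMap
    (LinearMap.mk₂ K act
      (fun a b l => x₀.injective_of_field (by simp [hact]))
      (fun c a l => x₀.injective_of_field (by
        rw [map_smul, hact, hact, map_smul, ← algebraMap_smul E c (F.val a), map_smul,
          LinearMap.smul_apply, algebraMap_smul]))
      (fun a l m => x₀.injective_of_field (by simp [hact]))
      (fun c a l => x₀.injective_of_field (by simp [hact])))
    (LinearMap.ext fun l => x₀.injective_of_field (by
      rw [LinearMap.mk₂_apply, hact, map_one, MonoidAlgebra.one_def, groupAlgebraEval_single]
      simp))
    (fun a b => LinearMap.ext fun l => x₀.injective_of_field (by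
      rw [Module.End.mul_apply, LinearMap.mk₂_apply, LinearMap.mk₂_apply, LinearMap.mk₂_apply, hact,
        hact, map_mul]
      exact (groupAlgebraEval_mul φ _ _ _ _ _ (fun n => hact b l (φ n⁻¹ x₀))).symm))

lemma formAction_apply (a : F.carrier) (l : L) : formAction F φ x₀ act hact a l = act a l := rfl

include hact in
lemma formAction_mul (h : F.carrier) (l m : L) : formAction F φ x₀ act hact h (l * m) =
    TensorProduct.lift
      ((LinearMap.mul K L).compl₁₂ ((formAction F φ x₀ act hact).toLinearMap.flip l)
        ((formAction F φ x₀ act hact).toLinearMap.flip m))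
      (Coalgebra.comul (R := K) h) := by
  apply x₀.injective_of_field
  have key : ∀ t : F.carrier ⊗[K] F.carrier, x₀ (TensorProduct.lift
      ((LinearMap.mul K L).compl₁₂ ((formAction F φ x₀ act hact).toLinearMap.flip l)
        ((formAction F φ x₀ act hact).toLinearMap.flip m)) t) =
      groupAlgebraEval₂ φ x₀ l m (F.val.tensorSquareMap t) := by
    intro t
    induction t with
    | zero => simp
    | add x y hx hy => rw [map_add, map_add, map_add, map_add, hx, hy]
    | tmul x y => simp [formAction_apply, hact]
  rw [key, HopfForm.comul_eq, HopfForm.tensorSquareMap_comul, groupAlgebraEval₂_comul,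
    formAction_apply, hact]

/-- The map `L ⊗ H → End_K(L)`, followed by composition with an embedding `L → E`, factors through
the group algebra. -/
lemma comp_formAction_eq (t : L ⊗[K] F.carrier) (l : L) :
    x₀ (TensorProduct.lift ((LinearMap.mul K (Module.End K L)).compl₁₂
      (Algebra.lmul K L).toLinearMap (formAction F φ x₀ act hact).toLinearMap) t l) =
    groupAlgebraEval φ x₀ (F.baseChangeAlgHom (x₀.toLinearMap.rTensor F.carrier t)) l := by
  induction t with
  | zero => simp
  | add x y hx hy => simp only [map_add, LinearMap.add_apply, hx, hy]
  | tmul x y => simp [formAction_apply, hact]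

/-- After composing with `x₀` the map is `L ⊗ H → E ⊗ H ≅ E[N] → Hom_K(L, E)`, and each arrow is
injective. -/
lemma formAction_injective (hreg : ∀ x y, ∃! n, φ n x = y) : Function.Injective
    (TensorProduct.lift ((LinearMap.mul K (Module.End K L)).compl₁₂
      (Algebra.lmul K L).toLinearMap (formAction F φ x₀ act hact).toLinearMap)) := by
  intro t t' htt
  have h2 : Function.Injective (x₀.toLinearMap.rTensor F.carrier) :=
    Module.Flat.rTensor_preserves_injective_linearMap _ x₀.injective_of_field
  apply h2
  apply F.baseChangeAlgHom_bijective.1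
  apply groupAlgebraEval_injective φ hreg x₀
  ext l
  rw [← comp_formAction_eq F φ x₀ act hact, ← comp_formAction_eq F φ x₀ act hact, htt]

lemma HopfForm.finrank_carrier [Finite N] : Module.finrank K F.carrier = Nat.card N := by
  rw [← Module.finrank_baseChange (R := E),
    (LinearEquiv.ofBijective F.baseChangeAlgHom.toLinearMap F.baseChangeAlgHom_bijective).finrank_eq,
    (MonoidAlgebra.coeffLinearEquiv (R := E) (S := E) (M := N)).finrank_eq]
  have := Fintype.ofFinite N
  rw [Module.finrank_finsupp_self, Nat.card_eq_fintype_card]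

lemma HopfForm.finite_carrier [Finite N] : Module.Finite K F.carrier := by
  apply Module.finite_of_finrank_pos
  rw [F.finrank_carrier]
  exact Nat.card_pos

lemma exists_hopfGaloisStructure_of_form [Finite N] [FiniteDimensional K L]
    (hreg : ∀ x y, ∃! n, φ n x = y) (hN : Nat.card N = Module.finrank K L) (x₀ : L →ₐ[K] E)
    (act : F.carrier → L → L)
    (hact : ∀ a l (x : L →ₐ[K] E), x (act a l) = groupAlgebraEval φ x (F.val a) l) :
    ∃ S : HopfGaloisStructure K L, Nonempty ((E ⊗[K] S.H) ≃ₐc[E] MonoidAlgebra E N) := by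
  have := F.finite_carrier
  refine ⟨{ H := F.carrier
            μ := formAction F φ x₀ act hact
            act_one := fun h => ?_
            act_mul := formAction_mul F φ x₀ act hact
            bijective := ?_ }, ⟨F.baseChangeEquiv⟩⟩
  · apply x₀.injective_of_field
    rw [formAction_apply, hact, groupAlgebraEval_one, x₀.commutes]
    exact (F.algebraMap_counit h).symm
  · have hinj := formAction_injective F φ x₀ act hact hreg
    refine ⟨hinj, ?_⟩
    -- Both sides have dimension `[L : K]²`, because `dim H = |N| = [L : K]`.
    refine (LinearMap.injective_iff_surjective_of_finrank_eq_finrank ?_).1 hinj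
    rw [Module.finrank_tensorProduct, F.finrank_carrier, hN, Module.finrank_linearMap]

end

variable [FiniteDimensional K E] [IsGalois K E]

lemma exists_hopfGaloisStructure_of_regular {N : Type} [Group N] [Finite N] [FiniteDimensional K L]
    [MulDistribMulAction Gal(E/K) N]
    (φ : N →* Equiv.Perm (L →ₐ[K] E)) (hreg : ∀ x y, ∃! n, φ n x = y)
    (hφ : ∀ (g : Gal(E/K)) (n : N) x, g • φ n x = φ (g • n) (g • x)) (x₀ : L →ₐ[K] E)
    (hN : Nat.card N = Module.finrank K L) :
    ∃ S : HopfGaloisStructure K L, Nonempty ((E ⊗[K] S.H) ≃ₐc[E] MonoidAlgebra E N) := by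
  have h : ∀ (a : (fixedForm K E N).carrier) (l : L), ∃ m : L, ∀ x : L →ₐ[K] E,
      x m = groupAlgebraEval φ x ((fixedForm K E N).val a) l := fun a l =>
    exists_fixed_act φ hφ x₀ _ (Subtype.prop (p := fun b => b ∈ fixedSubalgebra K E N) a) l
  choose act hact using h
  exact exists_hopfGaloisStructure_of_form (fixedForm K E N) φ hreg hN x₀ act hact

/-- The action of the normalizing group on a normalized regular group, by conjugation. -/
lemma NormalizedRegular.exists_conj {G X N : Type*} [Group G] [MulAction G X] [Group N]
    {φ : N →* Equiv.Perm X} (hreg : ∀ x y, ∃! n, φ n x = y) (x₀ : X)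
    (hφ : ∀ (g : G) (n : N), ∃ n', ∀ x, g • φ n x = φ n' (g • x)) :
    ∃ c : G →* MulAut N, ∀ g n x, g • φ n x = φ (c g n) (g • x) := by
  choose c hc using hφ
  -- A regular action is faithful, so identities in `N` can be checked on permutations.
  have huniq : ∀ {n m}, φ n = φ m → n = m := fun {n m} h =>
    (hreg x₀ (φ m x₀)).unique (by rw [h]) rfl
  have hone : ∀ n, c 1 n = n := fun n => huniq (Equiv.ext fun x => by
    have := hc 1 n x
    rw [one_smul, one_smul] at this
    exact this.symm)
  have hmul : ∀ g h n, c (g * h) n = c g (c h n) := fun g h n => huniq (Equiv.ext fun x => by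
    have h1 := hc (g * h) n ((g * h)⁻¹ • x)
    rw [smul_inv_smul] at h1
    rw [← h1, mul_smul, hc, hc, ← mul_smul, smul_inv_smul])
  refine ⟨{ toFun := fun g =>
              { toFun := c g
                invFun := c g⁻¹
                left_inv := fun n => by rw [← hmul, inv_mul_cancel, hone]
                right_inv := fun n => by rw [← hmul, mul_inv_cancel, hone]
                map_mul' := fun n m => huniq (Equiv.ext fun x => by
                  have h1 := hc g (n * m) (g⁻¹ • x)
                  rw [smul_inv_smul] at h1
                  rw [← h1, map_mul, map_mul, Equiv.Perm.mul_apply, Equiv.Perm.mul_apply, hc, hc,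
                    smul_inv_smul]) }
            map_one' := MulEquiv.ext hone
            map_mul' := fun g h => MulEquiv.ext (hmul g h) }, hc⟩

lemma exists_hopfGaloisStructure_of_normalizedRegular {N : Type} [Group N] [FiniteDimensional K L]
    (h : NormalizedRegular Gal(E/K) (L →ₐ[K] E) N) (x₀ : L →ₐ[K] E)
    (hX : Nat.card (L →ₐ[K] E) = Module.finrank K L) :
    ∃ S : HopfGaloisStructure K L, Nonempty ((E ⊗[K] S.H) ≃ₐc[E] MonoidAlgebra E N) := by
  obtain ⟨φ, hreg, hφ⟩ := h
  obtain ⟨c, hc⟩ := NormalizedRegular.exists_conj hreg x₀ hφ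
  let _ := MulDistribMulAction.compHom N c
  have hbij : Function.Bijective fun n => φ n x₀ :=
    ⟨fun n m h => (hreg x₀ (φ m x₀)).unique h rfl, fun y => (hreg x₀ y).exists⟩
  have := Finite.of_injective _ hbij.1
  exact exists_hopfGaloisStructure_of_regular φ hreg (fun g n x => hc g n x) x₀
    ((Nat.card_eq_of_bijective _ hbij).trans hX)

end

/-! ### From Hopf Galois structures to regular groups, by group-like elements -/

namespace HopfGaloisStructure

variable {K : Type u} {L : Type v} {E : Type w} [Field K] [Field L] [Field E] [Algebra K L]
  [Algebra K E] (S : HopfGaloisStructure K L)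

/-- The `E`-linear map `E ⊗ H → Hom_K(L, E)`, `e ⊗ h ↦ (l ↦ e x(h · l))`. -/
noncomputable def eval (x : L →ₐ[K] E) : E ⊗[K] S.H →ₗ[E] L →ₗ[K] E :=
  LinearMap.liftBaseChange E ((LinearMap.compRight K (M := L) x.toLinearMap) ∘ₗ S.μ.toLinearMap)

@[simp] lemma eval_tmul (x : L →ₐ[K] E) (e : E) (h : S.H) (l : L) :
    S.eval x (e ⊗ₜ h) l = e * x (S.μ h l) := by
  simp [eval]

lemma eval_mul_tmul (x : L →ₐ[K] E) (a : E ⊗[K] S.H) (e : E) (h : S.H) (l : L) :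
    S.eval x (a * e ⊗ₜ h) l = e * S.eval x a (S.μ h l) := by
  induction a with
  | zero => simp
  | add a b ha hb => simp only [add_mul, map_add, LinearMap.add_apply, ha, hb, mul_add]
  | tmul e' h' => simp [mul_comm e', mul_assoc]

/-- If `a` moves `x` to `y`, then `a b` moves `x` to where `b` moves `y`: group-like elements act on
embeddings from the right. -/
lemma eval_mul (x y : L →ₐ[K] E) (a b : E ⊗[K] S.H) (h : S.eval x a = y.toLinearMap) :
    S.eval x (a * b) = S.eval y b := by
  ext l
  induction b with
  | zero => simp
  | add b c hb hc => simp only [mul_add, map_add, LinearMap.add_apply, hb, hc]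
  | tmul e h' => rw [eval_mul_tmul, h]; simp

lemma eval_apply_one (x : L →ₐ[K] E) (a : E ⊗[K] S.H) :
    S.eval x a 1 = Coalgebra.counit (R := E) a := by
  induction a with
  | zero => simp
  | add a b ha hb => simp only [map_add, LinearMap.add_apply, ha, hb]
  | tmul e h =>
    rw [eval_tmul, S.act_one, x.commutes, TensorProduct.counit_tmul, Algebra.smul_def, mul_comm]
    rfl

lemma eval_one (x : L →ₐ[K] E) : S.eval x 1 = x.toLinearMap := by
  ext l
  rw [Algebra.TensorProduct.one_def, eval_tmul]
  simp

/-- The bilinear version of `eval`. -/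
noncomputable def eval₂ (x : L →ₐ[K] E) (l m : L) :
    (E ⊗[K] S.H) ⊗[E] (E ⊗[K] S.H) →ₗ[E] E :=
  TensorProduct.lift ((LinearMap.mul E E).compl₁₂
    ((LinearMap.applyₗ' E l) ∘ₗ S.eval x) ((LinearMap.applyₗ' E m) ∘ₗ S.eval x))

@[simp] lemma eval₂_tmul (x : L →ₐ[K] E) (l m : L) (a b : E ⊗[K] S.H) :
    S.eval₂ x l m (a ⊗ₜ b) = S.eval x a l * S.eval x b m := by
  simp [eval₂]

lemma eval₂_comul (x : L →ₐ[K] E) (l m : L) (a : E ⊗[K] S.H) :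
    S.eval₂ x l m (Coalgebra.comul (R := E) a) = S.eval x a (l * m) := by
  induction a with
  | zero => simp
  | add a b ha hb => simp only [map_add, LinearMap.add_apply, ha, hb]
  | tmul e h =>
    rw [eval_tmul, S.act_mul, TensorProduct.comul_tmul]
    generalize Coalgebra.comul (R := K) h = t
    induction t with
    | zero => simp
    | add t t' ht ht' => simp only [TensorProduct.tmul_add, map_add, ht, ht', mul_add]
    | tmul p q => simp [mul_left_comm]

lemma eval_gal (g : Gal(E/K)) (x : L →ₐ[K] E) (a : E ⊗[K] S.H) (l : L) :
    S.eval (g • x) ((g : E →ₐ[K] E).toLinearMap.rTensor S.H a) l = g (S.eval x a l) := by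
  induction a with
  | zero => simp
  | add a b ha hb => simp only [map_add, LinearMap.add_apply, ha, hb]
  | tmul e h => simp

variable [FiniteDimensional K L]

lemma finrank_H : Module.finrank K S.H = Module.finrank K L := by
  have h := (LinearEquiv.ofBijective _ S.bijective).finrank_eq
  rw [Module.finrank_tensorProduct, Module.finrank_linearMap] at h
  exact Nat.eq_of_mul_eq_mul_left Module.finrank_pos h

omit [FiniteDimensional K L] in
lemma comp_mem_range_eval (x : L →ₐ[K] E) (f : Module.End K L) :
    x.toLinearMap ∘ₗ f ∈ (S.eval x).range := by
  obtain ⟨t, rfl⟩ := S.bijective.2 f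
  induction t with
  | zero => simp
  | add t t' ht ht' =>
    rw [map_add, LinearMap.comp_add]
    exact Submodule.add_mem _ ht ht'
  | tmul l h => exact ⟨x l ⊗ₜ h, by ext m; simp⟩

/-- In a basis `c` of `L`, a linear `w : L → E` is `∑ w(cᵢ) (x ∘ fᵢ)` with `fᵢ ∈ End_K(L)` given by
the dual basis, and every `x ∘ f` comes from `L ⊗ H`. Injectivity follows by counting dimensions. -/
lemma eval_bijective (x : L →ₐ[K] E) : Function.Bijective (S.eval x) := by
  have hsurj : Function.Surjective (S.eval x) := by
    rw [← LinearMap.range_eq_top, eq_top_iff]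
    intro w _
    let c := Module.finBasis K L
    have hw : w = ∑ i, w (c i) • (x.toLinearMap ∘ₗ ((c.coord i).smulRight (1 : L))) := by
      refine c.ext fun j => ?_
      simp [Finsupp.single_apply, ite_smul, apply_ite]
    rw [hw]
    exact Submodule.sum_mem _ fun i _ => Submodule.smul_mem _ _ (S.comp_mem_range_eval x _)
  refine ⟨?_, hsurj⟩
  have h1 : Module.finrank E (L →ₗ[K] E) = Module.finrank K L := by
    rw [← ((Module.finBasis K L).constr E (M' := E)).finrank_eq]
    simp
  have : Module.Finite E (L →ₗ[K] E) := Module.Finite.equiv ((Module.finBasis K L).constr E)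
  refine (LinearMap.injective_iff_surjective_of_finrank_eq_finrank ?_).2 hsurj
  rw [Module.finrank_baseChange, S.finrank_H, h1]

/-- `S.eval x` identifies `E ⊗ H` with `Hom_K(L, E)`, so the values on pairs of basis vectors of `L`
are the coordinates of an element of the tensor square. -/
lemma eval₂_injective (x : L →ₐ[K] E) {t t' : (E ⊗[K] S.H) ⊗[E] (E ⊗[K] S.H)}
    (h : ∀ l m, S.eval₂ x l m t = S.eval₂ x l m t') : t = t' := by
  let c := Module.finBasis K L
  let b : Module.Basis _ E (E ⊗[K] S.H) := Module.Basis.ofEquivFun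
    ((LinearEquiv.ofBijective _ (S.eval_bijective x)).trans (c.constr E).symm)
  have hb : ∀ a i, b.repr a i = S.eval x a (c i) := fun a i => by
    rw [← Module.Basis.equivFun_apply, Module.Basis.equivFun_ofEquivFun]
    rfl
  have h2 : ∀ t i j, (b.tensorProduct b).repr t (i, j) = S.eval₂ x (c i) (c j) t := by
    intro t i j
    induction t with
    | zero => simp
    | add t t' ht ht' => simp only [map_add, Finsupp.add_apply, ht, ht']
    | tmul p q =>
      rw [Module.Basis.tensorProduct_repr_tmul_apply, hb, hb, eval₂_tmul, smul_eq_mul, mul_comm]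
  refine (b.tensorProduct b).ext_elem ?_
  rintro ⟨i, j⟩
  rw [h2, h2, h]

/-- Under `S.eval x` the counit becomes evaluation at `1` and the comultiplication becomes `(l, m) ↦
w(l m)`. Group-likeness of `w` thus says `w(1) = 1` and `w(l m) = w(l) w(m)`. -/
lemma isGroupLikeElem_iff_exists (x : L →ₐ[K] E) (a : E ⊗[K] S.H) :
    IsGroupLikeElem E a ↔ ∃ y : L →ₐ[K] E, S.eval x a = y.toLinearMap := by
  constructor
  · intro ha
    refine ⟨AlgHom.ofLinearMap (S.eval x a) ?_ ?_, rfl⟩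
    · rw [eval_apply_one, ha.counit_eq_one]
    · intro l m
      rw [← eval₂_comul, ha.comul_eq_tmul_self, eval₂_tmul]
  · rintro ⟨y, hy⟩
    refine ⟨?_, ?_⟩
    · rw [← S.eval_apply_one x, hy]
      simp
    · refine S.eval₂_injective x fun l m => ?_
      rw [eval₂_comul, eval₂_tmul, hy]
      simp

lemma isGroupLikeElem_gal (x : L →ₐ[K] E) (g : Gal(E/K)) {a : E ⊗[K] S.H}
    (ha : IsGroupLikeElem E a) :
    IsGroupLikeElem E ((g : E →ₐ[K] E).toLinearMap.rTensor S.H a) := by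
  obtain ⟨y, hy⟩ := (S.isGroupLikeElem_iff_exists x a).1 ha
  refine (S.isGroupLikeElem_iff_exists (g • x) _).2 ⟨g • y, ?_⟩
  ext l
  rw [S.eval_gal, hy]
  rfl

/-- A group-like element of `E ⊗ H` moves the embeddings of `L` into `E`. -/
noncomputable def groupLikeMove (a : GroupLike E (E ⊗[K] S.H)) (x : L →ₐ[K] E) : L →ₐ[K] E :=
  ((S.isGroupLikeElem_iff_exists x a.val).1 a.2).choose

lemma eval_groupLike (a : GroupLike E (E ⊗[K] S.H)) (x : L →ₐ[K] E) :
    S.eval x a.val = (S.groupLikeMove a x).toLinearMap :=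
  ((S.isGroupLikeElem_iff_exists x a.val).1 a.2).choose_spec

lemma groupLikeMove_eq_iff (a : GroupLike E (E ⊗[K] S.H)) (x y : L →ₐ[K] E) :
    S.groupLikeMove a x = y ↔ S.eval x a.val = y.toLinearMap := by
  rw [eval_groupLike]
  exact ⟨fun h => by rw [h], fun h => AlgHom.toLinearMap_injective h⟩

/-- The group of group-like elements of `E ⊗ H` acts on the embeddings of `L` into `E`. -/
noncomputable def groupLikePermHom :
    GroupLike E (E ⊗[K] S.H) →* Equiv.Perm (L →ₐ[K] E) :=
  let _ : MulAction (GroupLike E (E ⊗[K] S.H)) (L →ₐ[K] E) :=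
    -- The inverse turns the right action into a left one.
    { smul := fun a x => S.groupLikeMove a⁻¹ x
      one_smul := fun x => (S.groupLikeMove_eq_iff _ _ _).2 (by
        rw [inv_one]
        exact S.eval_one x)
      mul_smul := fun a b x => (S.groupLikeMove_eq_iff _ _ _).2 (by
        rw [mul_inv_rev, GroupLike.val_mul, S.eval_mul _ _ _ _ (S.eval_groupLike b⁻¹ x)]
        exact S.eval_groupLike _ _) }
  MulAction.toPermHom _ _

lemma groupLikePermHom_apply (a : GroupLike E (E ⊗[K] S.H)) (x : L →ₐ[K] E) :
    S.groupLikePermHom a x = S.groupLikeMove a⁻¹ x := rfl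

lemma groupLikePermHom_regular (x y : L →ₐ[K] E) :
    ∃! a : GroupLike E (E ⊗[K] S.H), S.groupLikePermHom a x = y := by
  obtain ⟨a, ha⟩ := (S.eval_bijective x).2 y.toLinearMap
  have hg : IsGroupLikeElem E a := (S.isGroupLikeElem_iff_exists x a).2 ⟨y, ha⟩
  refine ⟨(⟨a, hg⟩ : GroupLike E (E ⊗[K] S.H))⁻¹, ?_, fun b hb => ?_⟩
  · change S.groupLikePermHom _ x = y
    rw [groupLikePermHom_apply, inv_inv]
    exact (S.groupLikeMove_eq_iff _ _ _).2 ha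
  · rw [← inv_eq_iff_eq_inv, ← GroupLike.val_inj]
    apply (S.eval_bijective x).1
    rw [ha]
    exact (S.groupLikeMove_eq_iff _ _ _).1 hb

lemma normalizedRegular_groupLike (x₀ : L →ₐ[K] E) :
    NormalizedRegular Gal(E/K) (L →ₐ[K] E) (GroupLike E (E ⊗[K] S.H)) := by
  refine ⟨S.groupLikePermHom, S.groupLikePermHom_regular, fun g a => ?_⟩
  refine ⟨(⟨_, S.isGroupLikeElem_gal x₀ g a⁻¹.2⟩ : GroupLike E (E ⊗[K] S.H))⁻¹, fun x => ?_⟩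
  rw [groupLikePermHom_apply, groupLikePermHom_apply, inv_inv]
  symm
  rw [groupLikeMove_eq_iff]
  ext l
  rw [S.eval_gal, eval_groupLike]
  rfl

end HopfGaloisStructure

lemma NormalizedRegular.of_mulEquiv {G X N N' : Type*} [Group G] [MulAction G X] [Group N]
    [Group N'] (h : NormalizedRegular G X N) (e : N ≃* N') : NormalizedRegular G X N' := by
  obtain ⟨φ, hreg, hφ⟩ := h
  refine ⟨φ.comp e.symm, fun x y => ?_, fun g n => ?_⟩
  · exact (e.bijective.existsUnique_iff (p := fun n => φ (e.symm n) x = y)).2 (by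
      simpa using hreg x y)
  · obtain ⟨n', hn'⟩ := hφ g (e.symm n)
    exact ⟨e n', fun x => by simpa using hn' x⟩

/-- The elements of `N` as group-like elements of the group algebra. -/
noncomputable def MonoidAlgebra.ofGroupLike (E N : Type*) [Field E] [Group N] :
    N →* GroupLike E (MonoidAlgebra E N) where
  toFun n := ⟨MonoidAlgebra.of E N n, MonoidAlgebra.isGroupLikeElem_of n⟩
  map_one' := by ext : 1; simp [MonoidAlgebra.one_def]
  map_mul' n m := by ext : 1; simp

/-- Group-like elements of a group algebra over a field. -/
noncomputable def MonoidAlgebra.groupLikeEquiv (E N : Type*) [Field E] [Group N] :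
    N ≃* GroupLike E (MonoidAlgebra E N) :=
  MulEquiv.ofBijective (MonoidAlgebra.ofGroupLike E N)
    ⟨fun n m h => MonoidAlgebra.of_injective (congrArg GroupLike.val h), fun a => by
      obtain ⟨n, hn⟩ := MonoidAlgebra.isGroupLikeElem_iff_mem_range_of.1 a.2
      exact ⟨n, GroupLike.val_injective hn⟩⟩

/-- Bialgebra isomorphisms induce isomorphisms of groups of group-like elements. -/
noncomputable def BialgEquiv.groupLikeEquiv {R A B : Type*} [CommRing R] [Ring A] [Ring B]
    [HopfAlgebra R A] [HopfAlgebra R B] (e : A ≃ₐc[R] B) : GroupLike R A ≃* GroupLike R B where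
  toFun a := ⟨e a.val, a.2.map e⟩
  invFun b := ⟨e.symm b.val, b.2.map e.symm⟩
  left_inv a := by ext : 1; simp
  right_inv a := by ext : 1; simp
  map_mul' a b := by ext : 1; simp

section

variable {K : Type u} {L : Type v} {E : Type v} [Field K] [Field L] [Field E] [Algebra K L]
  [Algebra K E] [FiniteDimensional K L]

lemma HopfGaloisStructure.normalizedRegular_of_bialgEquiv (S : HopfGaloisStructure K L)
    (x₀ : L →ₐ[K] E) {N : Type*} [Group N] (e : (E ⊗[K] S.H) ≃ₐc[E] MonoidAlgebra E N) :
    NormalizedRegular Gal(E/K) (L →ₐ[K] E) N :=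
  (S.normalizedRegular_groupLike x₀).of_mulEquiv
    (e.groupLikeEquiv.trans (MonoidAlgebra.groupLikeEquiv E N).symm)

/-- Group-like elements are linearly independent and correspond to the `[L : K] = dim H` embeddings,
so they form a basis of `E ⊗ H`. Hence every Hopf Galois structure has a type; `Shrink` only moves
the group into `Type`. -/
lemma HopfGaloisStructure.exists_bialgEquiv (S : HopfGaloisStructure K L)
    (x₀ : L →ₐ[K] E) (hX : Nat.card (L →ₐ[K] E) = Module.finrank K L) :
    ∃ (N : Type) (_ : Group N), Nonempty ((E ⊗[K] S.H) ≃ₐc[E] MonoidAlgebra E N) := by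
  have hbij : Function.Bijective fun a : GroupLike E (E ⊗[K] S.H) => S.groupLikePermHom a x₀ :=
    ⟨fun a b h => (S.groupLikePermHom_regular x₀ _).unique h rfl,
      fun y => (S.groupLikePermHom_regular x₀ y).exists⟩
  have : Finite (L →ₐ[K] E) := Nat.finite_of_card_ne_zero (by
    rw [hX]; exact Module.finrank_pos.ne')
  have hfin : Finite (GroupLike E (E ⊗[K] S.H)) := Finite.of_injective _ hbij.1
  have := Fintype.ofFinite (GroupLike E (E ⊗[K] S.H))
  let f : MonoidAlgebra E (GroupLike E (E ⊗[K] S.H)) →ₐc[E] E ⊗[K] S.H :=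
    MonoidAlgebra.liftGroupLikeBialgHom
  have hinj : Function.Injective f := by
    have h := linearIndep_groupLikeVal (R := E) (A := E ⊗[K] S.H)
    intro a b hab
    refine (MonoidAlgebra.coeffLinearEquiv E).injective (h ?_)
    simpa [f, MonoidAlgebra.lift_apply, Finsupp.linearCombination_apply] using hab
  have hb : Function.Bijective f := by
    refine ⟨hinj, ?_⟩
    have : Module.Finite E (MonoidAlgebra E (GroupLike E (E ⊗[K] S.H))) :=
      Module.Finite.equiv (MonoidAlgebra.coeffLinearEquiv (R := E) (S := E)).symm
    refine (LinearMap.injective_iff_surjective_of_finrank_eq_finrank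
      (f := ((f : MonoidAlgebra E (GroupLike E (E ⊗[K] S.H)) →ₐ[E] E ⊗[K] S.H)).toLinearMap) ?_).1 hinj
    rw [Module.finrank_baseChange, S.finrank_H, ← hX, ← Nat.card_eq_of_bijective _ hbij,
      (MonoidAlgebra.coeffLinearEquiv (R := E) (S := E)).finrank_eq,
      Module.finrank_finsupp_self, Nat.card_eq_fintype_card]
  refine ⟨Shrink.{0} (GroupLike E (E ⊗[K] S.H)), inferInstance, ⟨?_⟩⟩
  exact (BialgEquiv.ofBijective f hb).symm.trans
    (MonoidAlgebra.domCongrBialgEquiv E E (Shrink.mulEquiv).symm)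

end

/-! ### The Greither–Pareigis correspondence -/

section

variable (K : Type u) (L : Type v) [Field K] [Field L] [Algebra K L] [FiniteDimensional K L]
  [Algebra.IsSeparable K L]

instance GaloisClosure.isGalois : IsGalois K (GaloisClosure K L) where
  to_isSeparable := by
    rw [GaloisClosure, normalClosure_def]
    have : ∀ f : L →ₐ[K] AlgebraicClosure L, Algebra.IsSeparable K f.fieldRange := fun f =>
      AlgEquiv.Algebra.isSeparable (AlgEquiv.ofInjectiveField f)
    exact IntermediateField.isSeparable_iSup (t := fun f : L →ₐ[K] AlgebraicClosure L => f.fieldRange) K _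

lemma GaloisClosure.natCard_algHom :
    Nat.card (L →ₐ[K] GaloisClosure K L) = Module.finrank K L :=
  (Nat.card_congr (normalClosure.algHomEquiv K L (AlgebraicClosure L))).trans
    (AlgHom.natCard_of_splits _ _ _ fun _ => IsAlgClosed.splits _)

variable {K L}

theorem mem_hopfGaloisTypes_iff {N : Type} [Group N] :
    groupIsoClass N ∈ hopfGaloisTypes K L ↔
      NormalizedRegular Gal(GaloisClosure K L/K) (L →ₐ[K] GaloisClosure K L) N := by
  let x₀ : L →ₐ[K] GaloisClosure K L := IsScalarTower.toAlgHom K L _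
  constructor
  · rintro ⟨S, N', _, hN, ⟨e⟩⟩
    obtain ⟨i⟩ : Nonempty (N ≃* N') := Quotient.exact hN
    exact (S.normalizedRegular_of_bialgEquiv x₀ e).of_mulEquiv i.symm
  · intro h
    obtain ⟨S, e⟩ := exists_hopfGaloisStructure_of_normalizedRegular h x₀
      (GaloisClosure.natCard_algHom K L)
    exact ⟨S, N, inferInstance, rfl, e⟩

omit [FiniteDimensional K L] [Algebra.IsSeparable K L] in
lemma exists_eq_of_mem_hopfGaloisTypes {T : GroupIsoClass} (h : T ∈ hopfGaloisTypes K L) :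
    ∃ (N : Type) (_ : Group N), T = groupIsoClass N := by
  obtain ⟨S, N, _, hN, _⟩ := h
  exact ⟨N, inferInstance, hN⟩

lemma hopfGaloisTypes_nonempty (S : HopfGaloisStructure K L) : (hopfGaloisTypes K L).Nonempty := by
  obtain ⟨N, _, e⟩ := S.exists_bialgEquiv (IsScalarTower.toAlgHom K L (GaloisClosure K L))
    (GaloisClosure.natCard_algHom K L)
  exact ⟨groupIsoClass N, S, N, inferInstance, rfl, e⟩

end

/-! ### Isomorphic actions -/

lemma NormalizedRegular.transport {G G' X Y N : Type*} [Group G] [Group G'] [MulAction G X]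
    [MulAction G' Y] [Group N] (e : G ≃* G') (f : X ≃ Y) (hf : ∀ g x, f (g • x) = e g • f x)
    (h : NormalizedRegular G X N) : NormalizedRegular G' Y N := by
  obtain ⟨φ, hreg, hφ⟩ := h
  refine ⟨f.permCongrHom.toMonoidHom.comp φ, fun x y => ?_, fun g n => ?_⟩
  · obtain ⟨n, hn, hu⟩ := hreg (f.symm x) (f.symm y)
    refine ⟨n, by simp [Equiv.permCongrHom, hn], fun m hm => hu m ?_⟩
    simp only [← hm]
    simp [Equiv.permCongrHom]
  · obtain ⟨n', hn'⟩ := hφ (e.symm g) n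
    refine ⟨n', fun y => ?_⟩
    have h1 := congrArg f (hn' (f.symm y))
    have h2 : e.symm g • f.symm y = f.symm (g • y) := by
      apply f.injective
      rw [hf]
      simp
    rw [hf, h2] at h1
    simpa [Equiv.permCongrHom] using h1

lemma NormalizedRegular.transport_iff {G G' X Y N : Type*} [Group G] [Group G'] [MulAction G X]
    [MulAction G' Y] [Group N] (e : G ≃* G') (f : X ≃ Y) (hf : ∀ g x, f (g • x) = e g • f x) :
    NormalizedRegular G X N ↔ NormalizedRegular G' Y N :=
  ⟨transport e f hf, transport e.symm f.symm fun g y => f.injective (by rw [hf]; simp)⟩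

/-- A transitive action is determined by a point stabilizer. -/
lemma MulAction.exists_equiv_of_stabilizer {G G' X Y : Type*} [Group G] [Group G'] [MulAction G X]
    [MulAction G' Y] [IsPretransitive G X] [IsPretransitive G' Y] (e : G ≃* G') (x₀ : X) (y₀ : Y)
    (h : ∀ g : G, g • x₀ = x₀ ↔ e g • y₀ = y₀) :
    ∃ f : X ≃ Y, ∀ (g : G) x, f (g • x) = e g • f x := by
  choose s hs using fun x => exists_smul_eq G x₀ x
  have key : ∀ g g' : G, g • x₀ = g' • x₀ ↔ e g • y₀ = e g' • y₀ := fun g g' => by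
    rw [← inv_smul_eq_iff, ← mul_smul, h, map_mul, map_inv, mul_smul, inv_smul_eq_iff]
  have hbij : Function.Bijective fun x => e (s x) • y₀ := by
    refine ⟨fun x x' hx => ?_, fun y => ?_⟩
    · rw [← hs x, ← hs x']
      exact (key _ _).2 hx
    · obtain ⟨g, rfl⟩ := exists_smul_eq G' y₀ y
      refine ⟨e.symm g • x₀, ?_⟩
      have := (key (s (e.symm g • x₀)) (e.symm g)).1 (hs _)
      simpa using this
  refine ⟨Equiv.ofBijective _ hbij, fun g x => ?_⟩
  change e (s (g • x)) • y₀ = e g • e (s x) • y₀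
  rw [← mul_smul, ← map_mul]
  apply (key _ _).1
  rw [hs, mul_smul, hs]

/-! ### Realizing transitive permutation groups as Galois groups -/

section Realization

variable (G X : Type) [Group G] [MulAction G X]

/-- The action of `G` on the rational function field in variables indexed by `X`. -/
noncomputable def ratFunAutHom :
    G →* Gal(FractionRing (MvPolynomial X ℚ)/ℚ) :=
  (IsFractionRing.fieldEquivOfAlgEquivHom ℚ (FractionRing (MvPolynomial X ℚ))).comp
    { toFun := fun g => MvPolynomial.renameEquiv ℚ (MulAction.toPerm (α := G) (β := X) g)
      map_one' := AlgEquiv.ext fun p => by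
        change MvPolynomial.rename (fun x : X => (1 : G) • x) p = p
        simp only [one_smul]
        exact MvPolynomial.rename_id_apply p
      map_mul' := fun g h => AlgEquiv.ext fun p => by
        change MvPolynomial.rename (fun x : X => (g * h) • x) p =
          MvPolynomial.rename (fun x : X => g • x) (MvPolynomial.rename (fun x : X => h • x) p)
        rw [MvPolynomial.rename_rename]
        simp only [mul_smul]
        rfl }

variable {G X}
lemma ratFunAutHom_injective [FaithfulSMul G X] : Function.Injective (ratFunAutHom G X) := by
  refine (IsFractionRing.fieldEquivOfAlgEquivHom_injective _ _ _ _).comp fun g h hgh =>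
    FaithfulSMul.eq_of_smul_eq_smul (M := G) fun x : X => ?_
  have := DFunLike.congr_fun hgh (MvPolynomial.X x)
  simpa using this

end Realization

/-- Every finite transitive permutation group is realized as a Galois group. -/
theorem exists_field_extension_of_action (G X : Type) [Group G] [Finite G] [MulAction G X]
    [FaithfulSMul G X] [MulAction.IsPretransitive G X] (x₀ : X) :
    ∃ (K L : Type) (_ : Field K) (_ : Field L) (_ : Algebra K L),
      Algebra.IsSeparable K L ∧ FiniteDimensional K L ∧ Module.finrank K L = Nat.card X ∧
      Nonempty (Gal(GaloisClosure K L/K) ≃* G) ∧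
      ∀ (N : Type) [Group N],
        NormalizedRegular Gal(GaloisClosure K L/K) (L →ₐ[K] GaloisClosure K L) N ↔
          NormalizedRegular G X N := by
  let F := FractionRing (MvPolynomial X ℚ)
  let _ : MulSemiringAction G F := MulSemiringAction.compHom F (ratFunAutHom G X)
  have : FaithfulSMul G F := ⟨fun {g h} hgh =>
    ratFunAutHom_injective (G := G) (X := X) (AlgEquiv.ext hgh)⟩
  let K := FixedPoints.subfield G F
  let σ : G ≃* Gal(F/K) := FixedPoints.toAlgAutMulEquiv G F
  have : IsGalois K F := {}
  let L := IntermediateField.fixedField ((MulAction.stabilizer G x₀).map σ.toMonoidHom)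
  -- `X` matches the embeddings of `L`, with `x₀` the inclusion: both have the stabilizer of `x₀`,
  -- which is the group fixing `L` pointwise.
  obtain ⟨f, hf⟩ := MulAction.exists_equiv_of_stabilizer (Y := L →ₐ[K] F) σ x₀ L.val (by
    intro g
    have h1 : g • x₀ = x₀ ↔ σ g ∈ L.fixingSubgroup := by
      rw [IntermediateField.fixingSubgroup_fixedField]
      constructor
      · exact fun h => ⟨g, h, rfl⟩
      · rintro ⟨g', h, hg⟩
        rwa [← σ.injective hg]
    rw [h1]
    constructor
    · intro h
      ext l
      exact h l
    · intro h l
      exact DFunLike.congr_fun h l)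
  -- An automorphism fixing all conjugates of `L` fixes all points of `X`, so it is trivial by
  -- faithfulness.
  have hnc : IntermediateField.normalClosure K L F = ⊤ := by
    have hb : (IntermediateField.normalClosure K L F).fixingSubgroup = ⊥ := by
      refine (Subgroup.eq_bot_iff_forall _).2 fun τ hτ => ?_
      obtain ⟨g, rfl⟩ := σ.surjective τ
      have hg : g = 1 := FaithfulSMul.eq_of_smul_eq_smul fun x : X => by
        rw [one_smul]
        apply f.injective
        rw [hf]
        ext l
        exact hτ ⟨f x l, (f x).fieldRange_le_normalClosure ⟨l, rfl⟩⟩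
      rw [hg, map_one]
    rw [← IsGalois.fixedField_fixingSubgroup (IntermediateField.normalClosure K L F), hb,
      IntermediateField.fixedField_bot]
  have hsplit : ∀ x : L, ((minpoly K x).map (algebraMap K F)).Splits := fun x => by
    rw [← minpoly.algHom_eq L.val L.val.injective_of_field x]
    exact Normal.splits inferInstance _
  have : IsNormalClosure K L F := Algebra.IsAlgebraic.isNormalClosure_iff.2 ⟨hsplit, hnc⟩
  have : Algebra.IsSeparable K L := Algebra.isSeparable_tower_bot_of_isSeparable K L F
  let e : F ≃ₐ[K] GaloisClosure K L := IsNormalClosure.equiv (K := L)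
  let τ : Gal(F/K) ≃* Gal(GaloisClosure K L/K) := AlgEquiv.autCongr e
  refine ⟨K, L, inferInstance, inferInstance, inferInstance, inferInstance, inferInstance, ?_,
    ⟨(σ.trans τ).symm⟩, fun N _ => (NormalizedRegular.transport_iff (σ.trans τ)
      (f.trans (AlgEquiv.arrowCongr AlgEquiv.refl e)) fun g x => ?_).symm⟩
  · rw [← AlgHom.natCard_of_splits K L F hsplit]
    exact (Nat.card_congr f).symm
  · ext l
    simp [hf, τ]

/-! ### Cyclic groups and semidirect products -/

section CyclicHom

variable {N : Type*} [Group N]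

/-- The homomorphism from the cyclic group of order `n` sending the generator to `u`. -/
def cyclicHom (n : ℕ) (u : N) (h : u ^ n = 1) : CyclicGrp n →* N :=
  AddMonoidHom.toMultiplicativeLeft (ZMod.lift n ⟨zmultiplesHom (Additive N) (Additive.ofMul u), by
    change ((n : ℤ) • Additive.ofMul u : Additive N) = 0
    rw [natCast_zsmul, ← ofMul_pow, h]
    rfl⟩)

lemma cyclicHom_intCast (n : ℕ) (u : N) (h : u ^ n = 1) (k : ℤ) :
    cyclicHom n u h (Multiplicative.ofAdd (k : ZMod n)) = u ^ k := by
  change Additive.toMul (ZMod.lift n _ (k : ZMod n)) = u ^ k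
  rw [ZMod.lift_coe]
  rfl

lemma cyclicHom_gen (n : ℕ) (u : N) (h : u ^ n = 1) :
    cyclicHom n u h (Multiplicative.ofAdd 1) = u := by
  simpa using cyclicHom_intCast n u h 1

lemma exists_intCast_eq {n : ℕ} (z : CyclicGrp n) :
    ∃ k : ℤ, z = Multiplicative.ofAdd (k : ZMod n) := by
  obtain ⟨k, hk⟩ := ZMod.intCast_surjective (Multiplicative.toAdd z)
  exact ⟨k, by rw [hk]; rfl⟩

lemma cyclicHom_injective {n : ℕ} {u : N} (h : orderOf u = n) :
    Function.Injective (cyclicHom n u (h ▸ pow_orderOf_eq_one u)) := by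
  rw [injective_iff_map_eq_one]
  intro z hz
  obtain ⟨k, rfl⟩ := exists_intCast_eq z
  rw [cyclicHom_intCast, ← orderOf_dvd_iff_zpow_eq_one, h] at hz
  rw [(ZMod.intCast_zmod_eq_zero_iff_dvd k n).2 hz]
  rfl

lemma range_cyclicHom (n : ℕ) (u : N) (h : u ^ n = 1) :
    (cyclicHom n u h).range = Subgroup.zpowers u := by
  ext x
  constructor
  · rintro ⟨z, rfl⟩
    obtain ⟨k, rfl⟩ := exists_intCast_eq z
    rw [cyclicHom_intCast]
    exact ⟨k, rfl⟩
  · rintro ⟨k, rfl⟩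
    exact ⟨_, cyclicHom_intCast n u h k⟩

/-- The generator of the cyclic group of order two. -/
abbrev cyclicTwoGen : CyclicGrp 2 := Multiplicative.ofAdd 1

lemma cyclicTwo_eq (z : CyclicGrp 2) : z = 1 ∨ z = cyclicTwoGen := by
  revert z
  decide

lemma cyclicTwoGen_ne_one : cyclicTwoGen ≠ 1 := by decide

lemma natCard_cyclicGrp (n : ℕ) : Nat.card (CyclicGrp n) = n := Nat.card_zmod n

lemma inversionAction_gen (A : Type) [CommGroup A] (a : A) :
    inversionAction A cyclicTwoGen a = a⁻¹ := rfl

end CyclicHom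

/-- Recognition of semidirect products with a group of order two. -/
lemma nonempty_mulEquiv_semidirect {Z N : Type*} [Group Z] [Group N] [Finite N]
    (θ : CyclicGrp 2 →* MulAut Z) (f : Z →* N) (hf : Function.Injective f) (τ : N)
    (hτ : τ ^ 2 = 1) (hτf : τ ∉ f.range) (hc : ∀ z, τ * f z * τ⁻¹ = f (θ cyclicTwoGen z))
    (hcard : Nat.card N = 2 * Nat.card Z) : Nonempty (Z ⋊[θ] CyclicGrp 2 ≃* N) := by
  let F : Z ⋊[θ] CyclicGrp 2 →* N := SemidirectProduct.lift f (cyclicHom 2 τ hτ) (by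
    intro g
    ext z
    rcases cyclicTwo_eq g with rfl | rfl
    · simp
    · simp [cyclicHom_gen, hc])
  have hF : Function.Injective F := by
    rw [injective_iff_map_eq_one]
    rintro ⟨z, g⟩ h
    change f z * cyclicHom 2 τ hτ g = 1 at h
    rcases cyclicTwo_eq g with rfl | rfl
    · rw [map_one, mul_one] at h
      rw [hf (h.trans f.map_one.symm)]
      rfl
    · rw [cyclicHom_gen, mul_eq_one_iff_eq_inv] at h
      exact absurd ⟨z⁻¹, by rw [map_inv, h, inv_inv]⟩ hτf
  refine ⟨MulEquiv.ofBijective F (hF.bijective_of_nat_card_le ?_)⟩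
  rw [SemidirectProduct.card, natCard_cyclicGrp, hcard, mul_comm]

/-- The homomorphism from `C_p × C_p` given by two commuting elements. -/
def cyclicPairHom {N : Type*} [Group N] (p : ℕ) (u v : N) (hu : u ^ p = 1) (hv : v ^ p = 1)
    (huv : Commute u v) : CyclicGrp p × CyclicGrp p →* N :=
  (cyclicHom p u hu).noncommCoprod (cyclicHom p v hv) (fun a b => by
    obtain ⟨k, rfl⟩ := exists_intCast_eq a
    obtain ⟨l, rfl⟩ := exists_intCast_eq b
    rw [cyclicHom_intCast, cyclicHom_intCast]
    exact huv.zpow_zpow k l)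

lemma cyclicPairHom_intCast {N : Type*} [Group N] (p : ℕ) (u v : N) (hu : u ^ p = 1)
    (hv : v ^ p = 1) (huv : Commute u v) (k l : ℤ) :
    cyclicPairHom p u v hu hv huv
      (Multiplicative.ofAdd (k : ZMod p), Multiplicative.ofAdd (l : ZMod p)) = u ^ k * v ^ l := by
  simp [cyclicPairHom, MonoidHom.noncommCoprod_apply, cyclicHom_intCast]

lemma cyclicPairHom_injective {N : Type*} [Group N] {p : ℕ} (hp : p.Prime) {u v : N}
    (hu : u ^ p = 1) (hv : v ^ p = 1) (huv : Commute u v) (hu1 : u ≠ 1)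
    (hvu : v ∉ Subgroup.zpowers u) : Function.Injective (cyclicPairHom p u v hu hv huv) := by
  have := Fact.mk hp
  rw [injective_iff_map_eq_one]
  rintro ⟨a, b⟩ h
  obtain ⟨k, rfl⟩ := exists_intCast_eq a
  obtain ⟨l, rfl⟩ := exists_intCast_eq b
  rw [cyclicPairHom_intCast] at h
  have hl : (p : ℤ) ∣ l := by
    by_contra hl
    apply hvu
    have hc : IsCoprime (p : ℤ) l := (Nat.prime_iff_prime_int.1 hp).coprime_iff_not_dvd.2 hl
    obtain ⟨s, t, hst⟩ := hc
    have h1 : v ^ l ∈ Subgroup.zpowers u := ⟨-k, by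
      change u ^ (-k) = v ^ l
      rw [zpow_neg, inv_eq_iff_mul_eq_one]
      exact h⟩
    have h2 : v = (v ^ l) ^ t := by
      rw [← zpow_mul, mul_comm l t]
      calc v = v ^ (s * p + t * l) := by rw [hst, zpow_one]
        _ = v ^ (t * l) := by
          rw [zpow_add, mul_comm s, zpow_mul, zpow_natCast, hv, one_zpow, one_mul]
    rw [h2]
    exact Subgroup.zpow_mem _ h1 t
  obtain ⟨l, rfl⟩ := hl
  rw [zpow_mul, zpow_natCast, hv, one_zpow, mul_one, ← orderOf_dvd_iff_zpow_eq_one,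
    orderOf_eq_prime hu hu1] at h
  rw [(ZMod.intCast_zmod_eq_zero_iff_dvd k p).2 h]
  simp

/-- Transporting the left regular representation along a bijection `N ≃ X`. -/
lemma normalizedRegular_of_equiv {G X N : Type*} [Group G] [MulAction G X] [Group N] (ψ : N ≃ X)
    (h : ∀ (g : G) (n : N), ∃ n', ∀ m, g • ψ (n * m) = ψ (n' * ψ.symm (g • ψ m))) :
    NormalizedRegular G X N := by
  refine ⟨ψ.permCongrHom.toMonoidHom.comp (MulAction.toPermHom N N), fun x y => ?_, fun g n => ?_⟩
  · refine ⟨ψ.symm y * (ψ.symm x)⁻¹, ?_, fun n hn => ?_⟩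
    · simp [Equiv.permCongrHom]
    · rw [← hn]
      simp [Equiv.permCongrHom]
  · obtain ⟨n', hn'⟩ := h g n
    refine ⟨n', fun x => ?_⟩
    simpa [Equiv.permCongrHom] using hn' (ψ.symm x)

/-- `Z × D` and `Z ⋊ D` share their underlying set, where `g` acts by `(z, d) ↦ (a₁ z · u, a₂ d ·
e)`. Since `Z` is commutative and `a₁`, `a₂` are compatible with `θ`, such a map also normalizes the
left translations of `Z ⋊ D`. -/
lemma normalizedRegular_semidirect {G X Z D : Type*} [Group G] [MulAction G X] [CommGroup Z]
    [Group D] (θ : D →* MulAut Z) {φ : Z × D →* Equiv.Perm X} (hreg : ∀ x y, ∃! n, φ n x = y)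
    (x₀ : X) (h : ∀ g : G, ∃ (a₁ : Z →* Z) (a₂ : D →* D),
      (∀ d z, a₁ (θ d z) = θ (a₂ d) (a₁ z)) ∧
        ∀ z d x, g • φ (z, d) x = φ (a₁ z, a₂ d) (g • x)) :
    NormalizedRegular G X (Z ⋊[θ] D) := by
  have hbij : Function.Bijective fun n : Z ⋊[θ] D => φ (n.left, n.right) x₀ := by
    refine ⟨fun n m hnm => ?_, fun y => ?_⟩
    · have := (hreg x₀ (φ (m.left, m.right) x₀)).unique hnm rfl
      rw [Prod.mk.injEq] at this
      exact SemidirectProduct.ext this.1 this.2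
    · obtain ⟨⟨z, d⟩, hn, -⟩ := hreg x₀ y
      exact ⟨⟨z, d⟩, hn⟩
  refine normalizedRegular_of_equiv (Equiv.ofBijective _ hbij) fun g n => ?_
  obtain ⟨a₁, a₂, hθ, hg⟩ := h g
  obtain ⟨⟨u, e⟩, hue, -⟩ := hreg x₀ (g • x₀)
  have hψ : ∀ m : Z ⋊[θ] D, g • Equiv.ofBijective _ hbij m =
      Equiv.ofBijective _ hbij ⟨a₁ m.left * u, a₂ m.right * e⟩ := by
    intro m
    change g • φ (m.left, m.right) x₀ = φ ((a₁ m.left, a₂ m.right) * (u, e)) x₀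
    rw [hg, map_mul, Equiv.Perm.mul_apply, hue]
  -- Translating by `n` and then applying `g` leaves the factor `u` untwisted, whereas a translation
  -- after `g` twists `u` by `θ`; the first coordinate corrects this.
  refine ⟨⟨a₁ n.left * u * (θ (a₂ n.right) u)⁻¹, a₂ n.right⟩, fun m => ?_⟩
  rw [hψ, hψ, Equiv.symm_apply_apply]
  congr 1
  ext
  · simp only [SemidirectProduct.mul_left, map_mul, hθ]
    rw [mul_comm (θ (a₂ n.right) (a₁ m.left)) (θ (a₂ n.right) u), ← mul_assoc,
      inv_mul_cancel_right, mul_right_comm]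
  · simp [mul_assoc]

/-- The action of `C_2` on `C_p × C_p` in which the generator inverts the second factor. -/
def sndInversionAction (p : ℕ) : CyclicGrp 2 →* MulAut (CyclicGrp p × CyclicGrp p) :=
  cyclicHom 2 ((MulEquiv.refl _).prodCongr (MulEquiv.inv (CyclicGrp p))) (by
    refine MulEquiv.ext fun x => Prod.ext rfl ?_
    exact inv_inv x.2)

lemma sndInversionAction_gen (p : ℕ) (z : CyclicGrp p × CyclicGrp p) :
    sndInversionAction p cyclicTwoGen z = (z.1, z.2⁻¹) := by
  rw [sndInversionAction, cyclicHom_gen]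
  rfl

/-! ### Classification of the groups of order `2p²` -/

/-- The groups of order `2 p ^ 2` with cyclic Sylow `p`-subgroup. -/
lemma nonempty_equiv_of_cyclic_subgroup_of_natCard_eq {p : ℕ} (hp : p.Prime) (hp2 : p ≠ 2) {N : Type*} [Group N]
    (hN : Nat.card N = 2 * p ^ 2) {c τ : N} (hc : orderOf c = p ^ 2) (hτ : τ ^ 2 = 1)
    (hτc : τ ∉ Subgroup.zpowers c) (hconj : τ * c * τ⁻¹ ∈ Subgroup.zpowers c) :
    Nonempty (CyclicGrp (p ^ 2) × CyclicGrp 2 ≃* N) ∨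
      Nonempty (CyclicGrp (p ^ 2) ⋊[inversionAction _] CyclicGrp 2 ≃* N) := by
  have : Finite N := Nat.finite_of_card_ne_zero (by rw [hN]; have := hp.pos; positivity)
  have hcard : Nat.card N = 2 * Nat.card (CyclicGrp (p ^ 2)) := by rw [natCard_cyclicGrp, hN]
  have hf := cyclicHom_injective hc
  have hr := range_cyclicHom (p ^ 2) c (hc ▸ pow_orderOf_eq_one c)
  obtain ⟨k, hk⟩ := hconj
  change c ^ k = _ at hk
  have hττ : τ * τ = 1 := by rw [← pow_two, hτ]
  have hτi : τ⁻¹ = τ := inv_eq_of_mul_eq_one_left hττ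
  have hkk : c ^ (k * k) = c := by
    rw [zpow_mul, hk, conj_zpow, hk, hτi]
    simp only [mul_assoc, hττ, mul_one]
    rw [← mul_assoc, hττ, one_mul]
  -- Conjugation by the involution is `c ↦ c^k` with `k² ≡ 1` modulo `p²`. As `p` is odd it divides
  -- only one of `k - 1`, `k + 1`, so `k ≡ ±1` modulo `p²`.
  have hdvd : ((p ^ 2 : ℕ) : ℤ) ∣ (k - 1) * (k + 1) := by
    rw [← hc, orderOf_dvd_iff_zpow_eq_one, show (k - 1) * (k + 1) = k * k - 1 by ring, zpow_sub,
      hkk, zpow_one, mul_inv_cancel]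
  have hpp := Nat.prime_iff_prime_int.1 hp
  have hp3 : ¬ ((p : ℤ) ∣ k - 1 ∧ (p : ℤ) ∣ k + 1) := by
    rintro ⟨h1, h2⟩
    have h3 : (p : ℤ) ∣ (2 : ℕ) := by
      have := dvd_sub h2 h1
      norm_num at this ⊢
      convert this using 1
    exact hp2 ((Nat.prime_dvd_prime_iff_eq hp Nat.prime_two).1 (Int.natCast_dvd_natCast.1 h3))
  have key : ∀ m : ℤ, ((p ^ 2 : ℕ) : ℤ) ∣ k - m → ∀ l : ℤ, τ * c ^ l * τ⁻¹ = c ^ (m * l) := by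
    intro m hm l
    rw [← hc, orderOf_dvd_iff_zpow_eq_one, zpow_sub, mul_inv_eq_one] at hm
    rw [← conj_zpow, ← hk, hm, zpow_mul]
  by_cases h1 : (p : ℤ) ∣ k - 1
  · left
    have h2 : ((p ^ 2 : ℕ) : ℤ) ∣ k - 1 := by
      have h3 : IsCoprime ((p ^ 2 : ℕ) : ℤ) (k + 1) := by
        push_cast
        exact ((hpp.coprime_iff_not_dvd).2 fun h => hp3 ⟨h1, h⟩).pow_left
      exact h3.dvd_of_dvd_mul_right hdvd
    obtain ⟨e⟩ := nonempty_mulEquiv_semidirect 1 _ hf τ hτ (hr ▸ hτc) (fun z => by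
      obtain ⟨l, rfl⟩ := exists_intCast_eq z
      simp [cyclicHom_intCast, key 1 h2]) hcard
    exact ⟨SemidirectProduct.mulEquivProd.symm.trans e⟩
  · right
    have h2 : ((p ^ 2 : ℕ) : ℤ) ∣ k - (-1) := by
      have h3 : IsCoprime ((p ^ 2 : ℕ) : ℤ) (k - 1) := by
        push_cast
        exact ((hpp.coprime_iff_not_dvd).2 h1).pow_left
      rw [sub_neg_eq_add]
      exact h3.dvd_of_dvd_mul_left hdvd
    exact nonempty_mulEquiv_semidirect _ _ hf τ hτ (hr ▸ hτc) (fun z => by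
      obtain ⟨l, rfl⟩ := exists_intCast_eq z
      rw [inversionAction_gen, map_inv, cyclicHom_intCast, key (-1) h2, neg_one_mul, zpow_neg]) hcard

lemma range_cyclicPairHom_le {N : Type*} [Group N] {p : ℕ} {u v : N} (hu : u ^ p = 1)
    (hv : v ^ p = 1) (huv : Commute u v) {P : Subgroup N} (huP : u ∈ P) (hvP : v ∈ P) :
    (cyclicPairHom p u v hu hv huv).range ≤ P := by
  rintro _ ⟨⟨a, b⟩, rfl⟩
  obtain ⟨k, rfl⟩ := exists_intCast_eq a
  obtain ⟨l, rfl⟩ := exists_intCast_eq b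
  rw [cyclicPairHom_intCast]
  exact P.mul_mem (P.zpow_mem huP k) (P.zpow_mem hvP l)

/-- Classification of the groups of order `2 p ^ 2`. -/
theorem nonempty_equiv_of_natCard_eq_two_mul_prime_sq {p : ℕ} (hp : p.Prime) (hp2 : p ≠ 2) {N : Type*} [Group N]
    (hN : Nat.card N = 2 * p ^ 2) :
    Nonempty (CyclicGrp (p ^ 2) × CyclicGrp 2 ≃* N) ∨
    Nonempty (CyclicGrp (p ^ 2) ⋊[inversionAction _] CyclicGrp 2 ≃* N) ∨
    Nonempty ((CyclicGrp p × CyclicGrp p) × CyclicGrp 2 ≃* N) ∨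
    Nonempty ((CyclicGrp p × CyclicGrp p) ⋊[sndInversionAction p] CyclicGrp 2 ≃* N) ∨
    Nonempty (GenDihedralGrp p ≃* N) := by
  have := Fact.mk hp
  have hNf : Finite N := Nat.finite_of_card_ne_zero (by rw [hN]; have := hp.pos; positivity)
  obtain ⟨P, hP⟩ := Sylow.exists_subgroup_card_pow_prime p (G := N) (n := 2) (by
    rw [hN]; exact dvd_mul_left _ _)
  have hPi : P.index = 2 := by
    have h := P.card_mul_index
    rw [hP, hN, mul_comm] at h
    exact Nat.eq_of_mul_eq_mul_right (pow_pos hp.pos 2) h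
  have hPn : P.Normal := Subgroup.normal_of_index_eq_two hPi
  have hcomm : ∀ a ∈ P, ∀ b ∈ P, Commute a b := fun a ha b hb => by
    have := IsPGroup.isMulCommutative_of_card_eq_prime_sq hP
    exact congrArg Subtype.val (mul_comm' (⟨a, ha⟩ : P) ⟨b, hb⟩)
  obtain ⟨τ, hτ⟩ := exists_prime_orderOf_dvd_card' (G := N) 2 (by rw [hN]; exact dvd_mul_right _ _)
  have hodd : ∀ x ∈ P, x ^ 2 = 1 → x = 1 := fun x hx h2 => by
    have h3 : orderOf x ∣ 2 := orderOf_dvd_of_pow_eq_one h2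
    have h4 : orderOf x ∣ p ^ 2 := hP ▸ P.orderOf_dvd_natCard hx
    have h5 : Nat.Coprime 2 (p ^ 2) :=
      ((Nat.coprime_primes Nat.prime_two hp).2 hp2.symm).pow_right 2
    exact orderOf_eq_one_iff.1 (Nat.eq_one_of_dvd_coprimes h5 h3 h4)
  have hτ2 : τ ^ 2 = 1 := hτ ▸ pow_orderOf_eq_one τ
  have hτP : τ ∉ P := fun h => by
    rw [hodd τ h hτ2, orderOf_one] at hτ
    omega
  by_cases hcyc : ∃ c ∈ P, orderOf c = p ^ 2
  · obtain ⟨c, hcP, hc⟩ := hcyc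
    have hz : Subgroup.zpowers c = P :=
      Subgroup.eq_of_le_of_card_ge (by simpa using hcP) (by rw [Nat.card_zpowers, hc, hP])
    rcases nonempty_equiv_of_cyclic_subgroup_of_natCard_eq hp hp2 hN hc hτ2 (hz ▸ hτP)
      (hz ▸ hPn.conj_mem c hcP τ) with h | h
    · exact Or.inl h
    · exact Or.inr (Or.inl h)
  right; right
  have hexp : ∀ x ∈ P, x ^ p = 1 := fun x hx => by
    have h4 : orderOf x ∣ p ^ 2 := hP ▸ P.orderOf_dvd_natCard hx
    obtain ⟨k, hk, hxk⟩ := (Nat.dvd_prime_pow hp).1 h4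
    apply orderOf_dvd_iff_pow_eq_one.1
    rw [hxk]
    interval_cases k
    · simp
    · simp
    · exact absurd ⟨x, hx, hxk⟩ hcyc
  have hcard : Nat.card N = 2 * Nat.card (CyclicGrp p × CyclicGrp p) := by
    rw [Nat.card_prod, natCard_cyclicGrp, hN, pow_two]
  have main : ∀ (θ : CyclicGrp 2 →* MulAut (CyclicGrp p × CyclicGrp p)) (u v : N),
      (huP : u ∈ P) → (hvP : v ∈ P) → u ≠ 1 → v ∉ Subgroup.zpowers u →
      (∀ z, τ * cyclicPairHom p u v (hexp u huP) (hexp v hvP) (hcomm u huP v hvP) z * τ⁻¹ =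
        cyclicPairHom p u v (hexp u huP) (hexp v hvP) (hcomm u huP v hvP) (θ cyclicTwoGen z)) →
      Nonempty ((CyclicGrp p × CyclicGrp p) ⋊[θ] CyclicGrp 2 ≃* N) := by
    intro θ u v huP hvP hu1 hvu hconj
    exact nonempty_mulEquiv_semidirect θ _ (cyclicPairHom_injective hp _ _ _ hu1 hvu) τ hτ2
      (fun h => hτP (range_cyclicPairHom_le _ _ _ huP hvP h)) hconj hcard
  have hbasis : ∃ u ∈ P, ∃ v ∈ P, u ≠ 1 ∧ v ∉ Subgroup.zpowers u := by
    have h1 : P ≠ ⊥ := by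
      rintro rfl
      rw [Subgroup.card_bot] at hP
      exact absurd hP.symm (Nat.one_lt_pow two_ne_zero hp.one_lt).ne'
    obtain ⟨⟨u, hu⟩, hu1⟩ := Subgroup.ne_bot_iff_exists_ne_one.1 h1
    have hu1' : u ≠ 1 := fun h => hu1 (Subtype.ext h)
    refine ⟨u, hu, ?_⟩
    by_contra! hcon
    have hle : P ≤ Subgroup.zpowers u := fun v hv => hcon v hv hu1'
    have h2 := Nat.le_of_dvd Nat.card_pos (Subgroup.card_dvd_of_le hle)
    rw [hP, Nat.card_zpowers, orderOf_eq_prime (hexp u hu) hu1'] at h2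
    nlinarith [hp.one_lt]
  by_cases h1 : ∀ x ∈ P, τ * x * τ⁻¹ = x
  · obtain ⟨u, hu, v, hv, hu1, hvu⟩ := hbasis
    obtain ⟨e⟩ := main 1 u v hu hv hu1 hvu fun z =>
      h1 _ (range_cyclicPairHom_le _ _ _ hu hv ⟨z, rfl⟩)
    exact Or.inl ⟨SemidirectProduct.mulEquivProd.symm.trans e⟩
  right
  by_cases h2 : ∀ x ∈ P, τ * x * τ⁻¹ = x⁻¹
  · obtain ⟨u, hu, v, hv, hu1, hvu⟩ := hbasis
    refine Or.inr (main _ u v hu hv hu1 hvu fun z => ?_)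
    rw [inversionAction_gen, map_inv]
    exact h2 _ (range_cyclicPairHom_le _ _ _ hu hv ⟨z, rfl⟩)
  left
  push Not at h1 h2
  obtain ⟨a, ha, ha1⟩ := h1
  obtain ⟨b, hb, hb1⟩ := h2
  have hττ : τ * τ = 1 := by rw [← pow_two, hτ2]
  have hτi : τ⁻¹ = τ := inv_eq_of_mul_eq_one_left hττ
  have hinv : ∀ x, τ * (τ * x * τ⁻¹) * τ⁻¹ = x := fun x => by
    rw [hτi]
    simp only [mul_assoc, hττ, mul_one]
    rw [← mul_assoc, hττ, one_mul]
  have hbc := hPn.conj_mem b hb τ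
  have hac := hPn.conj_mem a ha τ
  -- Eigenvectors of conjugation by `τ`: the norm of `b` is fixed and the quotient of `a` by its
  -- conjugate is inverted. They are nontrivial because `b` is not inverted and `a` is not fixed.
  have huf : τ * (b * (τ * b * τ⁻¹)) * τ⁻¹ = b * (τ * b * τ⁻¹) := by
    rw [← conj_mul, hinv, (hcomm _ hbc _ hb).eq]
  have hvf : τ * (a * (τ * a * τ⁻¹)⁻¹) * τ⁻¹ = (a * (τ * a * τ⁻¹)⁻¹)⁻¹ := by
    rw [← conj_mul, ← conj_inv, hinv, mul_inv_rev, inv_inv]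
  have huP := P.mul_mem hb hbc
  have hvP := P.mul_mem ha (P.inv_mem hac)
  have hu1 : b * (τ * b * τ⁻¹) ≠ 1 := fun h => hb1 (inv_eq_of_mul_eq_one_right h).symm
  have hv1 : a * (τ * a * τ⁻¹)⁻¹ ≠ 1 := fun h => ha1 (mul_inv_eq_one.1 h).symm
  generalize b * (τ * b * τ⁻¹) = u at *
  generalize a * (τ * a * τ⁻¹)⁻¹ = v at *
  refine main _ u v huP hvP hu1 ?_ fun z => ?_
  -- A power of `u` is fixed by `τ`; if it is also inverted, its square is trivial, which is
  -- impossible for a nontrivial element of odd order.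
  · rintro ⟨k, rfl⟩
    apply hv1
    apply hodd _ hvP
    change τ * u ^ k * τ⁻¹ = (u ^ k)⁻¹ at hvf
    rw [← conj_zpow, huf, eq_inv_iff_mul_eq_one] at hvf
    rw [pow_two]
    exact hvf
  · obtain ⟨x, y⟩ := z
    obtain ⟨k, rfl⟩ := exists_intCast_eq x
    obtain ⟨l, rfl⟩ := exists_intCast_eq y
    rw [sndInversionAction_gen, ← ofAdd_neg, ← Int.cast_neg]
    dsimp only
    rw [cyclicPairHom_intCast,
      cyclicPairHom_intCast, ← conj_mul, ← conj_zpow, ← conj_zpow, huf, hvf, inv_zpow']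

section NamedGroups

lemma nonempty_dihedral_equiv (n : ℕ) [NeZero n] :
    Nonempty (CyclicGrp n ⋊[inversionAction _] CyclicGrp 2 ≃* DihedralGroup n) := by
  let f : CyclicGrp n →* DihedralGroup n :=
    { toFun z := DihedralGroup.r (Multiplicative.toAdd z)
      map_one' := rfl
      map_mul' _ _ := rfl }
  refine nonempty_mulEquiv_semidirect _ f ?_ (DihedralGroup.sr 0) ?_ ?_ ?_ ?_
  · intro a b h
    exact DihedralGroup.r.inj h
  · rw [pow_two]
    exact DihedralGroup.sr_mul_self 0
  · rintro ⟨z, hz⟩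
    nomatch (hz : DihedralGroup.r (Multiplicative.toAdd z) = DihedralGroup.sr 0)
  · intro z
    change DihedralGroup.sr 0 * DihedralGroup.r _ * (DihedralGroup.sr 0)⁻¹ = DihedralGroup.r _
    rw [DihedralGroup.inv_sr, DihedralGroup.sr_mul_r, DihedralGroup.sr_mul_sr]
    simp [inversionAction_gen]
  · rw [DihedralGroup.nat_card, natCard_cyclicGrp]

lemma nonempty_cyclic_equiv {n : ℕ} (hn : Odd n) :
    Nonempty (CyclicGrp n × CyclicGrp 2 ≃* CyclicGrp (2 * n)) := by
  have hc : Nat.Coprime 2 n := Nat.coprime_two_left.2 hn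
  exact ⟨(((AddEquiv.toMultiplicative (ZMod.chineseRemainder hc).toAddEquiv).trans
    (MulEquiv.prodMultiplicative _ _)).trans MulEquiv.prodComm).symm⟩

lemma nonempty_cyclic_prod_equiv {p : ℕ} (hp : Odd p) :
    Nonempty ((CyclicGrp p × CyclicGrp p) × CyclicGrp 2 ≃* CyclicGrp p × CyclicGrp (2 * p)) := by
  obtain ⟨e⟩ := nonempty_cyclic_equiv hp
  exact ⟨MulEquiv.prodAssoc.trans ((MulEquiv.refl _).prodCongr e)⟩

lemma nonempty_cyclic_prod_dihedral_equiv (p : ℕ) [NeZero p] :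
    Nonempty ((CyclicGrp p × CyclicGrp p) ⋊[sndInversionAction p] CyclicGrp 2 ≃*
      CyclicGrp p × DihedralGroup p) := by
  let f : CyclicGrp p × CyclicGrp p →* CyclicGrp p × DihedralGroup p :=
    (MonoidHom.id _).prodMap
    { toFun z := DihedralGroup.r (Multiplicative.toAdd z)
      map_one' := rfl
      map_mul' _ _ := rfl }
  refine nonempty_mulEquiv_semidirect _ f ?_ (1, DihedralGroup.sr 0) ?_ ?_ ?_ ?_
  · intro a b h
    have h' := Prod.mk.inj h
    exact Prod.ext h'.1 (DihedralGroup.r.inj h'.2)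
  · rw [pow_two]
    exact Prod.ext (one_mul _) (DihedralGroup.sr_mul_self 0)
  · rintro ⟨z, hz⟩
    nomatch (congrArg Prod.snd hz : DihedralGroup.r (Multiplicative.toAdd z.2) = DihedralGroup.sr 0)
  · intro z
    rw [sndInversionAction_gen]
    refine Prod.ext ?_ ?_
    · change 1 * z.1 * 1⁻¹ = z.1
      simp
    · change DihedralGroup.sr 0 * DihedralGroup.r _ * (DihedralGroup.sr 0)⁻¹ = DihedralGroup.r _
      rw [DihedralGroup.inv_sr, DihedralGroup.sr_mul_r, DihedralGroup.sr_mul_sr]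
      simp
  · rw [Nat.card_prod, Nat.card_prod, DihedralGroup.nat_card, natCard_cyclicGrp]
    ring

end NamedGroups

/-- The groups of order `2 p ^ 2`, up to isomorphism. -/
theorem groupIsoClass_of_natCard_eq {p : ℕ} (hp : p.Prime) (hp2 : p ≠ 2) {N : Type} [Group N]
    (hN : Nat.card N = 2 * p ^ 2) :
    groupIsoClass N = groupIsoClass (CyclicGrp (2 * p ^ 2)) ∨
    groupIsoClass N = groupIsoClass (DihedralGroup (p ^ 2)) ∨
    groupIsoClass N = groupIsoClass (CyclicGrp p × CyclicGrp (2 * p)) ∨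
    groupIsoClass N = groupIsoClass (CyclicGrp p × DihedralGroup p) ∨
    groupIsoClass N = groupIsoClass (GenDihedralGrp p) := by
  have := NeZero.mk hp.ne_zero
  have hodd := hp.odd_of_ne_two hp2
  have key : ∀ {S T : Type} [Group S] [Group T], Nonempty (S ≃* N) → Nonempty (S ≃* T) →
      groupIsoClass N = groupIsoClass T := fun ⟨e⟩ ⟨f⟩ => Quotient.sound ⟨e.symm.trans f⟩
  rcases nonempty_equiv_of_natCard_eq_two_mul_prime_sq hp hp2 hN with h | h | h | h | h
  · exact Or.inl (key h (nonempty_cyclic_equiv hodd.pow))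
  · exact Or.inr (Or.inl (key h (nonempty_dihedral_equiv _)))
  · exact Or.inr (Or.inr (Or.inl (key h (nonempty_cyclic_prod_equiv hodd))))
  · exact Or.inr (Or.inr (Or.inr (Or.inl (key h (nonempty_cyclic_prod_dihedral_equiv p)))))
  · exact Or.inr (Or.inr (Or.inr (Or.inr (key h ⟨MulEquiv.refl _⟩))))

/-! ### Automorphisms of extensions of `C_2` by a group of odd order -/

lemma eq_one_of_pow_eq_one_of_coprime {N : Type*} [Group N] {x : N} {m n : ℕ} (h : m.Coprime n)
    (hm : x ^ m = 1) (hn : x ^ n = 1) : x = 1 :=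
  orderOf_eq_one_iff.1 (Nat.eq_one_of_dvd_coprimes h (orderOf_dvd_of_pow_eq_one hm)
    (orderOf_dvd_of_pow_eq_one hn))

lemma cyclicTwo_pow_two (z : CyclicGrp 2) : z ^ 2 = 1 := by
  revert z
  decide

lemma eq_one_of_pow_odd {z : CyclicGrp 2} {m : ℕ} (hm : Odd m) (h : z ^ m = 1) : z = 1 :=
  eq_one_of_pow_eq_one_of_coprime (Nat.coprime_two_right.2 hm) h (cyclicTwo_pow_two z)

lemma eq_one_of_sq_eq_one {Z : Type*} [Group Z] (hZ : Odd (Nat.card Z)) {z : Z}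
    (h : z ^ 2 = 1) : z = 1 :=
  eq_one_of_pow_eq_one_of_coprime (Nat.coprime_two_left.2 hZ) h pow_card_eq_one'

/-- A homomorphism from a group of odd order to a group of order two is trivial. -/
lemma map_eq_one_of_odd {Z : Type*} [Group Z] (hZ : Odd (Nat.card Z)) (f : Z →* CyclicGrp 2)
    (z : Z) : f z = 1 :=
  eq_one_of_pow_odd hZ (by rw [← map_pow, pow_card_eq_one', map_one])

section SemidirectAut

variable {Z : Type*} [Group Z] {θ : CyclicGrp 2 →* MulAut Z}

/-- Homomorphisms to `C_2` kill `Z`, so the `C_2`-coordinate of `α n` depends only on that of `n`;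
being onto, this self-map of `C_2` is the identity. -/
lemma right_mulAut (hZ : Odd (Nat.card Z)) (α : MulAut (Z ⋊[θ] CyclicGrp 2))
    (n : Z ⋊[θ] CyclicGrp 2) : (α n).right = n.right := by
  let h : Z ⋊[θ] CyclicGrp 2 →* CyclicGrp 2 := SemidirectProduct.rightHom.comp α.toMonoidHom
  have h1 : ∀ n, h n = h (SemidirectProduct.inr n.right) := fun n => by
    conv_lhs => rw [← SemidirectProduct.inl_left_mul_inr_right n]
    rw [map_mul, show h (SemidirectProduct.inl n.left) = 1 from
      map_eq_one_of_odd hZ (h.comp SemidirectProduct.inl) _, one_mul]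
  change h n = n.right
  rw [h1]
  rcases cyclicTwo_eq n.right with hn | hn
  · rw [hn, map_one, map_one]
  · rw [hn]
    rcases cyclicTwo_eq (h (SemidirectProduct.inr cyclicTwoGen)) with h2 | h2
    · exfalso
      obtain ⟨m, hm⟩ := α.surjective (SemidirectProduct.inr cyclicTwoGen)
      have h3 : h m = cyclicTwoGen := by
        change (α m).right = _
        rw [hm]
        rfl
      rw [h1] at h3
      rcases cyclicTwo_eq m.right with h4 | h4
      · rw [h4, map_one, map_one] at h3
        exact cyclicTwoGen_ne_one h3.symm
      · rw [h4, h2] at h3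
        exact cyclicTwoGen_ne_one h3.symm
    · exact h2

lemma exists_left_mulAut (hZ : Odd (Nat.card Z)) (α : MulAut (Z ⋊[θ] CyclicGrp 2)) :
    ∃ a : Z →* Z, ∀ z, α (SemidirectProduct.inl z) = SemidirectProduct.inl (a z) := by
  have h : ∀ z, α (SemidirectProduct.inl z) =
      SemidirectProduct.inl (α (SemidirectProduct.inl z)).left := fun z =>
    SemidirectProduct.ext rfl (right_mulAut hZ α _)
  refine ⟨MonoidHom.mk' (fun z => (α (SemidirectProduct.inl z)).left) fun x y => ?_, h⟩
  apply SemidirectProduct.inl_injective (φ := θ)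
  rw [← h, map_mul, map_mul, map_mul, ← h, ← h]

end SemidirectAut

/-- An automorphism of `Z × C_2`, with `Z` of odd order, respects the decomposition. -/
lemma mulAut_prod_cyclicTwo {Z : Type*} [Group Z] (hZ : Odd (Nat.card Z))
    (α : MulAut (Z × CyclicGrp 2)) :
    (∀ z, (α (z, 1)).2 = 1) ∧ ∀ d, α (1, d) = (1, d) := by
  refine ⟨fun z => map_eq_one_of_odd hZ ((MonoidHom.snd _ _).comp
    (α.toMonoidHom.comp (MonoidHom.inl _ _))) z, fun d => ?_⟩
  have h1 : (α (1, d)).1 = 1 := eq_one_of_sq_eq_one hZ (by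
    rw [← Prod.pow_fst, ← map_pow, Prod.pow_mk, one_pow, cyclicTwo_pow_two, ← Prod.one_eq_mk,
      map_one]
    rfl)
  refine Prod.ext h1 ?_
  rcases cyclicTwo_eq d with rfl | rfl
  · rw [← Prod.one_eq_mk, map_one]
  · rcases cyclicTwo_eq (α (1, cyclicTwoGen)).2 with h | h
    · have h2 : α (1, cyclicTwoGen) = α 1 := by
        rw [map_one]
        exact Prod.ext h1 h
      exact absurd (congrArg Prod.snd (α.injective h2)) cyclicTwoGen_ne_one
    · exact h

/-! ### Replacing direct products by semidirect products -/

section NormalizedRegular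

/-- The conditions on `α` split each conjugation by `g` into maps of `Z` and of `D`, as
`normalizedRegular_semidirect` requires. -/
lemma NormalizedRegular.semidirect_of_mulAut {G X Z D : Type*} [Group G] [MulAction G X]
    [CommGroup Z] [Group D] (θ : D →* MulAut Z) (x₀ : X)
    (h : ∀ α : MulAut (Z × D), (∀ z, (α (z, 1)).2 = 1) ∧ (∀ d, (α (1, d)).1 = 1) ∧
      ∀ d z, (α (θ d z, 1)).1 = θ (α (1, d)).2 (α (z, 1)).1)
    (hN : NormalizedRegular G X (Z × D)) : NormalizedRegular G X (Z ⋊[θ] D) := by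
  obtain ⟨φ, hreg, hφ⟩ := hN
  obtain ⟨c, hc⟩ := NormalizedRegular.exists_conj hreg x₀ hφ
  refine normalizedRegular_semidirect θ hreg x₀ fun g => ?_
  obtain ⟨h1, h2, h3⟩ := h (c g)
  refine ⟨(MonoidHom.fst _ _).comp ((c g).toMonoidHom.comp (MonoidHom.inl _ _)),
    (MonoidHom.snd _ _).comp ((c g).toMonoidHom.comp (MonoidHom.inr _ _)), h3, fun z d x => ?_⟩
  rw [hc]
  congr 2
  have : ((z, d) : Z × D) = (z, 1) * (1, d) := by simp
  rw [this, map_mul]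
  refine Prod.ext ?_ ?_
  · rw [Prod.fst_mul, h2, mul_one]
    rfl
  · rw [Prod.snd_mul, h1, one_mul]
    rfl

/-- Automorphisms of `Z × C_2` preserve both factors because `Z` has odd order, and inversion on `Z`
commutes with all of them. -/
lemma NormalizedRegular.generalizedDihedral {G X : Type*} {Z : Type} [Group G] [MulAction G X]
    [CommGroup Z] (hZ : Odd (Nat.card Z)) (x₀ : X)
    (hN : NormalizedRegular G X (Z × CyclicGrp 2)) :
    NormalizedRegular G X (Z ⋊[inversionAction Z] CyclicGrp 2) := by
  refine hN.semidirect_of_mulAut _ x₀ fun α => ?_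
  obtain ⟨h1, h2⟩ := mulAut_prod_cyclicTwo hZ α
  refine ⟨h1, fun d => by rw [h2], fun d z => ?_⟩
  rw [h2]
  rcases cyclicTwo_eq d with rfl | rfl
  · simp
  · rw [inversionAction_gen, inversionAction_gen, ← Prod.fst_inv, ← map_inv, Prod.inv_mk, inv_one]

/-- A commutative group with a direct product decomposition, acting on itself, normalizes the
corresponding semidirect products. -/
lemma normalizedRegular_semidirect_self {G Z D : Type*} [CommGroup G] [CommGroup Z] [CommGroup D]
    (e : Z × D ≃* G) (θ : D →* MulAut Z) : NormalizedRegular G G (Z ⋊[θ] D) := by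
  refine normalizedRegular_semidirect θ
    (φ := (MulAction.toPermHom G G).comp e.toMonoidHom) (fun x y => ?_) 1 fun g =>
      ⟨MonoidHom.id _, MonoidHom.id _, fun _ _ => rfl, fun z d x => ?_⟩
  · refine ⟨e.symm (y * x⁻¹), ?_, fun n hn => ?_⟩
    · simp
    · rw [← hn]
      simp
  · simp [mul_left_comm]

/-- The sign homomorphism of a dihedral group. -/
def DihedralGroup.signHom (n : ℕ) : DihedralGroup n →* CyclicGrp 2 where
  toFun
    | .r _ => 1
    | .sr _ => cyclicTwoGen
  map_one' := rfl
  map_mul' x y := by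
    cases x <;> cases y <;>
      first | rfl | exact (by decide : (1 : CyclicGrp 2) = cyclicTwoGen * cyclicTwoGen)

/-- The automorphisms of `C_p × D_{2p}` respect the decomposition. -/
lemma mulAut_cyclic_prod_dihedral {p : ℕ} (hp : p.Prime) (hp2 : p ≠ 2)
    (α : MulAut (CyclicGrp p × DihedralGroup p)) :
    (∀ z, (α (z, 1)).2 = 1) ∧ (∀ d, (α (1, d)).1 = 1) ∧
      ∀ d, DihedralGroup.signHom p (α (1, d)).2 = DihedralGroup.signHom p d := by
  have := NeZero.mk hp.ne_zero
  have hodd := hp.odd_of_ne_two hp2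
  have hZ : Odd (Nat.card (CyclicGrp p)) := by rwa [natCard_cyclicGrp]
  have hsr : ∀ i : ZMod p, (DihedralGroup.sr i) ^ 2 = (1 : DihedralGroup p) := fun i => by
    rw [pow_two, DihedralGroup.sr_mul_self]
  have hr : ∀ i : ZMod p, DihedralGroup.r i = DihedralGroup.sr 0 * DihedralGroup.sr i := fun i => by
    simp
  -- Reflections generate the dihedral group and have order two, while `C_p` has no involution.
  have h2 : ∀ d, (α (1, d)).1 = 1 := by
    have h3 : ∀ i, (α (1, DihedralGroup.sr i)).1 = 1 := fun i => eq_one_of_sq_eq_one hZ (by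
      rw [← Prod.pow_fst, ← map_pow, Prod.pow_mk, one_pow, hsr, ← Prod.one_eq_mk, map_one]
      rfl)
    rintro (i | i)
    · have : ((1, DihedralGroup.r i) : CyclicGrp p × DihedralGroup p) =
        (1, DihedralGroup.sr 0) * (1, DihedralGroup.sr i) := by simp
      rw [this, map_mul, Prod.fst_mul, h3, h3, one_mul]
    · exact h3 i
  refine ⟨fun z => ?_, h2, ?_⟩
  -- The factor `C_p` is central, and `D_{2p}` has trivial center.
  · have hz : α (z, 1) ∈ Subgroup.center (CyclicGrp p × DihedralGroup p) := by
      rw [Subgroup.mem_center_iff]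
      intro g
      obtain ⟨g, rfl⟩ := α.surjective g
      rw [← map_mul, ← map_mul]
      congr 1
      exact Prod.ext (mul_comm _ _) (by simp)
    have hc : (α (z, 1)).2 ∈ Subgroup.center (DihedralGroup p) := by
      rw [Subgroup.mem_center_iff] at hz ⊢
      exact fun g => congrArg Prod.snd (hz (1, g))
    rwa [DihedralGroup.center_eq_bot_of_odd_ne_one hodd hp.one_lt.ne', Subgroup.mem_bot] at hc
  · rintro (i | i)
    · change _ = (1 : CyclicGrp 2)
      refine eq_one_of_pow_odd hodd ?_
      rw [← map_pow, ← Prod.pow_snd, ← map_pow, Prod.pow_mk, one_pow, DihedralGroup.r_pow]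
      simp [← Prod.one_eq_mk]
    · cases hd : (α (1, DihedralGroup.sr i)).2 with
      | sr j => rfl
      | r j =>
        exfalso
        have h4 : (α (1, DihedralGroup.sr i)) ^ 2 = 1 := by
          rw [← map_pow, Prod.pow_mk, hsr, one_pow, ← Prod.one_eq_mk, map_one]
        have h5 : DihedralGroup.r j = (1 : DihedralGroup p) := by
          refine eq_one_of_pow_eq_one_of_coprime (m := 2) (n := p) (Nat.coprime_two_left.2 hodd) ?_ ?_
          · rw [← hd, ← Prod.pow_snd, h4]
            rfl
          · rw [DihedralGroup.r_pow]
            rw [CharP.cast_eq_zero, mul_zero, DihedralGroup.one_def]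
        have h6 : α (1, DihedralGroup.sr i) = α 1 := by
          rw [map_one]
          exact Prod.ext (h2 _) (hd.trans h5)
        nomatch (congrArg Prod.snd (α.injective h6) : DihedralGroup.sr i = DihedralGroup.r 0)

/-- Rotations act trivially through the sign, and a reflection inverts both `C_p` and the rotations.
This presents the generalized dihedral group as a twist of `C_p × D_{2p}`. -/
lemma nonempty_semidirect_signHom_equiv (p : ℕ) [NeZero p] :
    Nonempty (GenDihedralGrp p ≃* CyclicGrp p ⋊[(inversionAction (CyclicGrp p)).comp
      (DihedralGroup.signHom p)] DihedralGroup p) := by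
  set θ := (inversionAction (CyclicGrp p)).comp (DihedralGroup.signHom p) with hθ
  have : Finite (CyclicGrp p ⋊[θ] DihedralGroup p) :=
    Finite.of_equiv _ (SemidirectProduct.equivProd (φ := θ)).symm
  have hr : ∀ i, θ (DihedralGroup.r i) = 1 := fun i => rfl
  have hs : ∀ z, θ (DihedralGroup.sr 0) z = z⁻¹ := fun z => rfl
  let f : CyclicGrp p × CyclicGrp p →* CyclicGrp p ⋊[θ] DihedralGroup p :=
    { toFun z := ⟨z.1, DihedralGroup.r (Multiplicative.toAdd z.2)⟩
      map_one' := rfl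
      map_mul' x y := by
        ext
        · simp [hr]
        · simp }
  refine nonempty_mulEquiv_semidirect _ f ?_ (SemidirectProduct.inr (DihedralGroup.sr 0)) ?_ ?_ ?_ ?_
  · intro a b h
    exact Prod.ext (congrArg SemidirectProduct.left h)
      (DihedralGroup.r.inj (congrArg SemidirectProduct.right h))
  · rw [← map_pow, pow_two, DihedralGroup.sr_mul_self, map_one]
  · rintro ⟨z, hz⟩
    nomatch (congrArg SemidirectProduct.right hz :
      DihedralGroup.r (Multiplicative.toAdd z.2) = DihedralGroup.sr 0)
  · intro z
    rw [inversionAction_gen]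
    refine SemidirectProduct.ext ?_ ?_
    · simp [f, hs]
    · change DihedralGroup.sr 0 * DihedralGroup.r _ * (DihedralGroup.sr 0)⁻¹ = DihedralGroup.r _
      rw [DihedralGroup.inv_sr, DihedralGroup.sr_mul_r, DihedralGroup.sr_mul_sr]
      simp
  · rw [SemidirectProduct.card, Nat.card_prod, DihedralGroup.nat_card, natCard_cyclicGrp]
    ring

lemma NormalizedRegular.genDihedral_of_cyclic_prod_dihedral {G X : Type*} [Group G] [MulAction G X]
    {p : ℕ} (hp : p.Prime) (hp2 : p ≠ 2) (x₀ : X)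
    (hN : NormalizedRegular G X (CyclicGrp p × DihedralGroup p)) :
    NormalizedRegular G X (GenDihedralGrp p) := by
  have := NeZero.mk hp.ne_zero
  obtain ⟨e⟩ := nonempty_semidirect_signHom_equiv p
  refine NormalizedRegular.of_mulEquiv (hN.semidirect_of_mulAut _ x₀ fun α => ?_) e.symm
  obtain ⟨h1, h2, h3⟩ := mulAut_cyclic_prod_dihedral hp hp2 α
  refine ⟨h1, h2, fun d z => ?_⟩
  rw [MonoidHom.comp_apply, MonoidHom.comp_apply, h3]
  rcases cyclicTwo_eq (DihedralGroup.signHom p d) with h | h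
  · rw [h]
    simp
  · rw [h, inversionAction_gen, inversionAction_gen, ← Prod.fst_inv, ← map_inv, Prod.inv_mk,
      inv_one]

end NormalizedRegular

/-! ### Moving a point by elements of `p`-power order -/

section Displacement

variable {G X N : Type*} [Group G] [MulAction G X] [Group N] {φ : N →* Equiv.Perm X}
  {c : G →* MulAut N}

/-- The powers of an element moving `x₀` inside an orbit of an abelian subgroup. -/
lemma pow_smul_eq_prod {V : Type*} [CommGroup V] {i : V →* N} {A : V →* V}
    (hc : ∀ g n x, g • φ n x = φ (c g n) (g • x)) {σ : G} (hA : ∀ v, c σ (i v) = i (A v)) {w : V}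
    {x₀ : X} (hw : σ • x₀ = φ (i w) x₀) (k : ℕ) :
    σ ^ k • x₀ = φ (i (∏ j ∈ Finset.range k, A^[j] w)) x₀ := by
  induction k with
  | zero => simp
  | succ k ih =>
    rw [pow_succ', mul_smul, ih, hc, hA, hw, ← Equiv.Perm.mul_apply, ← map_mul, ← map_mul,
      Finset.prod_range_succ', map_prod]
    simp only [Function.iterate_succ_apply', Function.iterate_zero_apply]

/-- Automorphisms preserve the `C_2`-coordinate, so `σ^k` displaces `x₀` by an element with
`C_2`-coordinate `n.right ^ k`; at the odd exponent `m` this is trivial. -/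
lemma right_eq_one_of_smul_eq {Z : Type*} [Group Z] {θ : CyclicGrp 2 →* MulAut Z}
    (hZ : Odd (Nat.card Z)) {φ : Z ⋊[θ] CyclicGrp 2 →* Equiv.Perm X}
    {c : G →* MulAut (Z ⋊[θ] CyclicGrp 2)} (hreg : ∀ x y, ∃! n, φ n x = y)
    (hc : ∀ g n x, g • φ n x = φ (c g n) (g • x)) {σ : G} {m : ℕ} (hm : Odd m) (hσ : σ ^ m = 1)
    {x₀ : X} {n : Z ⋊[θ] CyclicGrp 2} (hn : σ • x₀ = φ n x₀) : n.right = 1 := by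
  have h : ∀ k : ℕ, ∃ l, σ ^ k • x₀ = φ l x₀ ∧ l.right = n.right ^ k := by
    intro k
    induction k with
    | zero => exact ⟨1, by simp, by simp⟩
    | succ k ih =>
      obtain ⟨l, hl, hlr⟩ := ih
      refine ⟨c σ l * n, ?_, ?_⟩
      · rw [pow_succ', mul_smul, hl, hc, hn, map_mul, Equiv.Perm.mul_apply]
      · rw [SemidirectProduct.mul_right, right_mulAut hZ, hlr, pow_succ]
  obtain ⟨l, hl, hlr⟩ := h m
  rw [hσ, one_smul] at hl
  have hl1 : l = 1 := (hreg x₀ x₀).unique hl.symm (by simp)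
  refine eq_one_of_pow_odd hm ?_
  rw [← hlr, hl1]
  rfl

/-- In a transitive action, the orbits of a Sylow `p`-subgroup are divisible by the powers of `p`
dividing the degree. -/
lemma pow_dvd_natCard_orbit_sylow [Finite G] [MulAction.IsPretransitive G X] {p k : ℕ}
    [Fact p.Prime] (hk : p ^ k ∣ Nat.card X) (P : Sylow p G) (x₀ : X) :
    p ^ k ∣ Nat.card (MulAction.orbit P x₀) := by
  have h1 : Nat.card X * Nat.card (MulAction.stabilizer G x₀) = Nat.card G := by
    rw [← MulAction.index_stabilizer_of_transitive G x₀, mul_comm]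
    exact Subgroup.card_mul_index _
  have h2 : Nat.card (MulAction.orbit P x₀) * Nat.card (MulAction.stabilizer P x₀) =
      Nat.card P := by
    rw [← Nat.card_prod, Nat.card_congr (MulAction.orbitProdStabilizerEquivGroup P x₀)]
  have h3 : Nat.card (MulAction.stabilizer P x₀) ∣ Nat.card (MulAction.stabilizer G x₀) := by
    let f : MulAction.stabilizer P x₀ →* MulAction.stabilizer G x₀ :=
      { toFun s := ⟨s.1.1, s.2⟩
        map_one' := rfl
        map_mul' _ _ := rfl }
    refine Subgroup.card_dvd_of_injective f fun s t h => ?_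
    exact Subtype.ext (Subtype.ext (Subtype.mk.inj h))
  obtain ⟨t, ht⟩ := (IsPGroup.iff_card (p := p)).1 (P.isPGroup'.to_subgroup
    (MulAction.stabilizer P x₀))
  -- The point stabilizer in `P` has order `p^t`, so `p^k · p^t` divides `|X| |Stab_G| = |G|`, hence
  -- also `|P| = |orbit| · p^t`.
  have h4 : p ^ (k + t) ∣ Nat.card P := by
    refine P.pow_dvd_card_of_pow_dvd_card ?_
    rw [pow_add, ← h1, ← ht]
    exact mul_dvd_mul hk h3
  rw [← h2, ht, pow_add] at h4
  exact Nat.dvd_of_mul_dvd_mul_right (pow_pos (Fact.out : p.Prime).pos t) h4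

/-- If a transitive group normalizes a regular group with a normal subgroup of order `p ^ 2` and
index two, its elements of `p`-power order are transitive on an orbit of this subgroup. -/
lemma exists_pow_eq_one_and_smul_eq [Finite G] [MulAction.IsPretransitive G X] {p : ℕ}
    (hp : p.Prime) (hp2 : p ≠ 2)
    {Z : Type*} [Group Z] {θ : CyclicGrp 2 →* MulAut Z} (hZ : Nat.card Z = p ^ 2)
    {φ : Z ⋊[θ] CyclicGrp 2 →* Equiv.Perm X}
    {c : G →* MulAut (Z ⋊[θ] CyclicGrp 2)} (hreg : ∀ x y, ∃! n, φ n x = y)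
    (hc : ∀ g n x, g • φ n x = φ (c g n) (g • x)) (x₀ : X) (z : Z) :
    ∃ (σ : G) (t : ℕ), σ ^ p ^ t = 1 ∧ σ • x₀ = φ (SemidirectProduct.inl z) x₀ := by
  have := Fact.mk hp
  have hodd := hp.odd_of_ne_two hp2
  have hZo : Odd (Nat.card Z) := hZ ▸ hodd.pow
  have hZf : Finite Z := Nat.finite_of_card_ne_zero (by rw [hZ]; exact (pow_pos hp.pos 2).ne')
  have hbij : Function.Bijective fun n => φ n x₀ :=
    ⟨fun n m h => (hreg x₀ (φ m x₀)).unique h rfl, fun y => (hreg x₀ y).exists⟩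
  have hX : p ^ 2 ∣ Nat.card X := by
    rw [← Nat.card_congr (Equiv.ofBijective _ hbij), SemidirectProduct.card, hZ]
    exact dvd_mul_right _ _
  obtain ⟨P⟩ : Nonempty (Sylow p G) := inferInstance
  have hP : ∀ σ : P, ∃ t : ℕ, (σ : G) ^ p ^ t = 1 := fun σ => by
    obtain ⟨t, ht⟩ := P.isPGroup' σ
    exact ⟨t, congrArg Subtype.val ht⟩
  have hsub : MulAction.orbit P x₀ ⊆ Set.range fun z => φ (SemidirectProduct.inl z) x₀ := by
    rintro _ ⟨σ, rfl⟩
    obtain ⟨t, ht⟩ := hP σ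
    obtain ⟨n, hn, -⟩ := hreg x₀ ((σ : G) • x₀)
    have hr := right_eq_one_of_smul_eq hZo hreg hc hodd.pow ht hn.symm
    refine ⟨n.left, ?_⟩
    change φ (SemidirectProduct.inl n.left) x₀ = (σ : G) • x₀
    rw [← hn]
    congr 2
    exact SemidirectProduct.ext rfl hr.symm
  -- The Sylow orbit lies in the `Z`-orbit, which has `p²` points; its own size is a positive
  -- multiple of `p²`, so the two coincide.
  have hfin : (Set.range fun z => φ (SemidirectProduct.inl (φ := θ) z) x₀).Finite :=
    Set.finite_range _
  have hcard : (Set.range fun z => φ (SemidirectProduct.inl (φ := θ) z) x₀).ncard ≤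
      (MulAction.orbit P x₀).ncard := by
    calc _ = (Set.univ : Set Z).ncard := by
          rw [← Set.image_univ]
          exact Set.ncard_image_of_injective _ fun a b h =>
            SemidirectProduct.inl_injective (hbij.1 h)
      _ = p ^ 2 := by rw [Set.ncard_univ, hZ]
      _ ≤ _ := by
          have : Finite (MulAction.orbit P x₀) := hfin.subset hsub
          have : Nonempty (MulAction.orbit P x₀) := ⟨⟨x₀, MulAction.mem_orbit_self x₀⟩⟩
          exact Nat.le_of_dvd Nat.card_pos (pow_dvd_natCard_orbit_sylow hX P x₀)
  have heq := Set.eq_of_subset_of_ncard_le hsub hcard hfin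
  obtain ⟨σ, hσ⟩ : φ (SemidirectProduct.inl z) x₀ ∈ MulAction.orbit P x₀ := heq ▸ ⟨z, rfl⟩
  obtain ⟨t, ht⟩ := hP σ
  exact ⟨σ, t, ht, hσ⟩

end Displacement

/-! ### The sums `1 + A + ⋯ + A^{p-1}` and the incompatibility of Sylow types -/

section Sums

/-- Modulo `p` the Frobenius gives `a = a^{p^t} = 1`. For `a = 1 + p b` and odd `p`, the sum is
congruent to `p` modulo `p²`. -/
lemma geom_sum_ne_zero_of_pow_eq_one {p t : ℕ} (hp : p.Prime) (hp2 : p ≠ 2) {a : ZMod (p ^ 2)}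
    (h : a ^ p ^ t = 1) : ∑ j ∈ Finset.range p, a ^ j ≠ 0 := by
  have := Fact.mk hp
  obtain ⟨k, rfl⟩ := ZMod.intCast_surjective a
  have h1 : (k : ZMod p) = 1 := by
    have h2 := congrArg (ZMod.castHom (dvd_pow_self p two_ne_zero) (ZMod p)) h
    rwa [map_pow, map_intCast, map_one, ZMod.pow_card_pow] at h2
  obtain ⟨b, hb⟩ : (p : ℤ) ∣ k - 1 := by
    rw [← ZMod.intCast_zmod_eq_zero_iff_dvd]
    simp [h1]
  obtain rfl : k = 1 + p * b := by linarith
  intro h0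
  have h3 : ((p ^ 2 : ℕ) : ℤ) ∣ ∑ j ∈ Finset.range p, (1 + p * b : ℤ) ^ j := by
    rw [← ZMod.intCast_zmod_eq_zero_iff_dvd, ← h0]
    push_cast
    rfl
  have h4 := odd_sq_dvd_geom_sum₂_sub (R := ℤ) (a := 1) (b := b) (hp.odd_of_ne_two hp2)
  simp only [one_pow, mul_one] at h4
  push_cast at h3
  have h5 : (p : ℤ) ^ 2 ∣ p := by
    have := dvd_sub h3 h4
    simpa using this
  have h6 : p ^ 2 ∣ p := by exact_mod_cast h5
  have := Nat.le_of_dvd hp.pos h6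
  nlinarith [hp.one_lt]

/-- In characteristic `p`, `n = f - 1` is nilpotent, and dimension two forces `n² = 0`. Then `f^j =
1 + j n` and the sum is `p + (p(p-1)/2) n`, which vanishes for odd `p`. -/
lemma geom_sum_eq_zero_of_pow_eq_one {p t : ℕ} (hp : p.Prime) (hp2 : p ≠ 2) {V : Type*}
    [AddCommGroup V] [Module (ZMod p) V] [Fact p.Prime] [FiniteDimensional (ZMod p) V]
    (hV : Module.finrank (ZMod p) V = 2)
    {f : V →ₗ[ZMod p] V} (h : f ^ p ^ t = 1) : ∑ j ∈ Finset.range p, f ^ j = 0 := by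
  have hchar : CharP (Module.End (ZMod p) V) p := by
    have : Nontrivial V := Module.nontrivial_of_finrank_pos (R := ZMod p) (by omega)
    exact charP_of_injective_algebraMap (algebraMap (ZMod p) (Module.End (ZMod p) V)).injective p
  set n : Module.End (ZMod p) V := f - 1 with hn
  have hf : f = 1 + n := by rw [hn]; abel
  have hnil : IsNilpotent n := by
    refine ⟨p ^ t, ?_⟩
    rw [hn, sub_pow_char_pow_of_commute _ _ (Commute.one_right f), h, one_pow, sub_self]
  have hn2 : n * n = 0 := by
    have h2 := LinearMap.aeval_self_charpoly n
    rw [IsNilpotent.charpoly_eq_X_pow_finrank hnil, hV] at h2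
    simpa [pow_two] using h2
  have hpow : ∀ j : ℕ, f ^ j = 1 + (j : Module.End (ZMod p) V) * n := by
    intro j
    induction j with
    | zero => simp
    | succ j ih =>
      rw [pow_succ, ih, hf]
      have : (j : Module.End (ZMod p) V) * n * n = 0 := by rw [mul_assoc, hn2, mul_zero]
      push_cast
      rw [add_mul, mul_add, mul_add, this]
      noncomm_ring
  have hs : (∑ j ∈ Finset.range p, (j : Module.End (ZMod p) V)) = 0 := by
    rw [← Nat.cast_sum, CharP.cast_eq_zero_iff _ p]
    have h2 := Finset.sum_range_id_mul_two p
    have h3 : p ∣ (∑ j ∈ Finset.range p, j) * 2 := h2 ▸ dvd_mul_right _ _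
    rcases hp.dvd_mul.1 h3 with h4 | h4
    · exact h4
    · exact absurd ((Nat.prime_dvd_prime_iff_eq hp Nat.prime_two).1 h4) hp2
  simp_rw [hpow]
  rw [Finset.sum_add_distrib, ← Finset.sum_mul, hs, zero_mul, add_zero]
  simp

lemma sum_iterate_eq_zero {p t : ℕ} (hp : p.Prime) (hp2 : p ≠ 2) {V : Type*} [AddCommGroup V]
    [Module (ZMod p) V] (hV : Nat.card V = p ^ 2) {A : V →+ V}
    (hA : ∀ v, A^[p ^ t] v = v) (w : V) : ∑ j ∈ Finset.range p, A^[j] w = 0 := by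
  have := Fact.mk hp
  have : Finite V := Nat.finite_of_card_ne_zero (by rw [hV]; exact (pow_pos hp.pos 2).ne')
  have hfr : Module.finrank (ZMod p) V = 2 := by
    have h := Module.natCard_eq_pow_finrank (K := ZMod p) (V := V)
    rw [Nat.card_zmod] at h
    exact (Nat.pow_right_injective hp.two_le (hV.symm.trans h)).symm
  let f : Module.End (ZMod p) V := AddMonoidHom.toZModLinearMap p A
  have hf : ∀ (j : ℕ) (v : V), (f ^ j) v = A^[j] v := fun j v => Module.End.pow_apply f j v
  have h1 : f ^ p ^ t = 1 := LinearMap.ext fun v => (hf _ v).trans (hA v)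
  have h2 := LinearMap.congr_fun (geom_sum_eq_zero_of_pow_eq_one hp hp2 hfr h1) w
  rw [LinearMap.sum_apply] at h2
  simp only [hf] at h2
  exact h2

lemma prod_iterate_eq_one {p t : ℕ} (hp : p.Prime) (hp2 : p ≠ 2) {V : Type*} [CommGroup V]
    (hV : Nat.card V = p ^ 2) (hexp : ∀ v : V, v ^ p = 1) {A : V →* V}
    (hA : ∀ v, A^[p ^ t] v = v) (w : V) : ∏ j ∈ Finset.range p, A^[j] w = 1 :=
  let _ : Module (ZMod p) (Additive V) := AddCommGroup.zmodModule hexp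
  sum_iterate_eq_zero (V := Additive V) hp hp2 hV (A := MonoidHom.toAdditive A) hA w

/-- An endomorphism of a cyclic group is multiplication by a scalar, here `f 1`, so the product is a
geometric sum in `ZMod (p ^ 2)`. -/
lemma prod_iterate_gen_ne_one {p t : ℕ} (hp : p.Prime) (hp2 : p ≠ 2)
    {A : CyclicGrp (p ^ 2) →* CyclicGrp (p ^ 2)}
    (hA : ∀ v, A^[p ^ t] v = v) :
    ∏ j ∈ Finset.range p, A^[j] (Multiplicative.ofAdd 1) ≠ 1 := by
  let f : ZMod (p ^ 2) →ₗ[ZMod (p ^ 2)] ZMod (p ^ 2) :=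
    AddMonoidHom.toZModLinearMap (p ^ 2) (AddMonoidHom.toMultiplicative.symm A)
  have hf : ∀ x : ZMod (p ^ 2), A (Multiplicative.ofAdd x) = Multiplicative.ofAdd (f 1 * x) := by
    intro x
    have h := f.map_smul x 1
    rw [smul_eq_mul, smul_eq_mul, mul_one, mul_comm] at h
    rw [← h]
    rfl
  have hj : ∀ j : ℕ, A^[j] (Multiplicative.ofAdd 1) = Multiplicative.ofAdd (f 1 ^ j) := by
    intro j
    induction j with
    | zero => simp
    | succ j ih => rw [Function.iterate_succ_apply', ih, hf, pow_succ' (f 1) j]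
  have h1 : f 1 ^ p ^ t = 1 := by
    have := hA (Multiplicative.ofAdd 1)
    rw [hj] at this
    exact Multiplicative.ofAdd.injective this
  simp_rw [hj]
  rw [← ofAdd_sum]
  exact fun h => geom_sum_ne_zero_of_pow_eq_one hp hp2 h1 (Multiplicative.ofAdd.injective h)

end Sums

/-- A transitive group cannot normalize both regular groups with cyclic and with elementary abelian
Sylow `p`-subgroups. -/
theorem not_normalizedRegular_cyclic_and_elementary {G X : Type*} [Group G] [MulAction G X]
    [Finite G] [MulAction.IsPretransitive G X] {p : ℕ} (hp : p.Prime) (hp2 : p ≠ 2)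
    {θ : CyclicGrp 2 →* MulAut (CyclicGrp (p ^ 2))}
    {θ' : CyclicGrp 2 →* MulAut (CyclicGrp p × CyclicGrp p)} (x₀ : X)
    (h : NormalizedRegular G X (CyclicGrp (p ^ 2) ⋊[θ] CyclicGrp 2))
    (h' : NormalizedRegular G X ((CyclicGrp p × CyclicGrp p) ⋊[θ'] CyclicGrp 2)) : False := by
  have := Fact.mk hp
  have hodd := hp.odd_of_ne_two hp2
  obtain ⟨φ, hreg, hφ⟩ := h
  obtain ⟨c, hc⟩ := NormalizedRegular.exists_conj hreg x₀ hφ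
  obtain ⟨φ', hreg', hφ'⟩ := h'
  obtain ⟨c', hc'⟩ := NormalizedRegular.exists_conj hreg' x₀ hφ'
  have hZ : Nat.card (CyclicGrp (p ^ 2)) = p ^ 2 := natCard_cyclicGrp _
  have hZ' : Nat.card (CyclicGrp p × CyclicGrp p) = p ^ 2 := by
    rw [Nat.card_prod, natCard_cyclicGrp, pow_two]
  -- `σ` moves `x₀` by the generator of the cyclic group. Computing `σ^p x₀` in the two regular
  -- groups gives contradictory answers: a moved point and `x₀` itself.
  obtain ⟨σ, t, hσ, hσx⟩ := exists_pow_eq_one_and_smul_eq hp hp2 hZ hreg hc x₀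
    (Multiplicative.ofAdd 1)
  have hiter : ∀ {N : Type} [Group N] {V : Type} [Group V] (c : G →* MulAut N) (i : V →* N)
      (A : V →* V), Function.Injective i → (∀ v, c σ (i v) = i (A v)) →
      ∀ v, A^[p ^ t] v = v := by
    intro N _ V _ c i A hi hA v
    apply hi
    have : ∀ k : ℕ, (c (σ ^ k)) (i v) = i (A^[k] v) := fun k => by
      induction k with
      | zero => simp
      | succ k ih => rw [pow_succ', map_mul, MulAut.mul_apply, ih, hA, Function.iterate_succ_apply']
    rw [← this, hσ, map_one, MulAut.one_apply]
  obtain ⟨A, hA⟩ := exists_left_mulAut (by rw [hZ]; exact hodd.pow) (c σ)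
  obtain ⟨A', hA'⟩ := exists_left_mulAut (by rw [hZ']; exact hodd.pow) (c' σ)
  have e1 := pow_smul_eq_prod hc hA hσx p
  obtain ⟨n, hn, -⟩ := hreg' x₀ (σ • x₀)
  have hn' : σ • x₀ = φ' (SemidirectProduct.inl n.left) x₀ := by
    rw [← hn]
    congr 2
    exact SemidirectProduct.ext rfl
      (right_eq_one_of_smul_eq (by rw [hZ']; exact hodd.pow) hreg' hc' hodd.pow hσ hn.symm)
  have e2 := pow_smul_eq_prod hc' hA' hn' p
  have hexp : ∀ v : CyclicGrp p × CyclicGrp p, v ^ p = 1 := fun v =>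
    Prod.ext (by simpa using pow_card_eq_one' (x := v.1))
      (by simpa using pow_card_eq_one' (x := v.2))
  rw [prod_iterate_eq_one hp hp2 hZ' hexp
    (hiter c' _ A' SemidirectProduct.inl_injective hA'), map_one, map_one,
    Equiv.Perm.one_apply] at e2
  have h1 : ∏ j ∈ Finset.range p, A^[j] (Multiplicative.ofAdd 1) = 1 := by
    apply SemidirectProduct.inl_injective (φ := θ)
    exact (hreg x₀ x₀).unique (e1.symm.trans e2) (by simp)
  exact prod_iterate_gen_ne_one hp hp2 (hiter c _ A SemidirectProduct.inl_injective hA) h1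

/-! ### Fixed points as subgroups -/

section FixedPoints

variable {G X N : Type*} [Group G] [MulAction G X] [Group N]

lemma NormalizedRegular.natCard_eq (h : NormalizedRegular G X N) (x₀ : X) :
    Nat.card N = Nat.card X := by
  obtain ⟨φ, hreg, -⟩ := h
  exact Nat.card_congr (Equiv.ofBijective (fun n => φ n x₀)
    ⟨fun n m h => (hreg x₀ (φ m x₀)).unique h rfl, fun y => (hreg x₀ y).exists⟩)

/-- An element with a fixed point acts like an automorphism of a normalized regular group. -/
lemma NormalizedRegular.exists_mulAut (h : NormalizedRegular G X N) {x₀ : X} :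
    ∃ (c : G →* MulAut N) (ψ : N ≃ X), ∀ γ : G, γ • x₀ = x₀ → ∀ n, γ • ψ n = ψ (c γ n) := by
  obtain ⟨φ, hreg, hφ⟩ := h
  obtain ⟨c, hc⟩ := NormalizedRegular.exists_conj hreg x₀ hφ
  refine ⟨c, Equiv.ofBijective (fun n => φ n x₀)
    ⟨fun n m h => (hreg x₀ (φ m x₀)).unique h rfl, fun y => (hreg x₀ y).exists⟩,
    fun γ hγ n => ?_⟩
  change γ • φ n x₀ = φ (c γ n) x₀
  rw [hc, hγ]

/-- Fixed points become the fixed subgroup of an automorphism, so Lagrange's theorem restricts their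
number. -/
lemma natCard_fixed {ψ : N ≃ X} {γ : G} {α : MulAut N} (h : ∀ n, γ • ψ n = ψ (α n)) :
    Nat.card {x : X // γ • x = x} = Nat.card (α.toMonoidHom.eqLocus (MonoidHom.id N)) :=
  (Nat.card_congr (ψ.subtypeEquiv fun n => by
    rw [h, ψ.apply_eq_iff_eq]
    rfl)).symm

/-- The fixed subgroup contains the factor `C_2`, so its order is even. An order at least `|Z|`
allows only index one or two, and index two would give the odd order `|Z|`. -/
lemma NormalizedRegular.smul_eq_of_le_natCard_fixed {Z : Type*} [CommGroup Z] [Finite Z]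
    (hZ : Odd (Nat.card Z)) (h : NormalizedRegular G X (Z × CyclicGrp 2)) {γ : G} {x₀ : X}
    (hγ : γ • x₀ = x₀) (hcard : Nat.card Z ≤ Nat.card {x : X // γ • x = x}) (x : X) :
    γ • x = x := by
  obtain ⟨c, ψ, hψ⟩ := h.exists_mulAut (x₀ := x₀)
  rw [natCard_fixed (hψ γ hγ)] at hcard
  set S := (c γ).toMonoidHom.eqLocus (MonoidHom.id (Z × CyclicGrp 2)) with hS
  have hg : ((1, cyclicTwoGen) : Z × CyclicGrp 2) ∈ S := (mulAut_prod_cyclicTwo hZ (c γ)).2 _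
  have h2 : 2 ∣ Nat.card S := by
    have h3 : orderOf ((1, cyclicTwoGen) : Z × CyclicGrp 2) = 2 :=
      orderOf_eq_prime (Prod.ext (one_pow 2) (cyclicTwo_pow_two _))
        fun h => cyclicTwoGen_ne_one (congrArg Prod.snd h)
    exact h3.symm.dvd.trans (S.orderOf_dvd_natCard hg)
  have hi := S.card_mul_index
  rw [Nat.card_prod, natCard_cyclicGrp] at hi
  have hpos : 0 < Nat.card Z := Nat.card_pos
  have hi1 : S.index = 1 := by
    obtain ⟨k, hk⟩ := h2
    obtain ⟨l, hl⟩ := hZ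
    have h4 : S.index ≤ 2 := by
      by_contra! h
      nlinarith
    interval_cases S.index <;> omega
  have htop := Subgroup.index_eq_one.1 hi1
  obtain ⟨n, rfl⟩ := ψ.surjective x
  rw [hψ γ hγ]
  congr 1
  have : n ∈ S := htop ▸ Subgroup.mem_top n
  exact this

/-- On an invariant copy of `C_p`, `α` is multiplication by some `a` in the field with `p` elements,
and `a = a^p = 1`. -/
lemma mulAut_eq_self_of_pow_eq_one {p : ℕ} (hp : p.Prime) {α : MulAut N} (hα : α ^ p = 1)
    {i : CyclicGrp p →* N} (hi : Function.Injective i) (h : ∀ z, ∃ w, α (i z) = i w)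
    (z : CyclicGrp p) : α (i z) = i z := by
  have := Fact.mk hp
  choose b hb using h
  let B : CyclicGrp p →* CyclicGrp p := MonoidHom.mk' b fun x y => hi (by
    rw [← hb, map_mul, map_mul, hb, hb, map_mul])
  let f : ZMod p →ₗ[ZMod p] ZMod p :=
    AddMonoidHom.toZModLinearMap p (AddMonoidHom.toMultiplicative.symm B)
  have hf : ∀ x : ZMod p, b (Multiplicative.ofAdd x) = Multiplicative.ofAdd (f 1 * x) := by
    intro x
    have h := f.map_smul x 1
    rw [smul_eq_mul, smul_eq_mul, mul_one, mul_comm] at h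
    rw [← h]
    rfl
  have hj : ∀ j : ℕ, (α ^ j) (i (Multiplicative.ofAdd 1)) = i (Multiplicative.ofAdd (f 1 ^ j)) := by
    intro j
    induction j with
    | zero => simp
    | succ j ih => rw [pow_succ', MulAut.mul_apply, ih, hb, hf, pow_succ' (f 1) j]
  have h1 : f 1 = 1 := by
    have := hj p
    rw [hα, MulAut.one_apply, ZMod.pow_card] at this
    exact (Multiplicative.ofAdd.injective (hi this)).symm
  have := hf (Multiplicative.toAdd z)
  rw [h1, one_mul] at this
  rw [hb]
  exact congrArg i this

/-- The factor `C_p` and the rotations of `D_{2p}` are invariant under all automorphisms, so one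
with trivial `p`-th power fixes their product, of order `p²`, pointwise. -/
lemma NormalizedRegular.sq_le_natCard_fixed [Finite X] {p : ℕ} (hp : p.Prime) (hp2 : p ≠ 2)
    (h : NormalizedRegular G X (CyclicGrp p × DihedralGroup p)) {γ : G} {x₀ : X}
    (hγ : γ • x₀ = x₀) (hγp : γ ^ p = 1) : p ^ 2 ≤ Nat.card {x : X // γ • x = x} := by
  have := Fact.mk hp
  obtain ⟨c, ψ, hψ⟩ := h.exists_mulAut (x₀ := x₀)
  rw [natCard_fixed (hψ γ hγ)]
  obtain ⟨h1, h2, h3⟩ := mulAut_cyclic_prod_dihedral hp hp2 (c γ)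
  have hα : c γ ^ p = 1 := by rw [← map_pow, hγp, map_one]
  let r : CyclicGrp p →* DihedralGroup p :=
    { toFun z := DihedralGroup.r (Multiplicative.toAdd z)
      map_one' := rfl
      map_mul' _ _ := rfl }
  have hr : Function.Injective r := fun a b h => DihedralGroup.r.inj h
  have f1 : ∀ z : CyclicGrp p, c γ (z, 1) = (z, 1) :=
    mulAut_eq_self_of_pow_eq_one hp hα (i := MonoidHom.inl _ _)
      (fun a b h => congrArg Prod.fst h) fun z => ⟨(c γ (z, 1)).1, Prod.ext rfl (h1 z)⟩
  have f2 : ∀ z : CyclicGrp p, c γ (1, r z) = (1, r z) :=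
    mulAut_eq_self_of_pow_eq_one hp hα (i := (MonoidHom.inr _ _).comp r)
      (fun a b h => hr (congrArg Prod.snd h)) fun z => by
        have h4 := h3 (r z)
        change _ = (1 : CyclicGrp 2) at h4
        change ∃ w, c γ (1, r z) = (1, r w)
        cases hd : (c γ (1, r z)).2 with
        | r j => exact ⟨Multiplicative.ofAdd j, Prod.ext (h2 _) hd⟩
        | sr j =>
          rw [hd] at h4
          exact absurd h4 cyclicTwoGen_ne_one
  let F : CyclicGrp p × CyclicGrp p → (c γ).toMonoidHom.eqLocus (MonoidHom.id _) := fun z =>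
    ⟨(z.1, r z.2), by
      change c γ (z.1, r z.2) = (z.1, r z.2)
      have : ((z.1, r z.2) : CyclicGrp p × DihedralGroup p) = (z.1, 1) * (1, r z.2) := by simp
      rw [this, map_mul, f1, f2]⟩
  have hF : Function.Injective F := fun a b h => by
    have h := Prod.mk.inj (Subtype.mk.inj h)
    exact Prod.ext h.1 (hr h.2)
  have : Finite (CyclicGrp p × DihedralGroup p) := Finite.of_equiv X ψ.symm
  calc p ^ 2 = Nat.card (CyclicGrp p × CyclicGrp p) := by
        rw [Nat.card_prod, natCard_cyclicGrp, pow_two]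
    _ ≤ _ := Nat.card_le_card_of_injective F hF

/-- The symmetric group normalizes no regular group in degree at least five. -/
lemma not_normalizedRegular_perm {n : ℕ} (hn : 5 ≤ n) :
    ¬ NormalizedRegular (Equiv.Perm (Fin n)) (Fin n) N := by
  intro h
  let a : Fin n := ⟨0, by omega⟩
  let b : Fin n := ⟨1, by omega⟩
  let x₀ : Fin n := ⟨2, by omega⟩
  have hab : a ≠ b := by simp [a, b, Fin.ext_iff]
  obtain ⟨c, ψ, hψ⟩ := h.exists_mulAut (x₀ := x₀)
  have hγ : Equiv.swap a b • x₀ = x₀ :=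
    Equiv.swap_apply_of_ne_of_ne (by simp [a, x₀, Fin.ext_iff]) (by simp [b, x₀, Fin.ext_iff])
  have hcard := natCard_fixed (hψ _ hγ)
  have h1 : Nat.card {x : Fin n // Equiv.swap a b • x = x} = n - 2 := by
    have h2 : (Equiv.swap a b).supportᶜ.card = n - 2 := by
      rw [Finset.card_compl, Equiv.Perm.card_support_swap hab, Fintype.card_fin]
    rw [← h2, Nat.card_eq_fintype_card, Fintype.card_subtype]
    congr 1
    ext x
    simp
  -- A transposition has `n - 2` fixed points; this would have to divide `n`, hence `2`.
  have h3 := ((c (Equiv.swap a b)).toMonoidHom.eqLocus (MonoidHom.id N)).card_subgroup_dvd_card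
  rw [← hcard, h1, h.natCard_eq x₀, Nat.card_fin] at h3
  have h4 : n - 2 ∣ 2 := by
    have := Nat.dvd_sub h3 (dvd_refl (n - 2))
    rwa [Nat.sub_sub_self (by omega)] at this
  have := Nat.le_of_dvd two_pos h4
  omega

end FixedPoints

/-! ### Holomorphs and the types they exclude -/

section Holomorph

variable {N : Type} [Group N]

/-- The holomorph of `N` acts on `N`. -/
instance Holomorph.instMulAction : MulAction (Holomorph N) N where
  smul g x := g.left * g.right x
  one_smul x := by
    change (1 : N) * (1 : MulAut N) x = x
    simp
  mul_smul g h x := by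
    change (g.left * g.right h.left) * (g.right * h.right) x =
      g.left * g.right (h.left * h.right x)
    rw [MulAut.mul_apply, map_mul, mul_assoc]

lemma Holomorph.smul_def (g : Holomorph N) (x : N) : g • x = g.left * g.right x := rfl

instance Holomorph.instFaithfulSMul : FaithfulSMul (Holomorph N) N where
  eq_of_smul_eq_smul {g h} hgh := by
    have h1 : g.left = h.left := by simpa [Holomorph.smul_def] using hgh 1
    refine SemidirectProduct.ext h1 (MulEquiv.ext fun x => ?_)
    have h2 := hgh x
    rw [Holomorph.smul_def, Holomorph.smul_def, h1] at h2
    exact mul_left_cancel h2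

instance Holomorph.instIsPretransitive : MulAction.IsPretransitive (Holomorph N) N where
  exists_smul_eq x y := ⟨SemidirectProduct.inl (y * x⁻¹), by simp [Holomorph.smul_def]⟩

instance Holomorph.instFinite [Finite N] : Finite (Holomorph N) :=
  Finite.of_injective _ (MulAction.toPerm_injective (α := Holomorph N) (β := N))

lemma Holomorph.inr_smul (α : MulAut N) (x : N) :
    (SemidirectProduct.inr α : Holomorph N) • x = α x := by
  simp [Holomorph.smul_def]

lemma normalizedRegular_holomorph : NormalizedRegular (Holomorph N) N N := by
  refine ⟨MulAction.toPermHom N N, fun x y => ⟨y * x⁻¹, by simp, fun n hn => ?_⟩, fun g n =>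
    ⟨g.left * g.right n * g.left⁻¹, fun x => ?_⟩⟩
  · rw [← hn]
    simp
  · simp [Holomorph.smul_def, mul_assoc]

/-- Conjugation by `z` fixes the commutative group `Z` pointwise. In type `Z' × C_2` so many fixed
points force the identity, yet the generator of `C_2` is moved because `θ` moves `z`. -/
lemma not_normalizedRegular_holomorph_prod {Z Z' : Type*} [CommGroup Z] [CommGroup Z'] [Finite Z']
    {θ : CyclicGrp 2 →* MulAut Z} (e : Z ⋊[θ] CyclicGrp 2 ≃* N) [Finite N]
    (hZ : Nat.card Z = Nat.card Z') (hodd : Odd (Nat.card Z')) {z : Z}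
    (hz : θ cyclicTwoGen z ≠ z) : ¬ NormalizedRegular (Holomorph N) N (Z' × CyclicGrp 2) := by
  intro h
  let γ : Holomorph N := SemidirectProduct.inr (MulAut.conj (e (SemidirectProduct.inl z)))
  have hγ : ∀ x : Z ⋊[θ] CyclicGrp 2, γ • e x =
      e (SemidirectProduct.inl z * x * (SemidirectProduct.inl z)⁻¹) := fun x => by
    rw [Holomorph.inr_smul, MulAut.conj_apply, ← map_inv, ← map_mul, ← map_mul]
  have hle : Nat.card Z' ≤ Nat.card {x : N // γ • x = x} := by
    rw [← hZ]
    refine Nat.card_le_card_of_injective (fun w => ⟨e (SemidirectProduct.inl w), ?_⟩)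
      fun a b hab => SemidirectProduct.inl_injective (e.injective (congrArg Subtype.val hab))
    rw [hγ, ← map_inv, ← map_mul, ← map_mul, mul_comm z, mul_inv_cancel_right]
  have h1 := h.smul_eq_of_le_natCard_fixed hodd (γ := γ) (x₀ := 1)
    (by rw [Holomorph.inr_smul, map_one]) hle (e (SemidirectProduct.inr cyclicTwoGen))
  rw [hγ] at h1
  have h2 := congrArg SemidirectProduct.left (e.injective h1)
  simp [mul_inv_eq_one] at h2
  exact hz h2.symm

/-- A transvection of `C_p × C_p`. -/
def transvection (p : ℕ) : MulAut (CyclicGrp p × CyclicGrp p) where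
  toFun z := (z.1 * z.2, z.2)
  invFun z := (z.1 * z.2⁻¹, z.2)
  left_inv z := by simp
  right_inv z := by simp
  map_mul' x y := Prod.ext (mul_mul_mul_comm _ _ _ _) rfl

lemma transvection_apply (p : ℕ) (z : CyclicGrp p × CyclicGrp p) :
    transvection p z = (z.1 * z.2, z.2) := rfl

lemma transvection_pow (p : ℕ) : transvection p ^ p = 1 := by
  have h : ∀ (k : ℕ) z, (transvection p ^ k) z = (z.1 * z.2 ^ k, z.2) := by
    intro k
    induction k with
    | zero => simp
    | succ k ih =>
      intro z
      rw [pow_succ', MulAut.mul_apply, ih, transvection_apply, pow_succ, mul_assoc]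
  ext z
  · rw [h]
    have h2 : z.2 ^ p = 1 :=
      orderOf_dvd_iff_pow_eq_one.1 ((orderOf_dvd_natCard z.2).trans (natCard_cyclicGrp p).dvd)
    rw [h2, mul_one]
    rfl
  · rw [h]
    rfl

/-- A transvection commuting with `θ` extends to an automorphism with trivial `p`-th power and at
most `2p` fixed points, fewer than the `p²` that type `C_p × D_{2p}` would force. -/
lemma not_normalizedRegular_holomorph_cyclic_prod_dihedral {p : ℕ} (hp : p.Prime) (hp2 : p ≠ 2)
    {θ : CyclicGrp 2 →* MulAut (CyclicGrp p × CyclicGrp p)}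
    (hθ : ∀ d z, transvection p (θ d z) = θ d (transvection p z))
    (e : (CyclicGrp p × CyclicGrp p) ⋊[θ] CyclicGrp 2 ≃* N) [Finite N] :
    ¬ NormalizedRegular (Holomorph N) N (CyclicGrp p × DihedralGroup p) := by
  intro h
  have := NeZero.mk hp.ne_zero
  let β : MulAut ((CyclicGrp p × CyclicGrp p) ⋊[θ] CyclicGrp 2) :=
    SemidirectProduct.congr (transvection p) (MulEquiv.refl _) fun d => MulEquiv.ext (hθ d)
  have hβ : ∀ n, β n = ⟨transvection p n.left, n.right⟩ := fun n => rfl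
  have hβp : β ^ p = 1 := by
    have : ∀ (k : ℕ) n, (β ^ k) n = ⟨(transvection p ^ k) n.left, n.right⟩ := by
      intro k
      induction k with
      | zero => exact fun n => rfl
      | succ k ih =>
        intro n
        rw [pow_succ', MulAut.mul_apply, ih, hβ, pow_succ', MulAut.mul_apply]
    refine MulEquiv.ext fun n => ?_
    rw [this, transvection_pow]
    rfl
  let γ : Holomorph N := SemidirectProduct.inr (MulAut.congr e β)
  have hγ : ∀ x, γ • e x = e (β x) := fun x => by
    rw [Holomorph.inr_smul]
    change e (β (e.symm (e x))) = e (β x)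
    rw [e.symm_apply_apply]
  have hle := h.sq_le_natCard_fixed hp hp2 (γ := γ) (x₀ := 1)
    (by rw [Holomorph.inr_smul, map_one])
    (by rw [← map_pow, ← map_pow, hβp, map_one, map_one])
  have hlt : Nat.card {x : N // γ • x = x} ≤ Nat.card (CyclicGrp p × CyclicGrp 2) := by
    refine Nat.card_le_card_of_injective
      (fun x => ((e.symm x.1).left.1, (e.symm x.1).right)) ?_
    have hfix : ∀ x : {x : N // γ • x = x}, (e.symm x.1).left.2 = 1 := by
      rintro ⟨x, hx⟩
      obtain ⟨y, rfl⟩ := e.surjective x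
      rw [hγ] at hx
      have h1 := congrArg (fun n => n.left.1) (e.injective hx)
      simp only [hβ, transvection_apply] at h1
      simpa using h1
    intro x y hxy
    have h1 := Prod.mk.inj hxy
    refine Subtype.ext (e.symm.injective (SemidirectProduct.ext (Prod.ext h1.1 ?_) h1.2))
    rw [hfix, hfix]
  rw [Nat.card_prod, natCard_cyclicGrp, natCard_cyclicGrp] at hlt
  have : 3 ≤ p := (hp.two_le.lt_of_ne' hp2)
  nlinarith

end Holomorph

/-! ### Assembling the sets of types -/

section Types

lemma NormalizedRegular.of_groupIsoClass_eq {G X : Type*} [Group G] [MulAction G X] {N N' : Type}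
    [Group N] [Group N'] (h : NormalizedRegular G X N) (e : groupIsoClass N = groupIsoClass N') :
    NormalizedRegular G X N' :=
  let ⟨f⟩ : Nonempty (N ≃* N') := Quotient.exact e
  h.of_mulEquiv f

variable {G X : Type*} [Group G] [MulAction G X] {p : ℕ}

lemma NormalizedRegular.dihedral_of_cyclic (hp : p.Prime) (hp2 : p ≠ 2) (x₀ : X)
    (h : NormalizedRegular G X (CyclicGrp (2 * p ^ 2))) :
    NormalizedRegular G X (DihedralGroup (p ^ 2)) := by
  have := NeZero.mk hp.ne_zero
  have hodd : Odd (p ^ 2) := (hp.odd_of_ne_two hp2).pow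
  obtain ⟨e⟩ := nonempty_cyclic_equiv hodd
  obtain ⟨f⟩ := nonempty_dihedral_equiv (p ^ 2)
  exact ((h.of_mulEquiv e.symm).generalizedDihedral (by rwa [natCard_cyclicGrp]) x₀).of_mulEquiv f

lemma odd_natCard_cyclicGrp_prod (hp : p.Prime) (hp2 : p ≠ 2) :
    Odd (Nat.card (CyclicGrp p × CyclicGrp p)) := by
  rw [Nat.card_prod, natCard_cyclicGrp]
  exact (hp.odd_of_ne_two hp2).mul (hp.odd_of_ne_two hp2)

lemma NormalizedRegular.genDihedral_of_cyclic_prod_cyclic (hp : p.Prime) (hp2 : p ≠ 2) (x₀ : X)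
    (h : NormalizedRegular G X (CyclicGrp p × CyclicGrp (2 * p))) :
    NormalizedRegular G X (GenDihedralGrp p) := by
  obtain ⟨e⟩ := nonempty_cyclic_prod_equiv (hp.odd_of_ne_two hp2)
  exact (h.of_mulEquiv e.symm).generalizedDihedral (odd_natCard_cyclicGrp_prod hp hp2) x₀

lemma not_normalizedRegular_dihedral_and_genDihedral [Finite G] [MulAction.IsPretransitive G X]
    (hp : p.Prime) (hp2 : p ≠ 2) (x₀ : X) (h : NormalizedRegular G X (DihedralGroup (p ^ 2)))
    (h' : NormalizedRegular G X (GenDihedralGrp p)) : False := by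
  have := NeZero.mk hp.ne_zero
  obtain ⟨f⟩ := nonempty_dihedral_equiv (p ^ 2)
  exact not_normalizedRegular_cyclic_and_elementary hp hp2 x₀ (h.of_mulEquiv f.symm) h'

lemma NormalizedRegular.groupIsoClass_eq (hp : p.Prime) (hp2 : p ≠ 2) (x₀ : X)
    (hX : Nat.card X = 2 * p ^ 2) {N : Type} [Group N] (h : NormalizedRegular G X N) :
    groupIsoClass N = groupIsoClass (CyclicGrp (2 * p ^ 2)) ∨
    groupIsoClass N = groupIsoClass (DihedralGroup (p ^ 2)) ∨
    groupIsoClass N = groupIsoClass (CyclicGrp p × CyclicGrp (2 * p)) ∨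
    groupIsoClass N = groupIsoClass (CyclicGrp p × DihedralGroup p) ∨
    groupIsoClass N = groupIsoClass (GenDihedralGrp p) :=
  groupIsoClass_of_natCard_eq hp hp2 ((h.natCard_eq x₀).trans hX)

/-- To determine the set of types of the regular groups normalized by `G`, it suffices to consider
the five groups of order `2 p ^ 2`. -/
lemma eq_of_forall_normalizedRegular (hp : p.Prime) (hp2 : p ≠ 2) (x₀ : X)
    (hX : Nat.card X = 2 * p ^ 2) {T S : Set GroupIsoClass}
    (hT : ∀ t, t ∈ T → ∃ (N : Type) (_ : Group N), t = groupIsoClass N)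
    (hTN : ∀ (N : Type) [Group N], groupIsoClass N ∈ T ↔ NormalizedRegular G X N)
    (hS : ∀ t ∈ S, ∃ (N : Type) (_ : Group N), t = groupIsoClass N ∧ NormalizedRegular G X N)
    (hC : NormalizedRegular G X (CyclicGrp (2 * p ^ 2)) →
      groupIsoClass (CyclicGrp (2 * p ^ 2)) ∈ S)
    (hD : NormalizedRegular G X (DihedralGroup (p ^ 2)) → groupIsoClass (DihedralGroup (p ^ 2)) ∈ S)
    (hA : NormalizedRegular G X (CyclicGrp p × CyclicGrp (2 * p)) →
      groupIsoClass (CyclicGrp p × CyclicGrp (2 * p)) ∈ S)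
    (hM : NormalizedRegular G X (CyclicGrp p × DihedralGroup p) →
      groupIsoClass (CyclicGrp p × DihedralGroup p) ∈ S)
    (hGD : NormalizedRegular G X (GenDihedralGrp p) → groupIsoClass (GenDihedralGrp p) ∈ S) :
    T = S := by
  ext t
  constructor
  · intro ht
    obtain ⟨N, _, rfl⟩ := hT t ht
    have h := (hTN N).1 ht
    rcases h.groupIsoClass_eq hp hp2 x₀ hX with e | e | e | e | e
    · exact e ▸ hC (h.of_groupIsoClass_eq e)
    · exact e ▸ hD (h.of_groupIsoClass_eq e)
    · exact e ▸ hA (h.of_groupIsoClass_eq e)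
    · exact e ▸ hM (h.of_groupIsoClass_eq e)
    · exact e ▸ hGD (h.of_groupIsoClass_eq e)
  · intro ht
    obtain ⟨N, _, rfl, h⟩ := hS t ht
    exact (hTN N).2 h

/-- The possible sets of types, in terms of normalized regular groups. -/
lemma types_mem_of_action [Finite G] [MulAction.IsPretransitive G X] (hp : p.Prime) (hp2 : p ≠ 2)
    (x₀ : X) (hX : Nat.card X = 2 * p ^ 2) {T : Set GroupIsoClass}
    (hT : ∀ t, t ∈ T → ∃ (N : Type) (_ : Group N), t = groupIsoClass N)
    (hTN : ∀ (N : Type) [Group N], groupIsoClass N ∈ T ↔ NormalizedRegular G X N)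
    (hne : T.Nonempty) :
    T ∈ ({ {groupIsoClass (DihedralGroup (p ^ 2))},
       {groupIsoClass (GenDihedralGrp p)},
       {groupIsoClass (DihedralGroup (p ^ 2)), groupIsoClass (CyclicGrp (2 * p ^ 2))},
       {groupIsoClass (GenDihedralGrp p), groupIsoClass (CyclicGrp p × CyclicGrp (2 * p))},
       {groupIsoClass (GenDihedralGrp p), groupIsoClass (CyclicGrp p × DihedralGroup p)},
       {groupIsoClass (GenDihedralGrp p), groupIsoClass (CyclicGrp p × CyclicGrp (2 * p)),
         groupIsoClass (CyclicGrp p × DihedralGroup p)} } : Set (Set GroupIsoClass)) := by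
  have key : ∀ {S : Set GroupIsoClass}, _ → _ → _ → _ → _ → _ → T = S :=
    fun {S} => eq_of_forall_normalizedRegular (S := S) hp hp2 x₀ hX hT hTN
  have hCD := NormalizedRegular.dihedral_of_cyclic (G := G) hp hp2 x₀
  have hAG := NormalizedRegular.genDihedral_of_cyclic_prod_cyclic (G := G) hp hp2 x₀
  have hMG := NormalizedRegular.genDihedral_of_cyclic_prod_dihedral (G := G) hp hp2 x₀
  have hDG := not_normalizedRegular_dihedral_and_genDihedral (G := G) hp hp2 x₀
  simp only [Set.mem_insert_iff, Set.mem_singleton_iff]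
  -- Exactly one of `D_{2p²}` and `(C_p × C_p) ⋊ C_2` occurs, since every other type forces one of
  -- them. The first leaves `C_{2p²}` free; the second leaves the other two elementary types free.
  by_cases hD : NormalizedRegular G X (DihedralGroup (p ^ 2))
  · have hG : ¬ NormalizedRegular G X (GenDihedralGrp p) := fun h => hDG hD h
    by_cases hC : NormalizedRegular G X (CyclicGrp (2 * p ^ 2))
    · right; right; left
      refine key ?_ (by simp) (by simp) (fun h => absurd (hAG h) hG) (fun h => absurd (hMG h) hG)
        fun h => absurd h hG
      rintro t (rfl | rfl)
      · exact ⟨_, _, rfl, hD⟩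
      · exact ⟨_, _, rfl, hC⟩
    · left
      refine key ?_ (fun h => absurd h hC) (by simp) (fun h => absurd (hAG h) hG)
        (fun h => absurd (hMG h) hG) fun h => absurd h hG
      rintro t rfl
      exact ⟨_, _, rfl, hD⟩
  · have hC : ¬ NormalizedRegular G X (CyclicGrp (2 * p ^ 2)) := fun h => hD (hCD h)
    have hG : NormalizedRegular G X (GenDihedralGrp p) := by
      obtain ⟨t, ht⟩ := hne
      obtain ⟨N, _, rfl⟩ := hT t ht
      have h := (hTN N).1 ht
      rcases h.groupIsoClass_eq hp hp2 x₀ hX with e | e | e | e | e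
      · exact absurd (h.of_groupIsoClass_eq e) hC
      · exact absurd (h.of_groupIsoClass_eq e) hD
      · exact hAG (h.of_groupIsoClass_eq e)
      · exact hMG (h.of_groupIsoClass_eq e)
      · exact h.of_groupIsoClass_eq e
    by_cases hA : NormalizedRegular G X (CyclicGrp p × CyclicGrp (2 * p))
    · by_cases hM : NormalizedRegular G X (CyclicGrp p × DihedralGroup p)
      · right; right; right; right; right
        refine key ?_ (fun h => absurd h hC) (fun h => absurd h hD) (by simp) (by simp) (by simp)
        rintro t (rfl | rfl | rfl)
        · exact ⟨_, _, rfl, hG⟩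
        · exact ⟨_, _, rfl, hA⟩
        · exact ⟨_, _, rfl, hM⟩
      · right; right; right; left
        refine key ?_ (fun h => absurd h hC) (fun h => absurd h hD) (by simp)
          (fun h => absurd h hM) (by simp)
        rintro t (rfl | rfl)
        · exact ⟨_, _, rfl, hG⟩
        · exact ⟨_, _, rfl, hA⟩
    · by_cases hM : NormalizedRegular G X (CyclicGrp p × DihedralGroup p)
      · right; right; right; right; left
        refine key ?_ (fun h => absurd h hC) (fun h => absurd h hD) (fun h => absurd h hA)
          (by simp) (by simp)
        rintro t (rfl | rfl)
        · exact ⟨_, _, rfl, hG⟩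
        · exact ⟨_, _, rfl, hM⟩
      · right; left
        refine key ?_ (fun h => absurd h hC) (fun h => absurd h hD) (fun h => absurd h hA)
          (fun h => absurd h hM) (by simp)
        rintro t rfl
        exact ⟨_, _, rfl, hG⟩

end Types

lemma typesOccur_of_action {p : ℕ} (hp : p.Prime) (hp2 : p ≠ 2) {G X : Type} [Group G] [Finite G]
    [MulAction G X] [FaithfulSMul G X] [MulAction.IsPretransitive G X] (x₀ : X)
    (hX : Nat.card X = 2 * p ^ 2) {S : Set GroupIsoClass}
    (hS : ∀ t ∈ S, ∃ (N : Type) (_ : Group N), t = groupIsoClass N ∧ NormalizedRegular G X N)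
    (hC : NormalizedRegular G X (CyclicGrp (2 * p ^ 2)) →
      groupIsoClass (CyclicGrp (2 * p ^ 2)) ∈ S)
    (hD : NormalizedRegular G X (DihedralGroup (p ^ 2)) → groupIsoClass (DihedralGroup (p ^ 2)) ∈ S)
    (hA : NormalizedRegular G X (CyclicGrp p × CyclicGrp (2 * p)) →
      groupIsoClass (CyclicGrp p × CyclicGrp (2 * p)) ∈ S)
    (hM : NormalizedRegular G X (CyclicGrp p × DihedralGroup p) →
      groupIsoClass (CyclicGrp p × DihedralGroup p) ∈ S)
    (hGD : NormalizedRegular G X (GenDihedralGrp p) → groupIsoClass (GenDihedralGrp p) ∈ S) :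
    TypesOccur (2 * p ^ 2) G S := by
  obtain ⟨K, L, _, _, _, hsep, hfin, hrank, hgal, hN⟩ := exists_field_extension_of_action G X x₀
  refine ⟨K, L, _, _, _, hsep, hrank.trans hX, hgal, ?_⟩
  exact eq_of_forall_normalizedRegular hp hp2 x₀ hX
    (fun t ht => exists_eq_of_mem_hopfGaloisTypes ht)
    (fun N _ => mem_hopfGaloisTypes_iff.trans (hN N)) hS hC hD hA hM hGD

theorem mainTheorem4 (p : ℕ) (hp : p.Prime) (hp2 : p ≠ 2) :
    -- the possible sets of types
    (∀ (K : Type u) (L : Type v) [Field K] [Field L] [Algebra K L] [Algebra.IsSeparable K L],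
      Module.finrank K L = 2 * p ^ 2 →
        IsEmpty (HopfGaloisStructure K L) ∨
        hopfGaloisTypes K L ∈
          ({ {groupIsoClass (DihedralGroup (p ^ 2))},
             {groupIsoClass (GenDihedralGrp p)},
             {groupIsoClass (DihedralGroup (p ^ 2)), groupIsoClass (CyclicGrp (2 * p ^ 2))},
             {groupIsoClass (GenDihedralGrp p), groupIsoClass (CyclicGrp p × CyclicGrp (2 * p))},
             {groupIsoClass (GenDihedralGrp p), groupIsoClass (CyclicGrp p × DihedralGroup p)},
             {groupIsoClass (GenDihedralGrp p), groupIsoClass (CyclicGrp p × CyclicGrp (2 * p)),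
               groupIsoClass (CyclicGrp p × DihedralGroup p)} } : Set (Set GroupIsoClass))) ∧
    -- every case occurs
    (∃ (K L : Type) (_ : Field K) (_ : Field L) (_ : Algebra K L),
      Algebra.IsSeparable K L ∧ Module.finrank K L = 2 * p ^ 2 ∧
      Nonempty ((GaloisClosure K L ≃ₐ[K] GaloisClosure K L) ≃* Equiv.Perm (Fin (2 * p ^ 2))) ∧
      IsEmpty (HopfGaloisStructure K L)) ∧
    TypesOccur (2 * p ^ 2) (Holomorph (DihedralGroup (p ^ 2)))
      {groupIsoClass (DihedralGroup (p ^ 2))} ∧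
    TypesOccur (2 * p ^ 2) (Holomorph (GenDihedralGrp p))
      {groupIsoClass (GenDihedralGrp p)} ∧
    TypesOccur (2 * p ^ 2) (CyclicGrp (2 * p ^ 2))
      {groupIsoClass (DihedralGroup (p ^ 2)), groupIsoClass (CyclicGrp (2 * p ^ 2))} ∧
    TypesOccur (2 * p ^ 2) (Holomorph (CyclicGrp p × CyclicGrp (2 * p)))
      {groupIsoClass (GenDihedralGrp p), groupIsoClass (CyclicGrp p × CyclicGrp (2 * p))} ∧
    TypesOccur (2 * p ^ 2) (Holomorph (CyclicGrp p × DihedralGroup p))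
      {groupIsoClass (GenDihedralGrp p), groupIsoClass (CyclicGrp p × DihedralGroup p)} ∧
    TypesOccur (2 * p ^ 2) (CyclicGrp p × CyclicGrp (2 * p))
      {groupIsoClass (GenDihedralGrp p), groupIsoClass (CyclicGrp p × CyclicGrp (2 * p)),
        groupIsoClass (CyclicGrp p × DihedralGroup p)} := by
  have hodd := hp.odd_of_ne_two hp2
  have h3 : 3 ≤ p := hp.two_le.lt_of_ne' hp2
  have : NeZero p := ⟨hp.ne_zero⟩
  have hF := Fact.mk hp
  have hZ := odd_natCard_cyclicGrp_prod hp hp2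
  have hZ1 : Odd (Nat.card (CyclicGrp (p ^ 2))) := by
    rw [natCard_cyclicGrp]
    exact hodd.pow
  have hcD : Nat.card (DihedralGroup (p ^ 2)) = 2 * p ^ 2 := DihedralGroup.nat_card
  have hcC : Nat.card (CyclicGrp (2 * p ^ 2)) = 2 * p ^ 2 := natCard_cyclicGrp _
  have hcA : Nat.card (CyclicGrp p × CyclicGrp (2 * p)) = 2 * p ^ 2 := by
    rw [Nat.card_prod, natCard_cyclicGrp, natCard_cyclicGrp]
    ring
  have hcM : Nat.card (CyclicGrp p × DihedralGroup p) = 2 * p ^ 2 := by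
    rw [Nat.card_prod, natCard_cyclicGrp, DihedralGroup.nat_card]
    ring
  have hcG : Nat.card (GenDihedralGrp p) = 2 * p ^ 2 := by
    rw [SemidirectProduct.card, Nat.card_prod, natCard_cyclicGrp, natCard_cyclicGrp]
    ring
  have hpos : 2 * p ^ 2 ≠ 0 := by positivity
  have : Finite (CyclicGrp (2 * p ^ 2)) := Nat.finite_of_card_ne_zero (hcC.trans_ne hpos)
  have : Finite (CyclicGrp p × CyclicGrp (2 * p)) := Nat.finite_of_card_ne_zero (hcA.trans_ne hpos)
  have : Finite (GenDihedralGrp p) := Nat.finite_of_card_ne_zero (hcG.trans_ne hpos)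
  obtain ⟨eC⟩ := nonempty_cyclic_equiv (n := p ^ 2) hodd.pow
  obtain ⟨eD⟩ := nonempty_dihedral_equiv (p ^ 2)
  obtain ⟨eA⟩ := nonempty_cyclic_prod_equiv hodd
  obtain ⟨eM⟩ := nonempty_cyclic_prod_dihedral_equiv p
  -- This supplies an element moved by inversion, for the conjugation argument in holomorphs.
  have hgen : ∀ {n : ℕ}, 3 ≤ n → (Multiplicative.ofAdd (1 : ZMod n))⁻¹ ≠ Multiplicative.ofAdd 1 := by
    intro n hn h
    have h1 : (-1 : ZMod n) = 1 := Multiplicative.ofAdd.injective h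
    have : Fact (2 < n) := ⟨hn⟩
    exact ZMod.neg_one_ne_one h1
  refine ⟨?_, ?_, ?_, ?_, ?_, ?_, ?_, ?_⟩
  · intro K L _ _ _ _ hrank
    have : FiniteDimensional K L := Module.finite_of_finrank_pos (by rw [hrank]; positivity)
    by_cases hE : IsEmpty (HopfGaloisStructure K L)
    · exact Or.inl hE
    right
    rw [not_isEmpty_iff] at hE
    obtain ⟨S⟩ := hE
    have hX : Nat.card (L →ₐ[K] GaloisClosure K L) = 2 * p ^ 2 := by
      rw [GaloisClosure.natCard_algHom, hrank]
    obtain ⟨⟨x₀⟩, -⟩ := Nat.card_ne_zero.1 (hX ▸ hpos)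
    exact types_mem_of_action (G := Gal(GaloisClosure K L/K)) hp hp2 x₀ hX
      (fun t ht => exists_eq_of_mem_hopfGaloisTypes ht) (fun N _ => mem_hopfGaloisTypes_iff)
      (hopfGaloisTypes_nonempty S)
  · obtain ⟨K, L, _, _, _, hsep, hfin, hrank, hgal, hN⟩ :=
      exists_field_extension_of_action (Equiv.Perm (Fin (2 * p ^ 2))) (Fin (2 * p ^ 2))
        ⟨0, by positivity⟩
    refine ⟨K, L, _, _, _, hsep, hrank.trans (Nat.card_fin _), hgal, ⟨fun S => ?_⟩⟩
    obtain ⟨T, hT⟩ := hopfGaloisTypes_nonempty S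
    obtain ⟨N, _, rfl⟩ := exists_eq_of_mem_hopfGaloisTypes hT
    exact not_normalizedRegular_perm (by nlinarith) ((hN N).1 (mem_hopfGaloisTypes_iff.1 hT))
  · have hD : NormalizedRegular (Holomorph (DihedralGroup (p ^ 2))) (DihedralGroup (p ^ 2))
      (DihedralGroup (p ^ 2)) := normalizedRegular_holomorph
    have hG := fun h => not_normalizedRegular_dihedral_and_genDihedral hp hp2 1 hD h
    refine typesOccur_of_action hp hp2 (1 : DihedralGroup (p ^ 2)) hcD ?_ (fun h => ?_) (by simp)
      (fun h => (hG (h.genDihedral_of_cyclic_prod_cyclic hp hp2 1)).elim)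
      (fun h => (hG (h.genDihedral_of_cyclic_prod_dihedral hp hp2 1)).elim)
      (fun h => (hG h).elim)
    · rintro t rfl
      exact ⟨_, _, rfl, hD⟩
    · exact absurd (h.of_mulEquiv eC.symm) (not_normalizedRegular_holomorph_prod eD rfl hZ1
        (z := Multiplicative.ofAdd 1) (hgen (by nlinarith)))
  · have hG : NormalizedRegular (Holomorph (GenDihedralGrp p)) (GenDihedralGrp p)
      (GenDihedralGrp p) := normalizedRegular_holomorph
    have hD := fun h => not_normalizedRegular_dihedral_and_genDihedral hp hp2 1 h hG
    refine typesOccur_of_action hp hp2 (1 : GenDihedralGrp p) hcG ?_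
      (fun h => (hD (h.dihedral_of_cyclic hp hp2 1)).elim) (fun h => (hD h).elim) (fun h => ?_)
      (fun h => ?_) (by simp)
    · rintro t rfl
      exact ⟨_, _, rfl, hG⟩
    · exact absurd (h.of_mulEquiv eA.symm) (not_normalizedRegular_holomorph_prod (MulEquiv.refl _)
        rfl hZ (z := (1, Multiplicative.ofAdd 1)) fun h => hgen h3 (congrArg Prod.snd h))
    -- Inversion commutes with every automorphism of `C_p × C_p`, in particular with the
    -- transvection.
    · refine absurd h (not_normalizedRegular_holomorph_cyclic_prod_dihedral hp hp2 (fun d z => ?_)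
        (MulEquiv.refl _))
      rcases cyclicTwo_eq d with rfl | rfl
      · simp
      · rw [inversionAction_gen, inversionAction_gen, map_inv]
  -- The trivial twist gives the regular action of the group on itself; this Galois case also has
  -- the dihedral type.
  · have hC : NormalizedRegular (CyclicGrp (2 * p ^ 2)) (CyclicGrp (2 * p ^ 2))
      (CyclicGrp (2 * p ^ 2)) :=
        (normalizedRegular_semidirect_self eC 1).of_mulEquiv
          (SemidirectProduct.mulEquivProd.trans eC)
    have hD := hC.dihedral_of_cyclic hp hp2 1
    have hG := fun h => not_normalizedRegular_dihedral_and_genDihedral hp hp2 1 hD h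
    refine typesOccur_of_action hp hp2 (1 : CyclicGrp (2 * p ^ 2)) hcC ?_ (by simp) (by simp)
      (fun h => (hG (h.genDihedral_of_cyclic_prod_cyclic hp hp2 1)).elim)
      (fun h => (hG (h.genDihedral_of_cyclic_prod_dihedral hp hp2 1)).elim)
      (fun h => (hG h).elim)
    rintro t (rfl | rfl)
    · exact ⟨_, _, rfl, hD⟩
    · exact ⟨_, _, rfl, hC⟩
  · have hA : NormalizedRegular (Holomorph (CyclicGrp p × CyclicGrp (2 * p)))
      (CyclicGrp p × CyclicGrp (2 * p)) (CyclicGrp p × CyclicGrp (2 * p)) :=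
        normalizedRegular_holomorph
    have hG := hA.genDihedral_of_cyclic_prod_cyclic hp hp2 1
    have hD := fun h => not_normalizedRegular_dihedral_and_genDihedral hp hp2 1 h hG
    refine typesOccur_of_action hp hp2 (1 : CyclicGrp p × CyclicGrp (2 * p)) hcA ?_
      (fun h => (hD (h.dihedral_of_cyclic hp hp2 1)).elim) (fun h => (hD h).elim) (by simp)
      (fun h => ?_) (by simp)
    · rintro t (rfl | rfl)
      · exact ⟨_, _, rfl, hG⟩
      · exact ⟨_, _, rfl, hA⟩
    · exact absurd h (not_normalizedRegular_holomorph_cyclic_prod_dihedral hp hp2 (θ := 1)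
        (fun d z => rfl) (SemidirectProduct.mulEquivProd.trans eA))
  · have hM : NormalizedRegular (Holomorph (CyclicGrp p × DihedralGroup p))
      (CyclicGrp p × DihedralGroup p) (CyclicGrp p × DihedralGroup p) :=
        normalizedRegular_holomorph
    have hG := hM.genDihedral_of_cyclic_prod_dihedral hp hp2 1
    have hD := fun h => not_normalizedRegular_dihedral_and_genDihedral hp hp2 1 h hG
    refine typesOccur_of_action hp hp2 (1 : CyclicGrp p × DihedralGroup p) hcM ?_
      (fun h => (hD (h.dihedral_of_cyclic hp hp2 1)).elim) (fun h => (hD h).elim) (fun h => ?_)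
      (by simp) (by simp)
    · rintro t (rfl | rfl)
      · exact ⟨_, _, rfl, hG⟩
      · exact ⟨_, _, rfl, hM⟩
    -- Only the second factor is inverted here, so the conjugating element is taken from it.
    · refine absurd (h.of_mulEquiv eA.symm) (not_normalizedRegular_holomorph_prod eM rfl hZ
        (z := (1, Multiplicative.ofAdd 1)) fun h => hgen h3 ?_)
      rw [sndInversionAction_gen] at h
      exact congrArg Prod.snd h
  · have hA : NormalizedRegular (CyclicGrp p × CyclicGrp (2 * p))
      (CyclicGrp p × CyclicGrp (2 * p)) (CyclicGrp p × CyclicGrp (2 * p)) :=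
        (normalizedRegular_semidirect_self eA 1).of_mulEquiv
          (SemidirectProduct.mulEquivProd.trans eA)
    -- A commutative group acting on itself has trivial conjugation action on its translations, so
    -- every action of `C_2` on `C_p × C_p` gives a normalized twist.
    have hM : NormalizedRegular (CyclicGrp p × CyclicGrp (2 * p))
      (CyclicGrp p × CyclicGrp (2 * p)) (CyclicGrp p × DihedralGroup p) :=
        (normalizedRegular_semidirect_self eA (sndInversionAction p)).of_mulEquiv eM
    have hG := hA.genDihedral_of_cyclic_prod_cyclic hp hp2 1
    have hD := fun h => not_normalizedRegular_dihedral_and_genDihedral hp hp2 1 h hG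
    refine typesOccur_of_action hp hp2 (1 : CyclicGrp p × CyclicGrp (2 * p)) hcA ?_
      (fun h => (hD (h.dihedral_of_cyclic hp hp2 1)).elim) (fun h => (hD h).elim) (by simp)
      (by simp) (by simp)
    rintro t (rfl | rfl | rfl)
    · exact ⟨_, _, rfl, hG⟩
    · exact ⟨_, _, rfl, hA⟩
    · exact ⟨_, _, rfl, hM⟩
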